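/- Let $\mathfrak g$ be a finite-dimensional complex reductive Lie algebra and $\mathfrak g'$ a reductive subalgebra. An element $H\in\mathfrak g$ is called hyperbolic if $\operatorname{ad}(H)\in\operatorname{End}(\mathfrak g)$ is diagonalizable with only real eigenvalues. For such an $H$ let $\mathfrak p(H)$, $\mathfrak l(H)$, $\mathfrak n^+(H)$ be the sums of the eigenspaces of $\operatorname{ad}(H)$ with eigenvalues $\ge 0$, $=0$, $>0$, respectively, so that $\mathfrak p(H)=\mathfrak l(H)+\mathfrak n^+(H)$. Suppose that the parabolic subalgebra $\mathfrak p$ of $\mathfrak g$ is $\mathfrak g'$-compatible, that is, $\mathfrak p=\mathfrak p(H)$ for some hyperbolic element $H$ of $\mathfrak g$ lying in $\mathfrak g'$; write $\mathfrak l=\mathfrak l(H)$, $\mathfrak n^+=\mathfrak n^+(H)$ and $\mathfrak p':=\mathfrak p\cap\mathfrak g'$. (1) For any finite-dimensional $\mathfrak p$-module $F$ and any finite-dimensional $\mathfrak p'$-module $F'$, $$\dim\operatorname{Hom}_{\mathfrak g'}\bigl(U(\mathfrak g')\otimes_{U(\mathfrak p')}F',\;U(\mathfrak g)\otimes_{U(\mathfrak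 p)}F\bigr)<\infty .$$ (2) Suppose moreover that $(\mathfrak g,\mathfrak g')$ is a symmetric pair (i.e. $\mathfrak g'=\mathfrak g^{\tau}$ for an automorphism $\tau$ of $\mathfrak g$ with $\tau^2=\mathrm{id}$) and that $\mathfrak n^+$ is abelian. Let $\mathfrak j$ be a Cartan subalgebra of $\mathfrak g$ contained in $\mathfrak l$, let $\Delta(\mathfrak n^+,\mathfrak j)$ be the set of weights of $\mathfrak j$ on $\mathfrak n^+$, and for $\alpha\in\Delta(\mathfrak n^+,\mathfrak j)$ and $\mu\in\mathfrak j^*$ put $\langle\mu,\alpha\rangle:=\mu(t_\alpha)$, where $t_\alpha\in\mathfrak j\cap[\mathfrak g,\mathfrak g]$ represents $\alpha$ through the Killing form. Then there is a real constant $C$ such that for every one-dimensional representation $\lambda:\mathfrak p\to\mathbb C$ with $\lambda\ll 0$, in the sense that $\operatorname{Re}\langle\lambda|_{\mathfrak j},\alpha\rangle<-C$ for all $\alpha\in\Delta(\mathfrak n^+,\mathfrak j)$, $$\sup_{F'}\dim\operatorname{Hom}_{\mathfrak g'}\bigl(U(\mathfrak g')\otimes_{U(\mathfrak p')}F',\;U(\mathfrak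 g)\otimes_{U(\mathfrak p)}\mathbb C_\lambda\bigr)=1,$$ where $F'$ runs over all finite-dimensional simple $\mathfrak p'$-modules. -/

import Mathlib

open scoped TensorProduct

universe u v w

noncomputable section

namespace GenVerma

section Induced

attribute [local instance 100] LieRing.ofAssociativeRing

variable {R : Type*} [CommRing R] {L : Type u} [LieRing L] [LieAlgebra R L]

/-- The algebra homomorphism `U(P) → U(L)` induced by the inclusion of a Lie subalgebra. -/
def uMap (P : LieSubalgebra R L) :
    UniversalEnvelopingAlgebra R P →ₐ[R] UniversalEnvelopingAlgebra R L :=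
  UniversalEnvelopingAlgebra.lift R ((UniversalEnvelopingAlgebra.ι R).comp P.incl)

/-- The action of `U(P)` on a `P`-module `F`. -/
def uAct (P : LieSubalgebra R L) (F : Type v) [AddCommGroup F] [Module R F]
    [LieRingModule P F] [LieModule R P F] :
    UniversalEnvelopingAlgebra R P →ₐ[R] Module.End R F :=
  UniversalEnvelopingAlgebra.lift R (LieModule.toEnd R P F)

variable (P : LieSubalgebra R L) (F : Type v) [AddCommGroup F] [Module R F]
  [LieRingModule P F] [LieModule R P F]

/-- The relations `(u a) ⊗ f = u ⊗ (a f)` with `a ∈ U(P)` that define `U(L) ⊗_{U(P)} F` as a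
quotient of `U(L) ⊗_R F`. -/
def relations : Submodule R (UniversalEnvelopingAlgebra R L ⊗[R] F) :=
  Submodule.span R {z | ∃ (u : UniversalEnvelopingAlgebra R L)
    (a : UniversalEnvelopingAlgebra R P) (f : F),
    z = (u * uMap P a) ⊗ₜ[R] f - u ⊗ₜ[R] (uAct P F a f)}

/-- The underlying module of `U(L) ⊗_{U(P)} F`. -/
def Induced : Type _ :=
  (UniversalEnvelopingAlgebra R L ⊗[R] F) ⧸ relations P F

instance : AddCommGroup (Induced P F) :=
  inferInstanceAs (AddCommGroup ((UniversalEnvelopingAlgebra R L ⊗[R] F) ⧸ relations P F))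

instance : Module R (Induced P F) :=
  inferInstanceAs (Module R ((UniversalEnvelopingAlgebra R L ⊗[R] F) ⧸ relations P F))

/-- The class of `u ⊗ f`. -/
def Induced.tmul (u : UniversalEnvelopingAlgebra R L) (f : F) : Induced P F :=
  (relations P F).mkQ (u ⊗ₜ[R] f)

/-- Left multiplication of `L` on `U(L) ⊗_R F` in the first factor. -/
def preAct : L →ₗ⁅R⁆ Module.End R (UniversalEnvelopingAlgebra R L ⊗[R] F) where
  toFun x := (LinearMap.mulLeft R (UniversalEnvelopingAlgebra.ι R x)).rTensor F
  map_add' x y := by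
    ext u f
    simp [add_mul, TensorProduct.add_tmul]
  map_smul' r x := by
    ext u f
    simp [TensorProduct.smul_tmul']
  map_lie' {x y} := by
    ext u f
    simp [LieRing.of_associative_ring_bracket, sub_mul, TensorProduct.sub_tmul, mul_assoc]

lemma relations_le (x : L) :
    relations P F ≤ (relations P F).comap (preAct F x : Module.End R _) := by
  refine Submodule.span_le.2 ?_
  rintro _ ⟨u, a, f, rfl⟩
  refine Submodule.subset_span ⟨UniversalEnvelopingAlgebra.ι R x * u, a, f, ?_⟩
  simp [preAct, mul_assoc]

/-- The action of `L` on `U(L) ⊗_{U(P)} F` by left multiplication. -/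
def act : L →ₗ⁅R⁆ Module.End R (Induced P F) where
  toFun x := (relations P F).mapQ (relations P F) (preAct F x) (relations_le P F x)
  map_add' x y := by
    refine Submodule.linearMap_qext _ (LinearMap.ext fun z => ?_)
    change (relations P F).mkQ (preAct F (x + y) z) = _
    rw [map_add, LinearMap.add_apply, map_add]
    rfl
  map_smul' r x := by
    refine Submodule.linearMap_qext _ (LinearMap.ext fun z => ?_)
    change (relations P F).mkQ (preAct F (r • x) z) = _
    rw [map_smul, LinearMap.smul_apply, map_smul]
    rfl
  map_lie' {x y} := by
    refine Submodule.linearMap_qext _ (LinearMap.ext fun z => ?_)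
    change (relations P F).mkQ (preAct F ⁅x, y⁆ z) = _
    rw [LieHom.map_lie, LieRing.of_associative_ring_bracket, LinearMap.sub_apply, map_sub]
    rfl

instance : LieRingModule L (Induced P F) := LieRingModule.compLieHom _ (act P F)

instance : LieModule R L (Induced P F) := LieModule.compLieHom _ (act P F)

/-- The action is `x · (u ⊗ f) = (x u) ⊗ f`. -/
lemma lie_tmul (x : L) (u : UniversalEnvelopingAlgebra R L) (f : F) :
    ⁅x, Induced.tmul P F u f⁆ = Induced.tmul P F (UniversalEnvelopingAlgebra.ι R x * u) f :=
  rfl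

/-- The one-dimensional module attached to a character `χ`, with underlying space `R`. -/
@[nolint unusedArguments]
def OneDim (_χ : LieAlgebra.LieCharacter R L) : Type _ := R

instance (χ : LieAlgebra.LieCharacter R L) : AddCommGroup (OneDim χ) :=
  inferInstanceAs (AddCommGroup R)

instance (χ : LieAlgebra.LieCharacter R L) : Module R (OneDim χ) :=
  inferInstanceAs (Module R R)

/-- `χ` as a representation on `R`: `x` acts by multiplication by `χ x`. -/
def oneDimAct (χ : LieAlgebra.LieCharacter R L) : L →ₗ⁅R⁆ Module.End R (OneDim χ) where
  toFun x := χ x • LinearMap.id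
  map_add' x y := by simp [add_smul]
  map_smul' r x := by simp [mul_smul]
  map_lie' {x y} := by
    rw [LieAlgebra.lieCharacter_apply_lie]
    refine LinearMap.ext fun z => ?_
    simp [LieRing.of_associative_ring_bracket, smul_smul, mul_comm]

instance (χ : LieAlgebra.LieCharacter R L) : LieRingModule L (OneDim χ) :=
  LieRingModule.compLieHom _ (oneDimAct χ)

instance (χ : LieAlgebra.LieCharacter R L) : LieModule R L (OneDim χ) :=
  LieModule.compLieHom _ (oneDimAct χ)

end Induced

section Parabolic

variable {g : Type u} [LieRing g] [LieAlgebra ℂ g]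

/-- `H` is hyperbolic: `ad H` is diagonalizable on `g` and all its eigenvalues are real. -/
def IsHyperbolic (H : g) : Prop :=
  (⨆ μ : ℂ, (LieAlgebra.ad ℂ g H).eigenspace μ) = ⊤ ∧
    ∀ μ : ℂ, (LieAlgebra.ad ℂ g H).HasEigenvalue μ → μ.im = 0

/-- The sum of the eigenspaces of `ad H` for the real eigenvalues in `S`; since `S` is closed
under addition, it is a Lie subalgebra. -/
def eigenSum (H : g) (S : AddSubsemigroup ℝ) : LieSubalgebra ℂ g where
  toSubmodule := ⨆ r : S, (LieAlgebra.ad ℂ g H).eigenspace ((r : ℝ) : ℂ)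
  lie_mem' {x y} hx hy := by
    change x ∈ ⨆ r : S, (LieAlgebra.ad ℂ g H).eigenspace ((r : ℝ) : ℂ) at hx
    change y ∈ ⨆ r : S, (LieAlgebra.ad ℂ g H).eigenspace ((r : ℝ) : ℂ) at hy
    change ⁅x, y⁆ ∈ ⨆ r : S, (LieAlgebra.ad ℂ g H).eigenspace ((r : ℝ) : ℂ)
    induction hx using Submodule.iSup_induction' with
    | zero => simp
    | add x₁ x₂ _ _ h₁ h₂ => rw [add_lie]; exact add_mem h₁ h₂
    | mem r x hx =>
      induction hy using Submodule.iSup_induction' with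
      | zero => simp
      | add y₁ y₂ _ _ h₁ h₂ => rw [lie_add]; exact add_mem h₁ h₂
      | mem s y hy =>
        refine Submodule.mem_iSup_of_mem (r + s) ?_
        rw [Module.End.mem_eigenspace_iff, LieAlgebra.ad_apply] at hx hy ⊢
        rw [leibniz_lie, hx, hy, smul_lie, lie_smul, ← add_smul]
        simp

/-- The parabolic subalgebra `p(H)`: sum of the eigenspaces with eigenvalue `≥ 0`. -/
def parabolic (H : g) : LieSubalgebra ℂ g :=
  eigenSum H ⟨Set.Ici 0, fun ha hb => add_nonneg (Set.mem_Ici.1 ha) (Set.mem_Ici.1 hb)⟩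

/-- The Levi part `l(H)` of `p(H)`: the centralizer of `H`. -/
def levi (H : g) : LieSubalgebra ℂ g :=
  eigenSum H ⟨{0}, fun {a b} ha hb => by
    rw [Set.mem_singleton_iff] at ha hb ⊢
    rw [ha, hb, add_zero]⟩

/-- The nilpotent part `n⁺(H)` of `p(H) = l(H) + n⁺(H)`: sum of the eigenspaces with eigenvalue `> 0`. -/
def nPlus (H : g) : LieSubalgebra ℂ g :=
  eigenSum H ⟨Set.Ioi 0, fun ha hb => add_pos (Set.mem_Ioi.1 ha) (Set.mem_Ioi.1 hb)⟩

/-- `p` is `g'`-compatible: it is `p(H)` for some hyperbolic element `H` of `g` lying in `g'`. -/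
def IsCompatible (g' p : LieSubalgebra ℂ g) : Prop :=
  ∃ H ∈ g', IsHyperbolic H ∧ p = parabolic H

/-- `p' = p ∩ g'`, as a subalgebra of `g'`. -/
abbrev inter (g' p : LieSubalgebra ℂ g) : LieSubalgebra ℂ g' := p.comap g'.incl

/-- `(g, g')` is a symmetric pair: `g'` is the fixed subalgebra of an involutive automorphism. -/
def IsSymmetricPair (g' : LieSubalgebra ℂ g) : Prop :=
  ∃ τ : g ≃ₗ⁅ℂ⁆ g, (∀ x, τ (τ x) = x) ∧ ∀ x, x ∈ g' ↔ τ x = x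

/-- `Δ(n, j)`: the weights of the subalgebra `j` acting by the bracket on `n`. -/
def weights (n j : LieSubalgebra ℂ g) : Set (Module.Dual ℂ j) :=
  {α | ∃ x ∈ n, x ≠ 0 ∧ ∀ h : j, ⁅(h : g), x⁆ = α h • x}

/-- `t = t_α` is the element of `j ∩ [g, g]` that represents the root `α` through the Killing
form. For `μ : j → ℂ` the number `⟨μ, α⟩` is `μ t_α`. (If `g` is reductive, the Killing form is
nondegenerate on `[g, g]`, the center acts by zero under every root, and `t_α` exists
and is unique.) -/
def Represents (j : LieSubalgebra ℂ g) (α : Module.Dual ℂ j) (t : g) : Prop :=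
  t ∈ j ∧ t ∈ LieAlgebra.derivedSeries ℂ g 1 ∧ ∀ h : j, killingForm ℂ g t h = α h

/-- `Re ⟨χ|_j, α⟩ < -C` for all `α ∈ Δ(n, j)`. A statement holds for `χ ≪ 0` if it holds for all
`χ` with this property, for some constant `C` that does not depend on `χ`. -/
def IsVeryNegative (p n j : LieSubalgebra ℂ g) (χ : LieAlgebra.LieCharacter ℂ p) (C : ℝ) : Prop :=
  ∀ α ∈ weights n j, ∀ t : p, Represents j α (t : g) → (χ t).re < -C

/-- `Hom_{g'}(U(g') ⊗_{U(p')} F', U(g) ⊗_{U(p)} F)`. -/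
abbrev VermaHom (g' p : LieSubalgebra ℂ g)
    (F' : Type w) [AddCommGroup F'] [Module ℂ F'] [LieRingModule (inter g' p) F']
    [LieModule ℂ (inter g' p) F']
    (F : Type v) [AddCommGroup F] [Module ℂ F] [LieRingModule p F] [LieModule ℂ p F] :
    Type _ :=
  Induced (inter g' p) F' →ₗ⁅ℂ, g'⁆ Induced p F

/-- The set of the dimensions of `Hom_{g'}(U(g') ⊗_{U(p')} F', U(g) ⊗_{U(p)} ℂ_χ)`, where `F'`
runs over all finite-dimensional simple `p'`-modules. -/
def multiplicities (g' p : LieSubalgebra ℂ g) (χ : LieAlgebra.LieCharacter ℂ p) :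
    Set Cardinal.{max u w} :=
  {d | ∃ (F' : Type w) (_ : AddCommGroup F') (_ : Module ℂ F')
    (_ : LieRingModule (inter g' p) F') (_ : LieModule ℂ (inter g' p) F'),
    Module.Finite ℂ F' ∧ LieModule.IsIrreducible ℂ (inter g' p) F' ∧
      d = Module.rank ℂ (VermaHom g' p F' (OneDim χ))}

end Parabolic

end GenVerma

end

/-!
Let `p = p(H)` with `H ∈ g'` hyperbolic, `p' = p ∩ g'`, and let `n⁻`, `l`, `n⁺` be the sums of the
eigenspaces of `ad H` for negative, zero and positive eigenvalues.

**Finiteness.** By Frobenius reciprocity a homomorphism is a `p'`-linear map from `F'` to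
`M = U(g) ⊗ F`. It commutes with `H ∈ p'`, and `M` is spanned by the words in `n⁻` applied to `F`. The
longer a word, the smaller the real parts of the eigenvalues of `H` on it, so only finitely many
lengths can meet the eigenvalues of `H` on `F'` (`vermaHom_finite`).

**Reduction to a short grading.** If `n⁺` is abelian, the operator that acts on the eigenspaces of
`ad H` by the sign of the eigenvalue is a derivation, hence given by an element `H₀` of the semisimple
part of the Cartan subalgebra (`exists_sign_grading`). So `g` has the grading `g₋₁ + g₀ + g₁` by
`ad H₀`, with `p = g₀ + g₁`. An involution `τ` with `τ H = H` fixes `H₀`, thus `H₀ ∈ g'`. From now on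
`M` is induced from a character `χ`, with generator `m₀`.

**No singular vectors.** For `χ ≪ 0` a vector of positive depth in `M` is not killed by all of `g₁`
(`exists_bound_singular`). Otherwise there is such a vector of highest weight `λ - s`, where `λ` is
the weight of `m₀` and `s` a nonempty sum of roots of degree `1`. Comparing the two values of the
Casimir operator gives `⟨s, s⟩ = ⟨s, 2λ + 2ρ⟩`. The left side is nonnegative, because the sum of two
roots of degree `1` is not a root, and the right side is negative, if `χ` is sufficiently negative.

**Sphericity.** The part of degree `1` of a short grading of a reductive Lie algebra is a spherical
module of the part of degree `0` (`isSpherical`): by induction, using the coroot of a longest root of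
degree `1` and its centralizer. Applied to the fixed points of `τ` composed with the automorphism
`(-1)^k` of the grading, this yields a solvable subalgebra `b` of `g'` in degree `0` and an element
`x₀ ∈ g₁` with `τ x₀ = -x₀` such that `[b, x₀]` is the whole `(-1)`-eigenspace of `τ` in degree `1`
(`exists_solvable_dense`).

**Multiplicity at most one** (`rank_vermaHom_le_one`). By Lie's theorem `F'` contains an eigenvector
`v₀` of `H₀` and of `b` that is killed by `g' ∩ g₁`. A homomorphism is determined by the image `w` of
`v₀`, which has a fixed depth `k`. Then `x₀ᵏ w` is a multiple of `m₀`, and this multiple determines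
`w`: if `x₀ᵏ w = 0`, the density of the orbit of `x₀` implies that `w` is killed by all products of
`k` elements of the `(-1)`-eigenspace of `τ` in `g₁`, and, as there are no singular vectors, induction
on `k` gives `w = 0`.

**The value one is attained.** The restriction of `χ` to `p'` maps to `ℂ m₀`, and `m₀ ≠ 0`. Instead of
the Poincaré–Birkhoff–Witt theorem, this uses an explicit representation of `g` on the symmetric
algebra of `g₋₁`, in which the elements of degree `1` act by differential operators of second order
(`unit_oneDim_ne_zero`).
-/

noncomputable section

namespace GenVerma

/-! ### Induced modules and Frobenius reciprocity -/

section Frobenius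

attribute [local instance 100] LieRing.ofAssociativeRing

variable {R : Type*} [CommRing R] {L : Type u} [LieRing L] [LieAlgebra R L]
variable (P : LieSubalgebra R L) (F : Type v) [AddCommGroup F] [Module R F]
  [LieRingModule P F] [LieModule R P F]
variable {N : Type w} [AddCommGroup N] [Module R N] [LieRingModule L N] [LieModule R L N]

lemma tmul_relation (u : UniversalEnvelopingAlgebra R L) (a : UniversalEnvelopingAlgebra R P)
    (f : F) : Induced.tmul P F (u * uMap P a) f = Induced.tmul P F u (uAct P F a f) := by
  refine (Submodule.Quotient.eq _).2 (Submodule.subset_span ⟨u, a, f, rfl⟩)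

/-- The map `f ↦ 1 ⊗ f` from a `P`-module to the induced module. -/
def unit : F →ₗ[R] Induced P F :=
  (relations P F).mkQ ∘ₗ TensorProduct.mk R (UniversalEnvelopingAlgebra R L) F 1

lemma unit_apply (f : F) : unit P F f = Induced.tmul P F 1 f := rfl

lemma unit_lie (x : P) (f : F) : unit P F ⁅x, f⁆ = ⁅(x : L), unit P F f⁆ := by
  have h := tmul_relation P F 1 (UniversalEnvelopingAlgebra.ι R x) f
  have h1 : uMap P (UniversalEnvelopingAlgebra.ι R x) = UniversalEnvelopingAlgebra.ι R (x : L) :=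
    UniversalEnvelopingAlgebra.lift_ι_apply R _ x
  have h2 : uAct P F (UniversalEnvelopingAlgebra.ι R x) = LieModule.toEnd R P F x :=
    UniversalEnvelopingAlgebra.lift_ι_apply R _ x
  rw [h1, h2, one_mul] at h
  rw [unit_apply, unit_apply, lie_tmul, mul_one, h]
  rfl

/-- A subalgebra of the enveloping algebra containing the image of the Lie algebra is everything. -/
lemma envelopingAlgebra_induction {p : UniversalEnvelopingAlgebra R L → Prop}
    (hι : ∀ x, p (UniversalEnvelopingAlgebra.ι R x)) (hC : ∀ r, p (algebraMap R _ r))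
    (hadd : ∀ a b, p a → p b → p (a + b)) (hmul : ∀ a b, p a → p b → p (a * b))
    (a : UniversalEnvelopingAlgebra R L) : p a := by
  let S : Subalgebra R (UniversalEnvelopingAlgebra R L) :=
    { carrier := {a | p a}
      mul_mem' := fun ha hb => hmul _ _ ha hb
      add_mem' := fun ha hb => hadd _ _ ha hb
      algebraMap_mem' := hC }
  let F : L →ₗ⁅R⁆ S :=
    { toFun := fun x => ⟨UniversalEnvelopingAlgebra.ι R x, hι x⟩
      map_add' := fun x y => Subtype.ext (map_add _ x y)
      map_smul' := fun r x => Subtype.ext (map_smul _ r x)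
      map_lie' := fun {x y} => Subtype.ext (LieHom.map_lie _ x y) }
  have h : S.val.comp (UniversalEnvelopingAlgebra.lift R F) = AlgHom.id R _ := by
    ext x
    change (UniversalEnvelopingAlgebra.lift R F (UniversalEnvelopingAlgebra.ι R x) :
      UniversalEnvelopingAlgebra R L) = UniversalEnvelopingAlgebra.ι R x
    rw [UniversalEnvelopingAlgebra.lift_ι_apply]
    rfl
  have h2 := DFunLike.congr_fun h a
  change ((UniversalEnvelopingAlgebra.lift R F a : S) : UniversalEnvelopingAlgebra R L) = a at h2
  rw [← h2]
  exact (UniversalEnvelopingAlgebra.lift R F a).2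

/-- The induced module is generated by `1 ⊗ F`. -/
lemma eq_top_of_unit_mem (S : Submodule R (Induced P F)) (h1 : ∀ f, unit P F f ∈ S)
    (h2 : ∀ (x : L), ∀ m ∈ S, ⁅x, m⁆ ∈ S) : S = ⊤ := by
  have key : ∀ (a u : UniversalEnvelopingAlgebra R L),
      (∀ f, Induced.tmul P F u f ∈ S) → ∀ f, Induced.tmul P F (a * u) f ∈ S := by
    intro a
    induction a using envelopingAlgebra_induction with
    | hι x => exact fun u hu f => h2 x _ (hu f)
    | hC r =>
      intro u hu f
      have : Induced.tmul P F (algebraMap R _ r * u) f = r • Induced.tmul P F u f := by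
        rw [← Algebra.smul_def, Induced.tmul, ← TensorProduct.smul_tmul', map_smul]; rfl
      rw [this]
      exact S.smul_mem _ (hu f)
    | hadd a b ha hb =>
      intro u hu f
      have : Induced.tmul P F ((a + b) * u) f =
          Induced.tmul P F (a * u) f + Induced.tmul P F (b * u) f := by
        rw [add_mul, Induced.tmul, TensorProduct.add_tmul, map_add]; rfl
      rw [this]
      exact S.add_mem (ha u hu f) (hb u hu f)
    | hmul a b ha hb =>
      intro u hu f
      rw [mul_assoc]
      exact ha _ (hb u hu) f
  refine eq_top_iff.2 fun z _ => ?_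
  obtain ⟨t, rfl⟩ := Submodule.Quotient.mk_surjective _ z
  induction t using TensorProduct.induction_on with
  | zero => exact S.zero_mem
  | add x y hx hy => exact S.add_mem (hx trivial) (hy trivial)
  | tmul a f =>
    have := key a 1 h1 f
    rwa [mul_one] at this

omit [LieModule R L N] in
lemma hom_ext_unit {φ ψ : Induced P F →ₗ⁅R, L⁆ N} (h : ∀ f, φ (unit P F f) = ψ (unit P F f)) :
    φ = ψ := by
  have := eq_top_of_unit_mem P F (LinearMap.eqLocus (φ : Induced P F →ₗ[R] N) ψ) h (by
    intro x m hm
    change φ m = ψ m at hm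
    change φ ⁅x, m⁆ = ψ ⁅x, m⁆
    rw [LieModuleHom.map_lie, LieModuleHom.map_lie, hm])
  refine LieModuleHom.ext fun m => ?_
  have hm : m ∈ LinearMap.eqLocus (φ : Induced P F →ₗ[R] N) ψ := this ▸ trivial
  exact hm

/-- Frobenius reciprocity: a `P`-linear map from `F` into an `L`-module extends to the induced
module by `u ⊗ f ↦ u · ψ f`. -/
lemma exists_hom_of_equivariant (ψ : F →ₗ[R] N) (hψ : ∀ (x : P) (f : F), ψ ⁅x, f⁆ = ⁅(x : L), ψ f⁆) :
    ∃ φ : Induced P F →ₗ⁅R, L⁆ N, ∀ f, φ (unit P F f) = ψ f := by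
  let A := UniversalEnvelopingAlgebra.lift R (LieModule.toEnd R L N)
  have hA : ∀ x : L, A (UniversalEnvelopingAlgebra.ι R x) = LieModule.toEnd R L N x :=
    fun x => UniversalEnvelopingAlgebra.lift_ι_apply R _ x
  let pre : UniversalEnvelopingAlgebra R L ⊗[R] F →ₗ[R] N :=
    TensorProduct.lift ((LinearMap.lcomp R N ψ) ∘ₗ A.toLinearMap)
  have hpre : ∀ u f, pre (u ⊗ₜ f) = A u (ψ f) := fun u f => rfl
  have hrel : ∀ (a : UniversalEnvelopingAlgebra R P) (f : F),
      A (uMap P a) (ψ f) = ψ (uAct P F a f) := by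
    intro a
    induction a using envelopingAlgebra_induction with
    | hι x =>
      intro f
      have h1 : uMap P (UniversalEnvelopingAlgebra.ι R x) =
        UniversalEnvelopingAlgebra.ι R (x : L) := UniversalEnvelopingAlgebra.lift_ι_apply R _ x
      have h2 : uAct P F (UniversalEnvelopingAlgebra.ι R x) = LieModule.toEnd R P F x :=
        UniversalEnvelopingAlgebra.lift_ι_apply R _ x
      rw [h1, h2, hA]
      exact (hψ x f).symm
    | hC r => intro f; simp [Module.algebraMap_end_apply]
    | hadd a b ha hb => intro f; simp [ha, hb]
    | hmul a b ha hb => intro f; simp [ha, hb]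
  have hle : relations P F ≤ LinearMap.ker pre := by
    refine Submodule.span_le.2 ?_
    rintro _ ⟨u, a, f, rfl⟩
    simp only [SetLike.mem_coe, LinearMap.mem_ker, map_sub, hpre, map_mul]
    rw [Module.End.mul_apply, hrel, sub_self]
  let φ : Induced P F →ₗ[R] N := (relations P F).liftQ pre hle
  have hφ : ∀ (x : L) (m : Induced P F), φ ⁅x, m⁆ = ⁅x, φ m⁆ := by
    intro x m
    let q : UniversalEnvelopingAlgebra R L ⊗[R] F →ₗ[R] Induced P F := (relations P F).mkQ
    obtain ⟨t, rfl⟩ : ∃ t, q t = m := Submodule.Quotient.mk_surjective _ m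
    induction t using TensorProduct.induction_on with
    | zero => simp
    | add a b ha hb => rw [map_add, lie_add, map_add, map_add, lie_add, ha, hb]
    | tmul a f =>
      change A (UniversalEnvelopingAlgebra.ι R x * a) (ψ f) = ⁅x, A a (ψ f)⁆
      rw [map_mul, hA]
      rfl
  refine ⟨{ φ with map_lie' := fun {x m} => hφ x m }, fun f => ?_⟩
  change A 1 (ψ f) = ψ f
  simp

end Frobenius

/-! ### Finite-dimensionality of the spaces of homomorphisms -/

section Words

variable {g : Type u} [LieRing g] [LieAlgebra ℂ g]
variable {M : Type v} [AddCommGroup M] [Module ℂ M] [LieRingModule g M] [LieModule ℂ g M]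

/-- The span of the products `y₁ ⋯ y_k · m` with `y_i ∈ n` and `m ∈ S`. -/
def words (n : Submodule ℂ g) (S : Submodule ℂ M) : ℕ → Submodule ℂ M
  | 0 => S
  | k + 1 => Submodule.map₂ (LieModule.toEnd ℂ g M : g →ₗ[ℂ] M →ₗ[ℂ] M) n (words n S k)

variable {n : Submodule ℂ g} {S : Submodule ℂ M}

lemma lie_mem_words {k : ℕ} {y : g} (hy : y ∈ n) {m : M} (hm : m ∈ words n S k) :
    ⁅y, m⁆ ∈ words n S (k + 1) :=
  Submodule.apply_mem_map₂ _ hy hm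

lemma words_succ_le {k : ℕ} {T : Submodule ℂ M} :
    words n S (k + 1) ≤ T ↔ ∀ y ∈ n, ∀ m ∈ words n S k, ⁅y, m⁆ ∈ T :=
  Submodule.map₂_le

lemma words_finite [Module.Finite ℂ g] (hS : S.FG) (k : ℕ) : (words n S k).FG := by
  induction k with
  | zero => exact hS
  | succ k ih => exact Submodule.FG.map₂ _ (IsNoetherian.noetherian n) ih

lemma partialSups_words_finite [Module.Finite ℂ g] (hS : S.FG) (k : ℕ) :
    (partialSups (words n S) k).FG := by
  induction k with
  | zero => rw [partialSups_zero]; exact words_finite hS 0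
  | succ k ih =>
    rw [← Order.succ_eq_add_one, partialSups_succ]
    exact Submodule.FG.sup ih (words_finite hS (k + 1))

lemma lie_mem_partialSups_words {k : ℕ} {y : g} (hy : y ∈ n) {m : M}
    (hm : m ∈ partialSups (words n S) k) : ⁅y, m⁆ ∈ partialSups (words n S) (k + 1) := by
  have : partialSups (words n S) k ≤
      (partialSups (words n S) (k + 1)).comap (LieModule.toEnd ℂ g M y) := by
    refine partialSups_le _ _ _ fun i hi m hm => ?_
    exact le_partialSups_of_le (words n S) (Nat.succ_le_succ hi) (lie_mem_words hy hm)
  exact this hm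

/-- If `g = n + p` and `S` is stable under `p`, the words of length at most `k` span a
`p`-stable subspace. -/
lemma partialSups_words_stable {p : Submodule ℂ g} (hnp : n ⊔ p = ⊤)
    (hS : ∀ x ∈ p, ∀ m ∈ S, ⁅x, m⁆ ∈ S) (k : ℕ) :
    ∀ x ∈ p, ∀ m ∈ partialSups (words n S) k, ⁅x, m⁆ ∈ partialSups (words n S) k := by
  have key : ∀ k, ∀ x ∈ p, ∀ m ∈ words n S k, ⁅x, m⁆ ∈ partialSups (words n S) k := by
    intro k
    induction k with
    | zero => intro x hx m hm; rw [partialSups_zero]; exact hS x hx m hm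
    | succ k ih =>
      intro x hx
      have : words n S (k + 1) ≤
          (partialSups (words n S) (k + 1)).comap (LieModule.toEnd ℂ g M x) := by
        rw [words_succ_le]
        intro y hy m hm
        change ⁅x, ⁅y, m⁆⁆ ∈ partialSups (words n S) (k + 1)
        rw [leibniz_lie]
        refine add_mem ?_ (lie_mem_partialSups_words hy (ih x hx m hm))
        obtain ⟨a, ha, b, hb, hab⟩ := Submodule.mem_sup.1 (hnp ▸ Submodule.mem_top : ⁅x, y⁆ ∈ n ⊔ p)
        rw [← hab, add_lie]
        exact add_mem (le_partialSups (words n S) (k + 1) (lie_mem_words ha hm))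
          ((partialSups (words n S)).mono (Nat.le_succ k) (ih b hb m hm))
      exact fun m hm => this hm
  intro x hx
  have : partialSups (words n S) k ≤
      (partialSups (words n S) k).comap (LieModule.toEnd ℂ g M x) :=
    partialSups_le _ _ _ fun i hi m hm => (partialSups (words n S)).mono hi (key i x hx m hm)
  exact fun m hm => this hm

lemma iSup_words_stable {p : Submodule ℂ g} (hnp : n ⊔ p = ⊤)
    (hS : ∀ x ∈ p, ∀ m ∈ S, ⁅x, m⁆ ∈ S) (x : g) :
    ∀ m ∈ (⨆ k, words n S k : Submodule ℂ M), ⁅x, m⁆ ∈ (⨆ k, words n S k : Submodule ℂ M) := by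
  have : ⨆ k, words n S k ≤ (⨆ k, words n S k).comap (LieModule.toEnd ℂ g M x) := by
    refine iSup_le fun k m hm => ?_
    change ⁅x, m⁆ ∈ (⨆ k, words n S k : Submodule ℂ M)
    obtain ⟨a, ha, b, hb, hab⟩ := Submodule.mem_sup.1 (hnp ▸ Submodule.mem_top : x ∈ n ⊔ p)
    rw [← hab, add_lie]
    refine add_mem (Submodule.mem_iSup_of_mem (k + 1) (lie_mem_words ha hm)) ?_
    rw [← iSup_partialSups_eq]
    exact Submodule.mem_iSup_of_mem k
      (partialSups_words_stable hnp hS k b hb m (le_partialSups (words n S) k hm))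
  exact fun m hm => this hm

/-- The elements of `g` that map the subspace `W` of `M` into the subspace `T`. -/
def mapping (W T : Submodule ℂ M) : Submodule ℂ g where
  carrier := {y | ∀ m ∈ W, ⁅y, m⁆ ∈ T}
  zero_mem' m _ := by simp
  add_mem' {y z} hy hz m hm := by rw [add_lie]; exact add_mem (hy m hm) (hz m hm)
  smul_mem' c y hy m hm := by rw [smul_lie]; exact T.smul_mem c (hy m hm)

end Words

section Hyperbolic

variable {g : Type u} [LieRing g] [LieAlgebra ℂ g]

/-- The sum of the eigenspaces of `ad H` for the negative real eigenvalues. -/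
def nMinus (H : g) : LieSubalgebra ℂ g :=
  eigenSum H ⟨Set.Iio 0, fun ha hb => add_neg (Set.mem_Iio.1 ha) (Set.mem_Iio.1 hb)⟩

lemma eigenSum_le_iff {H : g} {S : AddSubsemigroup ℝ} {T : Submodule ℂ g} :
    (eigenSum H S).toSubmodule ≤ T ↔ ∀ r ∈ S, ∀ x, ⁅H, x⁆ = (r : ℂ) • x → x ∈ T := by
  change (⨆ r : S, (LieAlgebra.ad ℂ g H).eigenspace ((r : ℝ) : ℂ)) ≤ T ↔ _
  rw [iSup_le_iff]
  constructor
  · intro h r hr x hx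
    exact h ⟨r, hr⟩ (Module.End.mem_eigenspace_iff.2 hx)
  · intro h r x hx
    exact h r r.2 x (Module.End.mem_eigenspace_iff.1 hx)

lemma mem_eigenSum {H : g} {S : AddSubsemigroup ℝ} {r : ℝ} (hr : r ∈ S) {x : g}
    (hx : ⁅H, x⁆ = (r : ℂ) • x) : x ∈ eigenSum H S :=
  eigenSum_le_iff.1 le_rfl r hr x hx

lemma IsHyperbolic.induction {H : g} (hH : IsHyperbolic H) {T : Submodule ℂ g}
    (h : ∀ (r : ℝ) x, ⁅H, x⁆ = (r : ℂ) • x → x ∈ T) : T = ⊤ := by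
  rw [eq_top_iff, ← hH.1]
  refine iSup_le fun μ x hx => ?_
  by_cases hx0 : x = 0
  · rw [hx0]; exact T.zero_mem
  · have him := hH.2 μ (Module.End.hasEigenvalue_of_hasEigenvector ⟨hx, hx0⟩)
    refine h μ.re x ?_
    rw [← LieAlgebra.ad_apply ℂ, Module.End.mem_eigenspace_iff.1 hx]
    congr 1
    exact Complex.ext rfl (by simp [him])

lemma IsHyperbolic.nMinus_sup_parabolic {H : g} (hH : IsHyperbolic H) :
    (nMinus H).toSubmodule ⊔ (parabolic H).toSubmodule = ⊤ := by
  refine hH.induction fun r x hx => ?_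
  rcases lt_or_ge r 0 with hr | hr
  · exact Submodule.mem_sup_left (mem_eigenSum (S := ⟨Set.Iio 0, _⟩) hr hx)
  · exact Submodule.mem_sup_right (mem_eigenSum (S := ⟨Set.Ici 0, _⟩) hr hx)

lemma mem_parabolic_self (H : g) : H ∈ parabolic H :=
  mem_eigenSum (S := ⟨Set.Ici 0, _⟩) (r := 0) (le_refl (0 : ℝ)) (by simp)

/-- The negative real eigenvalues of `ad H` are bounded away from `0`. -/
lemma exists_gap [Module.Finite ℂ g] (H : g) :
    ∃ r₀ : ℝ, 0 < r₀ ∧ ∀ r : ℝ, r < 0 → ∀ x : g, x ≠ 0 → ⁅H, x⁆ = (r : ℂ) • x → r ≤ -r₀ := by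
  have hfin : (Set.ofPred (LieAlgebra.ad ℂ g H).HasEigenvalue).Finite :=
    Module.End.finite_hasEigenvalue _
  let s : Finset ℂ := hfin.toFinset.filter fun μ => μ.re < 0
  rcases s.eq_empty_or_nonempty with hs | hs
  · refine ⟨1, one_pos, fun r hr x hx0 hx => ?_⟩
    have : (r : ℂ) ∈ s := Finset.mem_filter.2 ⟨hfin.mem_toFinset.2
      (Module.End.hasEigenvalue_of_hasEigenvector
        ⟨Module.End.mem_eigenspace_iff.2 hx, hx0⟩), by simpa using hr⟩
    simp [hs] at this
  · obtain ⟨μ, hμ, hmax⟩ := s.exists_max_image (fun μ => μ.re) hs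
    refine ⟨-μ.re, neg_pos.2 (Finset.mem_filter.1 hμ).2, fun r hr x hx0 hx => ?_⟩
    have : (r : ℂ) ∈ s := Finset.mem_filter.2 ⟨hfin.mem_toFinset.2
      (Module.End.hasEigenvalue_of_hasEigenvector
        ⟨Module.End.mem_eigenspace_iff.2 hx, hx0⟩), by simpa using hr⟩
    simpa using hmax _ this

end Hyperbolic

section Finiteness

open Module.End

/-- An intertwining map respects generalized eigenspaces. -/
lemma map_mem_maxGenEigenspace {V W : Type*} [AddCommGroup V] [Module ℂ V] [AddCommGroup W]
    [Module ℂ W] (q : V →ₗ[ℂ] W) {A : Module.End ℂ V} {B : Module.End ℂ W}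
    (h : ∀ x, q (A x) = B (q x)) {μ : ℂ} {x : V} (hx : x ∈ A.maxGenEigenspace μ) :
    q x ∈ B.maxGenEigenspace μ := by
  rw [mem_maxGenEigenspace] at hx ⊢
  obtain ⟨k, hk⟩ := hx
  refine ⟨k, ?_⟩
  have : ∀ (k : ℕ) (x : V), q (((A - μ • 1) ^ k) x) = ((B - μ • 1) ^ k) (q x) := by
    intro k
    induction k with
    | zero => intro x; rfl
    | succ k ih => intro x; rw [pow_succ, pow_succ, mul_apply, mul_apply, ih]; simp [h]
  rw [← this, hk, map_zero]

variable {g : Type u} [LieRing g] [LieAlgebra ℂ g] [Module.Finite ℂ g]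
variable {M : Type v} [AddCommGroup M] [Module ℂ M] [LieRingModule g M] [LieModule ℂ g M]

omit [Module.Finite ℂ g] in
/-- Every factor from `n⁻(H)` lowers the real parts of the generalized eigenvalues of `H` by at
least `r₀`. -/
lemma words_le_maxGenEigenspace {H : g} {r₀ a : ℝ} {S : Submodule ℂ M}
    (hr₀ : ∀ r : ℝ, r < 0 → ∀ x : g, x ≠ 0 → ⁅H, x⁆ = (r : ℂ) • x → r ≤ -r₀)
    (hS : S ≤ ⨆ ν : {ν : ℂ // ν.re ≤ a}, (LieModule.toEnd ℂ g M H).maxGenEigenspace ν) (k : ℕ) :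
    words (nMinus H).toSubmodule S k ≤ ⨆ ν : {ν : ℂ // ν.re ≤ a - k * r₀},
      (LieModule.toEnd ℂ g M H).maxGenEigenspace ν := by
  induction k with
  | zero =>
    refine hS.trans (iSup_le fun ν => ?_)
    exact le_iSup (fun ν : {ν : ℂ // ν.re ≤ a - (0 : ℕ) * r₀} =>
      (LieModule.toEnd ℂ g M H).maxGenEigenspace ν) ⟨ν, by simpa using ν.2⟩
  | succ k ih =>
    rw [words_succ_le]
    suffices h : (nMinus H).toSubmodule ≤ mapping (words (nMinus H).toSubmodule S k)
        (⨆ ν : {ν : ℂ // ν.re ≤ a - (k + 1 : ℕ) * r₀},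
          (LieModule.toEnd ℂ g M H).maxGenEigenspace ν) from fun y hy => h hy
    refine eigenSum_le_iff.2 fun r hr y hy m hm => ?_
    by_cases hy0 : y = 0
    · simp [hy0]
    have hrr := hr₀ r hr y hy0 hy
    have hle : (⨆ ν : {ν : ℂ // ν.re ≤ a - k * r₀},
        (LieModule.toEnd ℂ g M H).maxGenEigenspace ν) ≤
        (⨆ ν : {ν : ℂ // ν.re ≤ a - (k + 1 : ℕ) * r₀},
          (LieModule.toEnd ℂ g M H).maxGenEigenspace ν).comap (LieModule.toEnd ℂ g M y) := by
      refine iSup_le fun ν m hm => ?_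
      have hy' : y ∈ (LieModule.toEnd ℂ g g H).maxGenEigenspace (r : ℂ) :=
        eigenspace_le_maxGenEigenspace (mem_eigenspace_iff.2 hy)
      refine Submodule.mem_iSup_of_mem ⟨(r : ℂ) + ν, ?_⟩
        (LieModule.lie_mem_maxGenEigenspace_toEnd hy' hm)
      have := ν.2
      simp only [Complex.add_re, Complex.ofReal_re]
      push_cast
      linarith
    exact hle (ih hm)

/-- If an `A`-stable subspace `S` and generalized eigenspaces of `A` for eigenvalues different
from `μ` span the space, then `S` contains the generalized eigenspace for `μ`. -/
lemma maxGenEigenspace_le_of_sup {V : Type*} [AddCommGroup V] [Module ℂ V]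
    (A : Module.End ℂ V) (S : Submodule ℂ V) (hA : ∀ x ∈ S, A x ∈ S) {μ : ℂ} {I : Type*}
    (e : I → ℂ) (he : ∀ i, e i ≠ μ) (htop : S ⊔ ⨆ i, A.maxGenEigenspace (e i) = ⊤) :
    A.maxGenEigenspace μ ≤ S := by
  let B : Module.End ℂ (V ⧸ S) := S.mapQ S A hA
  have hq : ∀ x, S.mkQ (A x) = B (S.mkQ x) := fun x => rfl
  have h1 : (⨆ ν, ⨆ _ : ν ≠ μ, B.maxGenEigenspace ν) = ⊤ := by
    rw [eq_top_iff, ← Submodule.range_mkQ S, ← Submodule.map_top, ← htop, Submodule.map_sup,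
      Submodule.mkQ_map_self, bot_sup_eq, Submodule.map_le_iff_le_comap]
    exact iSup_le fun i x hx => Submodule.mem_iSup_of_mem (e i)
      (Submodule.mem_iSup_of_mem (he i) (map_mem_maxGenEigenspace _ hq hx))
  have h2 := independent_maxGenEigenspace B μ
  rw [h1, disjoint_top] at h2
  intro x hx
  have := map_mem_maxGenEigenspace S.mkQ hq hx
  rw [h2, Submodule.mem_bot] at this
  exact (Submodule.Quotient.mk_eq_zero S).1 this

omit [Module.Finite ℂ g] in
lemma exists_re_bound {V : Type*} [AddCommGroup V] [Module ℂ V] [Module.Finite ℂ V]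
    (A : Module.End ℂ V) : ∃ a : ℝ, ∀ μ, A.HasEigenvalue μ → |μ.re| ≤ a := by
  obtain ⟨a, ha⟩ := ((finite_hasEigenvalue A).image fun μ => |μ.re|).bddAbove
  exact ⟨a, fun μ hμ => ha ⟨μ, hμ, rfl⟩⟩

lemma hasEigenvalue_of_maxGenEigenspace_ne_bot {V : Type*} [AddCommGroup V] [Module ℂ V]
    [Module.Finite ℂ V] {A : Module.End ℂ V} {μ : ℂ} (h : A.maxGenEigenspace μ ≠ ⊥) :
    A.HasEigenvalue μ := by
  rw [maxGenEigenspace_eq] at h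
  exact hasEigenvalue_of_hasGenEigenvalue (k := A.maxGenEigenspaceIndex μ) h

variable (g) in
/-- Finite-dimensionality of the space of homomorphisms between generalized Verma modules. A
homomorphism is given by its restriction to `F'`, which commutes with `H`. The eigenvalues of `H` on
`F'` have bounded real parts, and the corresponding part of `U(g) ⊗ F` has finite dimension. -/
theorem vermaHom_finite (g' p : LieSubalgebra ℂ g) (hp : IsCompatible g' p)
    (F : Type v) [AddCommGroup F] [Module ℂ F] [LieRingModule p F] [LieModule ℂ p F]
    (F' : Type w) [AddCommGroup F'] [Module ℂ F'] [LieRingModule (inter g' p) F']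
    [LieModule ℂ (inter g' p) F'] [Module.Finite ℂ F] [Module.Finite ℂ F'] :
    Module.Finite ℂ (VermaHom g' p F' F) := by
  obtain ⟨H, hH', hH, hpH⟩ := hp
  have hHp : H ∈ p := hpH ▸ mem_parabolic_self H
  let M := Induced p F
  let A : Module.End ℂ M := LieModule.toEnd ℂ g M H
  let S : Submodule ℂ M := LinearMap.range (unit p F)
  have hnp : (nMinus H).toSubmodule ⊔ p.toSubmodule = ⊤ := hpH ▸ hH.nMinus_sup_parabolic
  have hSst : ∀ x ∈ p.toSubmodule, ∀ m ∈ S, ⁅x, m⁆ ∈ S := by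
    rintro x hx _ ⟨f, rfl⟩
    exact ⟨⁅(⟨x, hx⟩ : p), f⁆, unit_lie p F ⟨x, hx⟩ f⟩
  have htop : ⨆ k, words (nMinus H).toSubmodule S k = ⊤ :=
    eq_top_of_unit_mem p F _ (fun f => Submodule.mem_iSup_of_mem 0 ⟨f, rfl⟩)
      (iSup_words_stable hnp hSst)
  obtain ⟨r₀, hr₀, hgap⟩ := exists_gap H
  let HP : p := ⟨H, hHp⟩
  let HP' : inter g' p := ⟨⟨H, hH'⟩, hHp⟩
  obtain ⟨a, ha⟩ := exists_re_bound (LieModule.toEnd ℂ p F HP)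
  obtain ⟨b, hb⟩ := exists_re_bound (LieModule.toEnd ℂ (inter g' p) F' HP')
  have hSa : S ≤ ⨆ ν : {ν : ℂ // ν.re ≤ a}, A.maxGenEigenspace ν := by
    rintro _ ⟨f, rfl⟩
    have hle : (⊤ : Submodule ℂ F) ≤
        (⨆ ν : {ν : ℂ // ν.re ≤ a}, A.maxGenEigenspace ν).comap (unit p F) := by
      rw [← iSup_maxGenEigenspace_eq_top (LieModule.toEnd ℂ p F HP)]
      refine iSup_le fun ν => ?_
      by_cases hν : (LieModule.toEnd ℂ p F HP).maxGenEigenspace ν = ⊥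
      · rw [hν]; exact bot_le
      · intro f hf
        refine Submodule.mem_iSup_of_mem
          ⟨ν, (le_abs_self _).trans (ha ν (hasEigenvalue_of_maxGenEigenspace_ne_bot hν))⟩ ?_
        exact map_mem_maxGenEigenspace (unit p F) (fun x => unit_lie p F HP x) hf
    exact hle trivial
  -- on words of length `k ≥ K` the real parts of the eigenvalues of `H` are less than `-b`
  obtain ⟨K, hK⟩ := exists_nat_gt ((a + b) / r₀)
  have hK' : a - K * r₀ < -b := by
    rw [div_lt_iff₀ hr₀] at hK
    linarith
  let T : Submodule ℂ M := partialSups (words (nMinus H).toSubmodule S) K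
  have hTfin : T.FG := partialSups_words_finite
    (Module.Finite.iff_fg.1 (Module.Finite.range (unit p F))) K
  have hT : ∀ μ : ℂ, -b ≤ μ.re → A.maxGenEigenspace μ ≤ T := by
    intro μ hμ
    refine maxGenEigenspace_le_of_sup A T
      (partialSups_words_stable hnp hSst K H hHp)
      (fun ν : {ν : ℂ // ν.re < -b} => (ν : ℂ)) (fun ν h => ?_) ?_
    · have := ν.2
      rw [h] at this
      linarith
    · rw [eq_top_iff, ← htop]
      refine iSup_le fun k => ?_
      rcases le_total k K with hk | hk
      · exact le_sup_of_le_left (le_partialSups_of_le _ hk)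
      · refine le_sup_of_le_right ((words_le_maxGenEigenspace hgap hSa k).trans ?_)
        refine iSup_le fun ν => ?_
        refine le_iSup (fun ν : {ν : ℂ // ν.re < -b} => A.maxGenEigenspace (ν : ℂ)) ⟨ν, ?_⟩
        have h1 := ν.2
        have h2 : (K : ℝ) * r₀ ≤ k * r₀ := by gcongr
        linarith
  have hrange : ∀ (φ : VermaHom g' p F' F) (f : F'), φ (unit (inter g' p) F' f) ∈ T := by
    intro φ
    have hle : (⊤ : Submodule ℂ F') ≤
        T.comap ((φ : Induced (inter g' p) F' →ₗ[ℂ] M) ∘ₗ unit (inter g' p) F') := by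
      rw [← iSup_maxGenEigenspace_eq_top (LieModule.toEnd ℂ (inter g' p) F' HP')]
      refine iSup_le fun ν => ?_
      by_cases hν : (LieModule.toEnd ℂ (inter g' p) F' HP').maxGenEigenspace ν = ⊥
      · rw [hν]; exact bot_le
      · intro f hf
        refine hT ν (neg_le_of_abs_le (hb ν (hasEigenvalue_of_maxGenEigenspace_ne_bot hν))) ?_
        refine map_mem_maxGenEigenspace _ (fun x => ?_) hf
        change φ (unit (inter g' p) F' ⁅HP', x⁆) = ⁅H, φ (unit (inter g' p) F' x)⁆
        rw [unit_lie, LieModuleHom.map_lie]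
        rfl
    exact fun f => hle trivial
  have : Module.Finite ℂ T := Module.Finite.iff_fg.2 hTfin
  let Θ : VermaHom g' p F' F →ₗ[ℂ] (F' →ₗ[ℂ] T) :=
    { toFun := fun φ => LinearMap.codRestrict T
        ((φ : Induced (inter g' p) F' →ₗ[ℂ] M) ∘ₗ unit (inter g' p) F') (hrange φ)
      map_add' := fun φ ψ => rfl
      map_smul' := fun c φ => rfl }
  refine Module.Finite.of_injective Θ fun φ ψ h => ?_
  refine hom_ext_unit _ _ fun f => ?_
  exact congrArg Subtype.val (DFunLike.congr_fun h f)

end Finiteness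

/-! ### The center and the derived algebra of a reductive Lie algebra -/

section Reductive

open LieAlgebra

variable {g : Type u} [LieRing g] [LieAlgebra ℂ g]

lemma lie_mem_derived (x y : g) : ⁅x, y⁆ ∈ derivedSeries ℂ g 1 :=
  LieSubmodule.lie_mem_lie (I := (⊤ : LieIdeal ℂ g)) (N := (⊤ : LieIdeal ℂ g)) trivial trivial

lemma derived_le_of_lie_mem {T : Submodule ℂ g} (h : ∀ x y : g, ⁅x, y⁆ ∈ T) :
    (derivedSeries ℂ g 1).toSubmodule ≤ T := by
  rw [derivedSeries_def, derivedSeriesOfIdeal_succ, derivedSeriesOfIdeal_zero,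
    LieSubmodule.lieIdeal_oper_eq_linear_span]
  refine Submodule.span_le.2 ?_
  rintro _ ⟨x, y, rfl⟩
  exact h x y

lemma mem_center_iff' {x : g} : x ∈ center ℂ g ↔ ∀ y : g, ⁅y, x⁆ = 0 :=
  LieModule.mem_maxTrivSubmodule _ _ _ x

lemma killingForm_of_mem_center {x : g} (hx : x ∈ center ℂ g) (y : g) :
    killingForm ℂ g x y = 0 := by
  have : ad ℂ g x = 0 := by
    ext y
    rw [ad_apply, ← lie_skew, mem_center_iff'.1 hx, neg_zero]; rfl
  rw [killingForm_apply_apply, this, LinearMap.zero_comp, map_zero]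

lemma killingForm_invariant (x y z : g) : killingForm ℂ g ⁅x, y⁆ z = killingForm ℂ g x ⁅y, z⁆ :=
  LieModule.traceForm_apply_lie_apply ℂ g g x y z

lemma killingForm_symm (x y : g) : killingForm ℂ g x y = killingForm ℂ g y x :=
  LieModule.traceForm_comm ℂ g g x y

variable [Module.Finite ℂ g] [HasCentralRadical ℂ g]

/-- In a reductive Lie algebra an ideal whose derived ideal is central is central. -/
lemma ideal_le_center (I : LieIdeal ℂ g) (hI : ∀ x ∈ I, ∀ y ∈ I, ⁅x, y⁆ ∈ center ℂ g) :
    I ≤ center ℂ g := by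
  rw [← HasCentralRadical.radical_eq_center, ← LieIdeal.solvable_iff_le_radical]
  refine LieIdeal.isSolvable_of_killingForm_apply_lie_eq_zero I fun x _ y hy => ?_
  have hle : ⁅I, I⁆ ≤ center ℂ g := by
    rw [LieSubmodule.lieIdeal_oper_eq_span, LieSubmodule.lieSpan_le]
    rintro _ ⟨x, y, rfl⟩
    exact hI x x.2 y y.2
  rw [killingForm_symm]
  exact killingForm_of_mem_center (hle hy) x

lemma mem_center_of_killingForm_eq_zero {x : g} (hx : ∀ y, killingForm ℂ g x y = 0) :
    x ∈ center ℂ g := by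
  rw [← HasCentralRadical.radical_eq_center]
  refine killingCompl_top_le_radical ℂ g ((LieIdeal.mem_killingCompl ..).2 fun y _ => ?_)
  rw [killingForm_symm]
  exact hx y

/-- The second center is the center. -/
lemma mem_center_of_lie_mem_center {x : g} (hx : ∀ y : g, ⁅y, x⁆ ∈ center ℂ g) : x ∈ center ℂ g := by
  let I : LieIdeal ℂ g :=
    { carrier := {x | ∀ y : g, ⁅y, x⁆ ∈ center ℂ g}
      zero_mem' := fun y => by simp
      add_mem' := fun {a b} ha hb y => by rw [lie_add]; exact add_mem (ha y) (hb y)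
      smul_mem' := fun c a ha y => by rw [lie_smul]; exact (center ℂ g).smul_mem c (ha y)
      lie_mem := fun {a b} hb y => by
        rw [mem_center_iff'.1 (hb a) y]
        exact zero_mem _ }
  exact ideal_le_center I (fun a _ b hb => hb a) hx

/-- The quotient of a reductive Lie algebra by its center is semisimple. -/
instance quotient_center_isKilling : IsKilling ℂ (g ⧸ center ℂ g) := by
  have : HasTrivialRadical ℂ (g ⧸ center ℂ g) := by
    rw [hasTrivialRadical_iff_no_abelian_ideals]
    intro A hA
    have hmk : ∀ x y : g, (LieSubmodule.Quotient.mk ⁅x, y⁆ : g ⧸ center ℂ g) =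
      ⁅(LieSubmodule.Quotient.mk x : g ⧸ center ℂ g), LieSubmodule.Quotient.mk y⁆ :=
      fun x y => LieSubmodule.Quotient.mk_bracket (center ℂ g) x y
    let I : LieIdeal ℂ g :=
      { A.toSubmodule.comap (center ℂ g).toSubmodule.mkQ with
        lie_mem := fun {a b} hb => by
          change (LieSubmodule.Quotient.mk ⁅a, b⁆ : g ⧸ center ℂ g) ∈ A
          rw [hmk]
          exact LieSubmodule.lie_mem A hb }
    have hI : I ≤ center ℂ g := by
      refine ideal_le_center I fun x hx y hy => ?_
      rw [← LieSubmodule.Quotient.mk_eq_zero', hmk]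
      have := hA.trivial ⟨_, hx⟩ ⟨_, hy⟩
      exact congrArg Subtype.val this
    rw [eq_bot_iff]
    intro q hq
    obtain ⟨x, rfl⟩ := Submodule.Quotient.mk_surjective _ q
    exact (LieSubmodule.Quotient.mk_eq_zero').2 (hI hq)
  infer_instance

/-- A central extension of a semisimple Lie algebra meets its derived algebra trivially: every
`2`-cocycle `ζ ⁅x, y⁆` is given by a derivation of the quotient, hence it is a coboundary. -/
lemma center_inf_derived {x : g} (hz : x ∈ center ℂ g) (hs : x ∈ derivedSeries ℂ g 1) : x = 0 := by
  by_contra hx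
  obtain ⟨ζ, hζ⟩ : ∃ ζ : Module.Dual ℂ g, ζ x ≠ 0 := by
    by_contra! h
    exact hx ((Module.forall_dual_apply_eq_zero_iff ℂ x).1 h)
  let Q := g ⧸ center ℂ g
  let π : g →ₗ[ℂ] Q := (center ℂ g).toSubmodule.mkQ
  have hπ : ∀ x y : g, π ⁅x, y⁆ = ⁅π x, π y⁆ :=
    fun x y => LieSubmodule.Quotient.mk_bracket (center ℂ g) x y
  obtain ⟨σ, hσ⟩ := π.exists_rightInverse_of_surjective (Submodule.range_mkQ _)
  have hσ' : ∀ q, π (σ q) = q := DFunLike.congr_fun hσ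
  let ω : Q →ₗ[ℂ] Q →ₗ[ℂ] ℂ := LinearMap.mk₂ ℂ (fun p q => ζ ⁅σ p, σ q⁆)
    (by simp) (by simp) (by simp) (by simp)
  have hcen : ∀ a : g, a - σ (π a) ∈ center ℂ g := fun a => by
    have : π (a - σ (π a)) = 0 := by rw [map_sub, hσ', sub_self]
    exact LieSubmodule.Quotient.mk_eq_zero'.1 this
  have hω : ∀ a b : g, ω (π a) (π b) = ζ ⁅a, b⁆ := by
    intro a b
    change ζ ⁅σ (π a), σ (π b)⁆ = _
    have h1 : ⁅a, b⁆ = ⁅σ (π a), b⁆ := by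
      have := mem_center_iff'.1 (hcen a) b
      rw [← sub_eq_zero, ← sub_lie, ← lie_skew, this, neg_zero]
    have h2 : ⁅σ (π a), b⁆ = ⁅σ (π a), σ (π b)⁆ := by
      rw [← sub_eq_zero, ← lie_sub, mem_center_iff'.1 (hcen b)]
    rw [h1, h2]
  have hnd := IsKilling.killingForm_nondegenerate ℂ Q
  let D₀ : Q →ₗ[ℂ] Q := ((killingForm ℂ Q).toDual hnd).symm.toLinearMap ∘ₗ ω
  have hD₀ : ∀ p q, killingForm ℂ Q (D₀ p) q = ω p q := fun p q =>
    LinearMap.BilinForm.apply_toDual_symm_apply (hB := hnd) _ _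
  have hsurj : ∀ q : Q, ∃ a, π a = q := fun q => ⟨σ q, hσ' q⟩
  let D : LieDerivation ℂ Q Q :=
    { D₀ with
      leibniz' := fun p q => by
        change D₀ ⁅p, q⁆ = ⁅p, D₀ q⁆ - ⁅q, D₀ p⁆
        rw [← sub_eq_zero]
        refine hnd.1 _ fun r => ?_
        obtain ⟨a, rfl⟩ := hsurj p
        obtain ⟨b, rfl⟩ := hsurj q
        obtain ⟨c, rfl⟩ := hsurj r
        rw [← lie_skew (π a) (D₀ (π b)), ← lie_skew (π b) (D₀ (π a))]
        simp only [map_sub, map_neg, LinearMap.sub_apply, LinearMap.neg_apply,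
          killingForm_invariant, hD₀, ← hπ, hω]
        rw [lie_lie, map_sub]
        ring }
  obtain ⟨h, hh⟩ := LieDerivation.IsKilling.exists_eq_ad (R := ℂ) (L := Q) D
  have hh' : ∀ q, D₀ q = ⁅h, q⁆ := fun q => by
    have := DFunLike.congr_fun hh q
    rw [LieDerivation.ad_apply_apply] at this
    exact this.symm
  have key : (derivedSeries ℂ g 1).toSubmodule ≤
      LinearMap.ker (ζ - (killingForm ℂ Q h) ∘ₗ π) := by
    refine derived_le_of_lie_mem fun a b => ?_
    rw [LinearMap.mem_ker, LinearMap.sub_apply, LinearMap.comp_apply, hπ,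
      ← killingForm_invariant, ← hh', hD₀, hω, sub_self]
  have h0 : π x = 0 := LieSubmodule.Quotient.mk_eq_zero'.2 hz
  have := key hs
  rw [LinearMap.mem_ker, LinearMap.sub_apply, LinearMap.comp_apply, h0, map_zero, sub_zero] at this
  exact hζ this

/-- A reductive Lie algebra is the sum of its center and its derived algebra: the center is the
orthogonal complement of the derived algebra and the radical of the Killing form, so the dimensions
add up. -/
lemma center_sup_derived : (center ℂ g).toSubmodule ⊔ (derivedSeries ℂ g 1).toSubmodule = ⊤ := by
  have horth : (killingForm ℂ g).orthogonal (derivedSeries ℂ g 1).toSubmodule =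
      (center ℂ g).toSubmodule := by
    refine le_antisymm (fun x hx => ?_) fun x hx y _ => ?_
    · refine mem_center_of_lie_mem_center fun y => ?_
      refine mem_center_of_killingForm_eq_zero fun w => ?_
      have := hx ⁅w, y⁆ (lie_mem_derived w y)
      rw [killingForm_symm, ← killingForm_invariant]
      exact this
    · change killingForm ℂ g y x = 0
      rw [killingForm_symm, killingForm_of_mem_center hx]
  have h := LinearMap.BilinForm.finrank_add_finrank_orthogonal' (B := killingForm ℂ g)
    (derivedSeries ℂ g 1).toSubmodule
  have hker : LinearMap.ker (killingForm ℂ g) = (center ℂ g).toSubmodule := by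
    ext x
    rw [LinearMap.mem_ker]
    exact ⟨fun hx => mem_center_of_killingForm_eq_zero fun y => DFunLike.congr_fun hx y,
      fun hx => LinearMap.ext fun y => killingForm_of_mem_center hx y⟩
  rw [horth, hker] at h
  have h2 := Submodule.finrank_sup_add_finrank_inf_eq (center ℂ g).toSubmodule
    (derivedSeries ℂ g 1).toSubmodule
  refine Submodule.eq_top_of_finrank_eq ?_
  rw [inf_comm] at h2
  omega

omit [HasCentralRadical ℂ g] in
lemma killingForm_derived (x y : derivedSeries ℂ g 1) :
    killingForm ℂ (derivedSeries ℂ g 1) x y = killingForm ℂ g x y :=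
  DFunLike.congr_fun (DFunLike.congr_fun (LieIdeal.killingForm_eq (R := ℂ) (L := g)
    (derivedSeries ℂ g 1)) x) y

/-- The derived algebra of a reductive Lie algebra is semisimple. -/
instance derived_isKilling : IsKilling ℂ (derivedSeries ℂ g 1) where
  killingCompl_top_eq_bot := by
    rw [eq_bot_iff]
    intro x hx
    have hx' : ∀ y : derivedSeries ℂ g 1, killingForm ℂ g x y = 0 := by
      intro y
      have h := (LieIdeal.mem_killingCompl ..).1 hx y trivial
      rwa [killingForm_derived, killingForm_symm] at h
    have : (x : g) ∈ center ℂ g := by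
      refine mem_center_of_killingForm_eq_zero fun y => ?_
      obtain ⟨a, ha, b, hb, rfl⟩ := Submodule.mem_sup.1
        (center_sup_derived (g := g) ▸ Submodule.mem_top :
          y ∈ (center ℂ g).toSubmodule ⊔ (derivedSeries ℂ g 1).toSubmodule)
      rw [map_add, killingForm_symm, killingForm_of_mem_center ha, zero_add]
      exact hx' ⟨b, hb⟩
    exact Subtype.ext (center_inf_derived this x.2)

end Reductive

/-! ### Hyperbolic elements with abelian positive part -/

section Grading

open LieAlgebra LieModule

variable {S : Type*} [LieRing S] [LieAlgebra ℂ S] [Module.Finite ℂ S] [IsKilling ℂ S]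
variable {J : LieSubalgebra ℂ S} [J.IsCartanSubalgebra]

omit [IsKilling ℂ S] in
lemma eq_top_of_rootSpace_le {T : Submodule ℂ S}
    (h : ∀ (α : Weight ℂ J S), ∀ x ∈ rootSpace J α, x ∈ T) : T = ⊤ := by
  have h1 := LieSubmodule.iSup_toSubmodule_eq_top.mpr (iSup_genWeightSpace_eq_top' ℂ J S)
  rw [eq_top_iff, ← h1]
  exact iSup_le fun α x hx => h α x hx

/-- In a semisimple Lie algebra an element that is orthogonal to all root vectors vanishes. -/
lemma eq_zero_of_killingForm_rootSpace {x : S}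
    (h : ∀ (α : Weight ℂ J S), ∀ y ∈ rootSpace J α, killingForm ℂ S x y = 0) : x = 0 := by
  have htop : LinearMap.ker (killingForm ℂ S x) = ⊤ := eq_top_of_rootSpace_le (J := J) h
  refine (IsKilling.killingForm_nondegenerate ℂ S).1 x fun y => ?_
  exact (htop ▸ Submodule.mem_top : y ∈ LinearMap.ker (killingForm ℂ S x))

omit [Module.Finite ℂ S] [IsKilling ℂ S] in
lemma mem_cartan_of_commute {x : S} (h : ∀ y ∈ J, ⁅x, y⁆ = 0) : x ∈ J := by
  rw [← LieSubalgebra.IsCartanSubalgebra.self_normalizing (H := J),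
    LieSubalgebra.mem_normalizer_iff]
  intro y hy
  rw [h y hy]
  exact J.zero_mem

variable {H : S}

omit [Module.Finite ℂ S] [IsKilling ℂ S] in
lemma lie_eigen {a b : ℝ} {x y : S} (hx : ⁅H, x⁆ = (a : ℂ) • x) (hy : ⁅H, y⁆ = (b : ℂ) • y) :
    ⁅H, ⁅x, y⁆⁆ = ((a + b : ℝ) : ℂ) • ⁅x, y⁆ := by
  rw [leibniz_lie, hx, hy, smul_lie, lie_smul, ← add_smul]
  push_cast
  rfl

omit [Module.Finite ℂ S] [IsKilling ℂ S] in
lemma killingForm_eq_zero_of_add_ne_zero {a b : ℝ} (hs : a + b ≠ 0) {x y : S}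
    (hx : ⁅H, x⁆ = (a : ℂ) • x) (hy : ⁅H, y⁆ = (b : ℂ) • y) : killingForm ℂ S x y = 0 := by
  have h := killingForm_invariant x H y
  rw [← lie_skew, hx, hy, map_neg, LinearMap.neg_apply, map_smul, LinearMap.smul_apply, map_smul,
    smul_eq_mul, smul_eq_mul] at h
  have h2 : ((a + b : ℝ) : ℂ) * killingForm ℂ S x y = 0 := by
    push_cast
    linear_combination -h
  exact (mul_eq_zero.1 h2).resolve_left (Complex.ofReal_ne_zero.2 hs)

/-- The sum of the eigenspaces of `ad H` for positive real eigenvalues is abelian. -/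
def AbelianPositivePart (H : S) : Prop :=
  ∀ a b : ℝ, 0 < a → 0 < b → ∀ x y : S, ⁅H, x⁆ = (a : ℂ) • x → ⁅H, y⁆ = (b : ℂ) • y → ⁅x, y⁆ = 0

variable (hab : AbelianPositivePart H)
include hab

/-- If `x` is a root vector of negative degree and `z` has positive degree, and their bracket has
positive degree, then it vanishes: `z` is a primitive vector of weight `0` for the `sl₂`-triple
of the opposite of the root of `x`. -/
lemma lie_eq_zero_of_pos {α : Weight ℂ J S} {a c : ℝ} (ha : a < 0) (hc : 0 < c) (hac : 0 < a + c)
    {x z : S} (hx : x ∈ rootSpace J α) (hα : ∀ y ∈ rootSpace J α, ⁅H, y⁆ = (a : ℂ) • y)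
    (hα' : ∀ y ∈ rootSpace J (-α), ⁅H, y⁆ = ((-a : ℝ) : ℂ) • y)
    (hα0 : α.IsNonZero) (hz : ⁅H, z⁆ = (c : ℂ) • z) : ⁅x, z⁆ = 0 := by
  obtain ⟨h, e, f, t, he, hf⟩ := IsKilling.exists_isSl2Triple_of_weight_isNonZero hα0
  have hna : 0 < -a := neg_pos.2 ha
  have hfz : ⁅f, z⁆ = 0 := hab _ _ hna hc _ _ (hα' f hf) hz
  have hez : ⁅f, ⁅e, z⁆⁆ = 0 :=
    hab _ _ hna hac _ _ (hα' f hf) (lie_eigen (hα e he) hz)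
  have hhz : ⁅h, z⁆ = 0 := by
    rw [← t.lie_e_f, lie_lie, hfz, lie_zero, hez, sub_zero]
  have hez0 : ⁅e, z⁆ = 0 := by
    by_cases hz0 : z = 0
    · rw [hz0, lie_zero]
    have P : t.symm.HasPrimitiveVectorWith z (0 : ℂ) :=
      { ne_zero := hz0
        lie_h := by rw [neg_lie, hhz, neg_zero, zero_smul]
        lie_e := hfz }
    have := P.pow_toEnd_f_eq_zero_of_eq_nat (n := 0) (by simp)
    simpa using this
  have h1 := IsKilling.finrank_rootSpace_eq_one α hα0
  have hne : (⟨e, he⟩ : rootSpace J α) ≠ 0 := fun h => t.e_ne_zero (congrArg Subtype.val h)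
  obtain ⟨c, hc⟩ := (finrank_eq_one_iff_of_nonzero' _ hne).1 h1 ⟨x, hx⟩
  have hxe : x = c • e := (congrArg Subtype.val hc).symm
  rw [hxe, smul_lie, hez0, smul_zero]

variable (hH : H ∈ J) (hreal : ∀ α : Weight ℂ J S, (α ⟨H, hH⟩).im = 0)

omit hab in
include hreal in
lemma lie_of_mem_rootSpace (α : Weight ℂ J S) {x : S} (hx : x ∈ rootSpace J α) :
    ⁅H, x⁆ = ((α ⟨H, hH⟩).re : ℂ) • x := by
  have := IsKilling.lie_eq_smul_of_mem_rootSpace hx ⟨H, hH⟩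
  rw [show ((α ⟨H, hH⟩).re : ℂ) = α ⟨H, hH⟩ from Complex.ext rfl (by simp [hreal α])]
  exact this

include hH hreal in
/-- The sign of the grading element is additive on non-vanishing brackets of root vectors. -/
lemma sign_smul_lie {α β : Weight ℂ J S} {x y : S} (hx : x ∈ rootSpace J α)
    (hy : y ∈ rootSpace J β) :
    (Real.sign ((α ⟨H, hH⟩).re + (β ⟨H, hH⟩).re) : ℂ) • ⁅x, y⁆ =
      ((Real.sign (α ⟨H, hH⟩).re : ℂ) + Real.sign (β ⟨H, hH⟩).re) • ⁅x, y⁆ := by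
  have hroot := fun (α : Weight ℂ J S) {x : S} (hx : x ∈ rootSpace J α) =>
    lie_of_mem_rootSpace hH hreal α hx
  have hpos : ∀ (α β : Weight ℂ J S) {x y : S}, x ∈ rootSpace J α → y ∈ rootSpace J β →
      0 < (α ⟨H, hH⟩).re → 0 < (β ⟨H, hH⟩).re → ⁅x, y⁆ = 0 :=
    fun α β x y hx hy ha hb => hab _ _ ha hb x y (hroot α hx) (hroot β hy)
  have hA : ∀ (α β : Weight ℂ J S) {x y : S}, x ∈ rootSpace J α → y ∈ rootSpace J β →
      (α ⟨H, hH⟩).re < 0 → 0 < (β ⟨H, hH⟩).re → 0 < (α ⟨H, hH⟩).re + (β ⟨H, hH⟩).re →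
      ⁅x, y⁆ = 0 := by
    intro α β x y hx hy ha hb hs
    refine lie_eq_zero_of_pos hab ha hb hs hx (fun y hy => hroot α hy) (fun y hy => ?_) ?_
      (hroot β hy)
    · have := hroot (-α) (x := y) (by rwa [Weight.coe_neg])
      simpa using this
    · intro h
      rw [h.eq] at ha
      simp at ha
  set a := (α ⟨H, hH⟩).re with ha
  set b := (β ⟨H, hH⟩).re with hb
  have hxH := hroot α hx
  have hyH := hroot β hy
  rcases lt_trichotomy a 0 with ha0 | ha0 | ha0 <;> rcases lt_trichotomy b 0 with hb0 | hb0 | hb0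
  · -- two negative degrees: `κ(⁅x, y⁆, z) = κ(x, ⁅y, z⁆)` and `⁅y, z⁆ = 0` when it could matter
    have : ⁅x, y⁆ = 0 := by
      refine eq_zero_of_killingForm_rootSpace (J := J) fun δ z hz => ?_
      by_cases hd : (a + b) + (δ ⟨H, hH⟩).re = 0
      · rw [killingForm_invariant, hA β δ hy hz hb0 (by linarith) (by linarith), map_zero]
      · exact killingForm_eq_zero_of_add_ne_zero hd (lie_eigen hxH hyH) (hroot δ hz)
    rw [this, smul_zero, smul_zero]
  · rw [hb0, Real.sign_zero, add_zero, Complex.ofReal_zero, add_zero]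
  · rcases lt_trichotomy (a + b) 0 with hs | hs | hs
    · have : ⁅x, y⁆ = 0 := by
        refine eq_zero_of_killingForm_rootSpace (J := J) fun δ z hz => ?_
        by_cases hd : (a + b) + (δ ⟨H, hH⟩).re = 0
        · -- `y` and `z` have positive degree
          rw [killingForm_invariant, hpos β δ hy hz hb0 (by linarith), map_zero]
        · exact killingForm_eq_zero_of_add_ne_zero hd (lie_eigen hxH hyH) (hroot δ hz)
      rw [this, smul_zero, smul_zero]
    · rw [hs, Real.sign_of_neg ha0, Real.sign_of_pos hb0, Real.sign_zero]; simp
    · rw [hA α β hx hy ha0 hb0 hs, smul_zero, smul_zero]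
  · rw [ha0, Real.sign_zero, zero_add, Complex.ofReal_zero, zero_add]
  · rw [ha0, Real.sign_zero, zero_add, Complex.ofReal_zero, zero_add]
  · rw [ha0, Real.sign_zero, zero_add, Complex.ofReal_zero, zero_add]
  · rcases lt_trichotomy (a + b) 0 with hs | hs | hs
    · have : ⁅y, x⁆ = 0 := by
        refine eq_zero_of_killingForm_rootSpace (J := J) fun δ z hz => ?_
        by_cases hd : (b + a) + (δ ⟨H, hH⟩).re = 0
        · rw [killingForm_invariant, hpos α δ hx hz ha0 (by linarith), map_zero]
        · exact killingForm_eq_zero_of_add_ne_zero hd (lie_eigen hyH hxH) (hroot δ hz)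
      rw [← lie_skew, this, neg_zero, smul_zero, smul_zero]
    · rw [hs, Real.sign_of_pos ha0, Real.sign_of_neg hb0, Real.sign_zero]; simp
    · rw [← lie_skew, hA β α hy hx hb0 ha0 (by linarith), neg_zero, smul_zero, smul_zero]
  · rw [hb0, Real.sign_zero, add_zero, Complex.ofReal_zero, add_zero]
  · rw [hpos α β hx hy ha0 hb0, smul_zero, smul_zero]

include hH hreal in
/-- If the positive part is abelian, the operator that acts on the eigenspaces of `ad H` by the sign
of the eigenvalue is a derivation, hence inner. -/
lemma exists_sign_grading : ∃ H₀ ∈ J, ∀ (r : ℝ) (x : S), ⁅H, x⁆ = (r : ℂ) • x →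
    ⁅H₀, x⁆ = (Real.sign r : ℂ) • x := by
  classical
  let A := ad ℂ S H
  let s : Finset ℂ := (Module.End.finite_hasEigenvalue A).toFinset
  -- the sign of `ad H`, as a polynomial in `ad H`
  let q := Lagrange.interpolate s id (fun μ : ℂ => (Real.sign μ.re : ℂ))
  let D₀ : Module.End ℂ S := Polynomial.aeval A q
  have hD₀ : ∀ (r : ℝ) (x : S), ⁅H, x⁆ = (r : ℂ) • x → D₀ x = (Real.sign r : ℂ) • x := by
    intro r x hx
    by_cases hx0 : x = 0
    · simp [hx0]
    have hv : A.HasEigenvector (r : ℂ) x := ⟨Module.End.mem_eigenspace_iff.2 hx, hx0⟩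
    have hs : (r : ℂ) ∈ s := (Set.Finite.mem_toFinset _).2
      (Module.End.hasEigenvalue_of_hasEigenvector hv)
    change Polynomial.aeval A q x = _
    rw [Module.End.aeval_apply_of_hasEigenvector hv]
    have := Lagrange.eval_interpolate_at_node (fun μ : ℂ => (Real.sign μ.re : ℂ))
      (Set.injOn_id (s : Set ℂ)) hs
    simp only [id, Complex.ofReal_re] at this
    rw [this]
  have hroot := fun (α : Weight ℂ J S) {x : S} (hx : x ∈ rootSpace J α) =>
    lie_of_mem_rootSpace hH hreal α hx
  let B : S →ₗ[ℂ] S →ₗ[ℂ] S := LinearMap.mk₂ ℂ (fun x y => D₀ ⁅x, y⁆ - ⁅D₀ x, y⁆ - ⁅x, D₀ y⁆)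
    (fun x y z => by simp only [add_lie, map_add]; abel)
    (fun c x y => by simp only [smul_lie, map_smul, smul_sub])
    (fun x y z => by simp only [lie_add, map_add]; abel)
    (fun c x y => by simp only [lie_smul, map_smul, smul_sub])
  have hB : B = 0 := by
    have h1 : LinearMap.ker B = ⊤ := eq_top_of_rootSpace_le (J := J) fun α x hx => by
      have h2 : LinearMap.ker (B x) = ⊤ := eq_top_of_rootSpace_le (J := J) fun β y hy => by
        change D₀ ⁅x, y⁆ - ⁅D₀ x, y⁆ - ⁅x, D₀ y⁆ = 0
        rw [hD₀ _ _ (lie_eigen (hroot α hx) (hroot β hy)), hD₀ _ _ (hroot α hx),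
          hD₀ _ _ (hroot β hy), sign_smul_lie hab hH hreal hx hy, add_smul, smul_lie, lie_smul]
        abel
      exact LinearMap.mem_ker.2 (LinearMap.ker_eq_top.1 h2)
    exact LinearMap.ker_eq_top.1 h1
  let D : LieDerivation ℂ S S :=
    { D₀ with
      leibniz' := fun x y => by
        change D₀ ⁅x, y⁆ = ⁅x, D₀ y⁆ - ⁅y, D₀ x⁆
        have h : D₀ ⁅x, y⁆ - ⁅D₀ x, y⁆ - ⁅x, D₀ y⁆ = 0 :=
          DFunLike.congr_fun (DFunLike.congr_fun hB x) y
        rw [sub_sub, sub_eq_zero] at h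
        rw [h, ← lie_skew y (D₀ x)]
        abel }
  obtain ⟨H₀, hH₀⟩ := LieDerivation.IsKilling.exists_eq_ad (R := ℂ) (L := S) D
  have hH₀' : ∀ x, ⁅H₀, x⁆ = D₀ x := fun x => by
    have := DFunLike.congr_fun hH₀ x
    rwa [LieDerivation.ad_apply_apply] at this
  refine ⟨H₀, mem_cartan_of_commute fun y hy => ?_, fun r x hx => by rw [hH₀', hD₀ r x hx]⟩
  have h0 : ⁅H, y⁆ = ((0 : ℝ) : ℂ) • y := by
    have := congrArg Subtype.val (trivial_lie_zero J J ⟨H, hH⟩ ⟨y, hy⟩)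
    simpa using this
  rw [hH₀', hD₀ 0 y h0]
  simp

end Grading

/-! ### Short gradings and a polynomial model of the induced module -/

section ShortGrading

variable {g : Type*} [LieRing g] [LieAlgebra ℂ g]

/-- `H` defines a short grading `g = g₋₁ + g₀ + g₁`: `ad H` is a root of `t³ = t`. -/
def IsShortGrading (H : g) : Prop := ∀ x : g, ⁅H, ⁅H, ⁅H, x⁆⁆⁆ = ⁅H, x⁆

/-- The part of degree `k` in the grading by `ad H`. -/
def gr (H : g) (k : ℤ) : Submodule ℂ g where
  carrier := {x | ⁅H, x⁆ = (k : ℂ) • x}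
  zero_mem' := by simp
  add_mem' {x y} hx hy := by
    change ⁅H, x + y⁆ = _
    rw [lie_add, hx, hy, smul_add]
  smul_mem' c x hx := by
    change ⁅H, c • x⁆ = _
    rw [lie_smul, hx, smul_comm]

lemma mem_gr {H : g} {k : ℤ} {x : g} : x ∈ gr H k ↔ ⁅H, x⁆ = (k : ℂ) • x := Iff.rfl

lemma lie_mem_gr {H : g} {k l : ℤ} {x y : g} (hx : x ∈ gr H k) (hy : y ∈ gr H l) :
    ⁅x, y⁆ ∈ gr H (k + l) := by
  rw [mem_gr] at *
  rw [leibniz_lie, hx, hy, smul_lie, lie_smul, ← add_smul]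
  push_cast
  rfl

variable {H : g} (hH : IsShortGrading H)
include hH

lemma IsShortGrading.eq_zero {k : ℤ} (hk : k ≠ -1 ∧ k ≠ 0 ∧ k ≠ 1) {x : g} (hx : x ∈ gr H k) :
    x = 0 := by
  have h := hH x
  rw [mem_gr] at hx
  simp only [hx, lie_smul, smul_smul] at h
  rw [← sub_eq_zero, ← sub_smul] at h
  refine (smul_eq_zero.1 h).resolve_left ?_
  have : (k : ℂ) * k * k - k = ((k * (k - 1) * (k + 1) : ℤ) : ℂ) := by push_cast; ring
  rw [this]
  refine Int.cast_ne_zero.2 (mul_ne_zero (mul_ne_zero hk.2.1 (sub_ne_zero.2 hk.2.2)) ?_)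
  have := hk.1
  omega

lemma IsShortGrading.lie_eq_zero {k l : ℤ} (hk : k + l ≠ -1 ∧ k + l ≠ 0 ∧ k + l ≠ 1) {x y : g}
    (hx : x ∈ gr H k) (hy : y ∈ gr H l) : ⁅x, y⁆ = 0 :=
  hH.eq_zero hk (lie_mem_gr hx hy)

/-- The components of an element with respect to a short grading. -/
lemma IsShortGrading.exists_components (x : g) :
    ∃ a ∈ gr H (-1), ∃ b ∈ gr H 0, ∃ c ∈ gr H 1, x = a + b + c := by
  refine ⟨(2⁻¹ : ℂ) • (⁅H, ⁅H, x⁆⁆ - ⁅H, x⁆), ?_, x - ⁅H, ⁅H, x⁆⁆, ?_,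
    (2⁻¹ : ℂ) • (⁅H, ⁅H, x⁆⁆ + ⁅H, x⁆), ?_, ?_⟩
  · rw [mem_gr, lie_smul, lie_sub, hH]
    module
  · rw [mem_gr, lie_sub, hH]
    simp
  · rw [mem_gr, lie_smul, lie_add, hH]
    module
  · module

lemma IsShortGrading.induction {T : Submodule ℂ g} (h₁ : gr H (-1) ≤ T) (h₂ : gr H 0 ≤ T)
    (h₃ : gr H 1 ≤ T) (x : g) : x ∈ T := by
  obtain ⟨a, ha, b, hb, c, hc, rfl⟩ := hH.exists_components x
  exact add_mem (add_mem (h₁ ha) (h₂ hb)) (h₃ hc)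

end ShortGrading

section Model

open MvPolynomial

variable {g : Type*} [LieRing g] [LieAlgebra ℂ g] {H : g} {ι : Type*}
  {b : Module.Basis ι ℂ (gr H (-1))} {lin : g →ₗ[ℂ] MvPolynomial ι ℂ}

/-- A polynomial operator that commutes with the multiplication by linear polynomials is
determined by its value at `1`. -/
lemma operator_eq_zero {T : Module.End ℂ (MvPolynomial ι ℂ)} (h1 : T 1 = 0)
    (hT : ∀ i f, T (X i * f) = X i * T f) : T = 0 := by
  refine LinearMap.ext fun f => ?_
  induction f using MvPolynomial.induction_on with
  | C a => rw [C_eq_smul_one, map_smul, h1, smul_zero]; rfl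
  | add p q hp hq => rw [map_add, hp, hq]; simp
  | mul_X p i hp => rw [mul_comm, hT, hp]; simp

variable [Fintype ι]

variable (b lin) in
/-- The derivation of the symmetric algebra of `g₋₁` that extends the action of `x`. -/
def adOp : g →ₗ[ℂ] MvPolynomial ι ℂ →ₗ[ℂ] MvPolynomial ι ℂ :=
  LinearMap.mk₂ ℂ (fun x f => ∑ i, lin ⁅x, (b i : g)⁆ * pderiv i f)
    (fun x y f => by simp only [add_lie, map_add, add_mul, Finset.sum_add_distrib])
    (fun r x f => by simp only [smul_lie, map_smul, smul_mul_assoc, Finset.smul_sum])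
    (fun x f h => by simp only [map_add, mul_add, Finset.sum_add_distrib])
    (fun r x f => by simp only [Derivation.map_smul, mul_smul_comm, Finset.smul_sum])

lemma adOp_apply (x : g) (f : MvPolynomial ι ℂ) :
    adOp b lin x f = ∑ i, lin ⁅x, (b i : g)⁆ * pderiv i f := rfl

lemma adOp_mul (x : g) (f h : MvPolynomial ι ℂ) :
    adOp b lin x (f * h) = f * adOp b lin x h + adOp b lin x f * h := by
  simp only [adOp_apply, Derivation.leibniz, smul_eq_mul, mul_add, Finset.sum_add_distrib,
    Finset.mul_sum, Finset.sum_mul]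
  exact congrArg₂ _ (Finset.sum_congr rfl fun i _ => by ring)
    (Finset.sum_congr rfl fun i _ => by ring)

lemma adOp_C (x : g) (a : ℂ) : adOp b lin x (C a) = 0 := by
  simp [adOp_apply]

lemma eq_sum_repr {y : g} (hy : y ∈ gr H (-1)) : y = ∑ j, b.repr ⟨y, hy⟩ j • (b j : g) := by
  have := congrArg Subtype.val (b.sum_repr ⟨y, hy⟩)
  rw [AddSubmonoidClass.coe_finsetSum] at this
  exact this.symm

lemma lie_eq_sum {e y : g} (hy : y ∈ gr H (-1)) :
    ⁅e, y⁆ = ∑ i, b.repr ⟨y, hy⟩ i • ⁅e, (b i : g)⁆ := by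
  conv_lhs => rw [eq_sum_repr (b := b) hy]
  simp only [lie_sum, lie_smul]

variable (hlin : ∀ i, lin (b i) = X i)
include hlin

lemma pderiv_lin (i : ι) {y : g} (hy : y ∈ gr H (-1)) :
    pderiv i (lin y) = C (b.repr ⟨y, hy⟩ i) := by
  classical
  have h := congrArg (fun z => pderiv i (lin z)) (eq_sum_repr (b := b) hy)
  simp only [map_sum, map_smul, hlin] at h
  rw [h]
  simp [Pi.single_apply, C_eq_smul_one]

lemma adOp_lin (x : g) {y : g} (hy : y ∈ gr H (-1)) : adOp b lin x (lin y) = lin ⁅x, y⁆ := by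
  rw [adOp_apply, lie_eq_sum (b := b) hy, map_sum]
  refine Finset.sum_congr rfl fun i _ => ?_
  rw [pderiv_lin hlin i hy, map_smul, smul_eq_C_mul, mul_comm]

variable {c : g →ₗ[ℂ] ℂ}

omit hlin in
variable (b lin c) in
/-- The action of an element of degree `0` on the symmetric algebra of `g₋₁`: the derivation that
extends its adjoint action, shifted by the character `c`. -/
def rho : g →ₗ[ℂ] MvPolynomial ι ℂ →ₗ[ℂ] MvPolynomial ι ℂ :=
  LinearMap.mk₂ ℂ (fun x f => c x • f + adOp b lin x f)
    (fun x y f => by simp only [map_add, add_smul, LinearMap.add_apply]; abel)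
    (fun r x f => by simp only [map_smul, smul_add, smul_eq_mul, mul_smul, LinearMap.smul_apply])
    (fun x f h => by simp only [map_add, smul_add]; abel)
    (fun r x f => by simp only [map_smul, smul_add, smul_comm r])

omit hlin in
lemma rho_apply (x : g) (f : MvPolynomial ι ℂ) : rho b lin c x f = c x • f + adOp b lin x f := rfl

lemma rho_mul (x : g) {y : g} (hy : y ∈ gr H (-1)) (f : MvPolynomial ι ℂ) :
    rho b lin c x (lin y * f) = lin y * rho b lin c x f + lin ⁅x, y⁆ * f := by
  rw [rho_apply, rho_apply, adOp_mul, adOp_lin hlin x hy, mul_add, mul_smul_comm]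
  ring

omit hlin in
lemma rho_one (x : g) : rho b lin c x 1 = c x • 1 := by
  rw [rho_apply, ← C_1, adOp_C, add_zero]

omit hlin in
variable (b lin c) in
/-- The second order operator by which an element `e` of degree `1` acts on the symmetric algebra of
`g₋₁`. Moving `e` to the right through a product of elements `y ∈ g₋₁` yields the terms `c ⁅e, y⁆`,
and terms `⁅⁅e, y⁆, y'⁆` for the unordered pairs `y`, `y'`, which explains the factor `2⁻¹`. -/
def raiseOp : g →ₗ[ℂ] MvPolynomial ι ℂ →ₗ[ℂ] MvPolynomial ι ℂ :=
  LinearMap.mk₂ ℂ (fun e f => ∑ i, (c ⁅e, (b i : g)⁆ • pderiv i f +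
      (2⁻¹ : ℂ) • adOp b lin ⁅e, (b i : g)⁆ (pderiv i f)))
    (fun x y f => by
      rw [← Finset.sum_add_distrib]
      refine Finset.sum_congr rfl fun i _ => ?_
      simp only [add_lie, map_add, add_smul, LinearMap.add_apply, smul_add]
      abel)
    (fun r x f => by
      rw [Finset.smul_sum]
      refine Finset.sum_congr rfl fun i _ => ?_
      simp only [smul_lie, map_smul, smul_add, smul_eq_mul, mul_smul, LinearMap.smul_apply,
        smul_comm r (2⁻¹ : ℂ)])
    (fun x f h => by
      rw [← Finset.sum_add_distrib]
      refine Finset.sum_congr rfl fun i _ => ?_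
      simp only [map_add, smul_add]
      abel)
    (fun r x f => by
      rw [Finset.smul_sum]
      refine Finset.sum_congr rfl fun i _ => ?_
      simp only [Derivation.map_smul, map_smul, smul_add, smul_comm r])

omit hlin in
lemma raiseOp_apply (e : g) (f : MvPolynomial ι ℂ) :
    raiseOp b lin c e f = ∑ i, (c ⁅e, (b i : g)⁆ • pderiv i f +
      (2⁻¹ : ℂ) • adOp b lin ⁅e, (b i : g)⁆ (pderiv i f)) := rfl

omit hlin in
lemma raiseOp_one (e : g) : raiseOp b lin c e 1 = 0 := by
  rw [raiseOp_apply]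
  simp

/-- The commutator with the multiplication by `y ∈ g₋₁` is the action of `⁅e, y⁆`. -/
lemma raiseOp_mul (hH : IsShortGrading H) {e y : g} (hy : y ∈ gr H (-1))
    (f : MvPolynomial ι ℂ) :
    raiseOp b lin c e (lin y * f) = lin y * raiseOp b lin c e f + rho b lin c ⁅e, y⁆ f := by
  have hj : ∀ i, ⁅⁅e, (b i : g)⁆, y⁆ = ⁅⁅e, y⁆, (b i : g)⁆ := fun i => by
    rw [lie_lie, hH.lie_eq_zero (by norm_num) (b i).2 hy, lie_zero, zero_sub, lie_skew]
  have hterm : ∀ i, c ⁅e, (b i : g)⁆ • pderiv i (lin y * f) +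
      (2⁻¹ : ℂ) • adOp b lin ⁅e, (b i : g)⁆ (pderiv i (lin y * f)) =
      lin y * (c ⁅e, (b i : g)⁆ • pderiv i f +
        (2⁻¹ : ℂ) • adOp b lin ⁅e, (b i : g)⁆ (pderiv i f)) +
      (b.repr ⟨y, hy⟩ i • (c ⁅e, (b i : g)⁆ • f + (2⁻¹ : ℂ) • adOp b lin ⁅e, (b i : g)⁆ f) +
        (2⁻¹ : ℂ) • (lin ⁅⁅e, y⁆, (b i : g)⁆ * pderiv i f)) := by
    intro i
    rw [Derivation.leibniz, pderiv_lin hlin i hy, smul_eq_mul, smul_eq_mul, map_add,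
      adOp_mul, adOp_mul, adOp_lin hlin _ hy, hj, adOp_C]
    simp only [smul_eq_C_mul]
    ring
  rw [raiseOp_apply, Finset.sum_congr rfl fun i _ => hterm i, Finset.sum_add_distrib,
    ← Finset.mul_sum, ← raiseOp_apply, Finset.sum_add_distrib, ← Finset.smul_sum, ← adOp_apply]
  congr 1
  rw [rho_apply]
  have h3 : ∑ i, b.repr ⟨y, hy⟩ i • (c ⁅e, (b i : g)⁆ • f +
      (2⁻¹ : ℂ) • adOp b lin ⁅e, (b i : g)⁆ f) = c ⁅e, y⁆ • f + (2⁻¹ : ℂ) • adOp b lin ⁅e, y⁆ f := by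
    conv_rhs => rw [lie_eq_sum (b := b) hy]
    simp only [map_sum, map_smul, LinearMap.sum_apply, LinearMap.smul_apply]
    rw [Finset.sum_smul, Finset.smul_sum, ← Finset.sum_add_distrib]
    refine Finset.sum_congr rfl fun i _ => ?_
    rw [smul_add, smul_smul, smul_comm (2⁻¹ : ℂ), smul_eq_mul]
  rw [h3]
  module

variable (hH : IsShortGrading H)
  (hc : ∀ x ∈ gr H 0, ∀ y ∈ gr H 0, c ⁅x, y⁆ = 0)
include hH hc

omit hH in
lemma rho_lie {x x' : g} (hx : x ∈ gr H 0) (hx' : x' ∈ gr H 0) (f : MvPolynomial ι ℂ) :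
    rho b lin c ⁅x, x'⁆ f = rho b lin c x (rho b lin c x' f) - rho b lin c x' (rho b lin c x f) := by
  have h : rho b lin c ⁅x, x'⁆ - (rho b lin c x ∘ₗ rho b lin c x' -
      rho b lin c x' ∘ₗ rho b lin c x) = 0 := by
    refine operator_eq_zero ?_ fun i f => ?_
    · simp only [LinearMap.sub_apply, LinearMap.comp_apply, rho_one, map_smul, hc x hx x' hx',
        smul_smul, zero_smul, zero_sub]
      rw [mul_comm, sub_self, neg_zero]
    · have hb := (b i).2
      have h0 := fun {z : g} (hz : z ∈ gr H 0) =>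
        (by simpa using lie_mem_gr hz hb : ⁅z, (b i : g)⁆ ∈ gr H (-1))
      rw [← hlin i]
      simp only [LinearMap.sub_apply, LinearMap.comp_apply, rho_mul hlin _ hb, map_add,
        rho_mul hlin _ (h0 hx), rho_mul hlin _ (h0 hx'), lie_lie, map_sub]
      ring
  have := DFunLike.congr_fun h f
  rwa [LinearMap.sub_apply, LinearMap.zero_apply, sub_eq_zero] at this

lemma raiseOp_lie {x e : g} (hx : x ∈ gr H 0) (he : e ∈ gr H 1) (f : MvPolynomial ι ℂ) :
    raiseOp b lin c ⁅x, e⁆ f =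
      rho b lin c x (raiseOp b lin c e f) - raiseOp b lin c e (rho b lin c x f) := by
  have h : raiseOp b lin c ⁅x, e⁆ - (rho b lin c x ∘ₗ raiseOp b lin c e -
      raiseOp b lin c e ∘ₗ rho b lin c x) = 0 := by
    refine operator_eq_zero ?_ fun i f => ?_
    · simp only [LinearMap.sub_apply, LinearMap.comp_apply, rho_one, map_smul, raiseOp_one,
        smul_zero, map_zero, sub_zero]
    · have hb := (b i).2
      have h0 : ⁅x, (b i : g)⁆ ∈ gr H (-1) := by simpa using lie_mem_gr hx hb
      have h1 : ⁅e, (b i : g)⁆ ∈ gr H 0 := by simpa using lie_mem_gr he hb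
      rw [← hlin i]
      simp only [LinearMap.sub_apply, LinearMap.comp_apply, rho_mul hlin _ hb, map_add,
        raiseOp_mul hlin hH hb, raiseOp_mul hlin hH h0, lie_lie]
      have := rho_lie (b := b) hlin hc hx h1 f
      rw [map_sub, LinearMap.sub_apply]
      linear_combination this
  have := DFunLike.congr_fun h f
  rwa [LinearMap.sub_apply, LinearMap.zero_apply, sub_eq_zero] at this

lemma raiseOp_comm {e e' : g} (he : e ∈ gr H 1) (he' : e' ∈ gr H 1) (f : MvPolynomial ι ℂ) :
    raiseOp b lin c e (raiseOp b lin c e' f) = raiseOp b lin c e' (raiseOp b lin c e f) := by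
  have h : raiseOp b lin c e ∘ₗ raiseOp b lin c e' -
      raiseOp b lin c e' ∘ₗ raiseOp b lin c e = 0 := by
    refine operator_eq_zero ?_ fun i f => ?_
    · simp only [LinearMap.sub_apply, LinearMap.comp_apply, raiseOp_one, map_zero, sub_zero]
    · have hb := (b i).2
      have h1 : ⁅e, (b i : g)⁆ ∈ gr H 0 := by simpa using lie_mem_gr he hb
      have h1' : ⁅e', (b i : g)⁆ ∈ gr H 0 := by simpa using lie_mem_gr he' hb
      rw [← hlin i]
      simp only [LinearMap.sub_apply, LinearMap.comp_apply, map_add, raiseOp_mul hlin hH hb]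
      have r1 := raiseOp_lie (b := b) hlin hH hc h1 he' f
      have r2 := raiseOp_lie (b := b) hlin hH hc h1' he f
      have r3 : ⁅⁅e, (b i : g)⁆, e'⁆ = ⁅⁅e', (b i : g)⁆, e⁆ := by
        have : ⁅e, e'⁆ = 0 := hH.lie_eq_zero (by norm_num) he he'
        rw [lie_lie, this, lie_zero, sub_zero, ← lie_skew _ e, ← lie_skew e', lie_neg, neg_neg]
      rw [r3, r2] at r1
      linear_combination -r1
  have := DFunLike.congr_fun h f
  rwa [LinearMap.sub_apply, LinearMap.zero_apply, sub_eq_zero] at this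

omit hlin hH hc in
variable (b lin c) in
/-- The operator by which an element of `g` acts on the symmetric algebra of `g₋₁`. It is used for
`lin` and `c` that vanish on the homogeneous parts of degree `≠ -1` and `≠ 0`, respectively. Then
only one of the three summands is nonzero on each homogeneous part of `g`. -/
def modelOp (x : g) : MvPolynomial ι ℂ →ₗ[ℂ] MvPolynomial ι ℂ :=
  LinearMap.mulLeft ℂ (lin x) + rho b lin c x + raiseOp b lin c x

omit hlin hH hc in
lemma modelOp_apply (x : g) (f : MvPolynomial ι ℂ) :
    modelOp b lin c x f = lin x * f + rho b lin c x f + raiseOp b lin c x f := rfl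

variable (hl0 : ∀ x ∈ gr H 0, lin x = 0) (hl1 : ∀ x ∈ gr H 1, lin x = 0)
  (hc1 : ∀ x ∈ gr H 1, c x = 0) (hcn : ∀ x ∈ gr H (-1), c x = 0)
include hl0 hl1 hc1 hcn

omit hlin hc hl0 hl1 hc1 hcn in
lemma adOp_neg {x : g} (hx : x ∈ gr H (-1)) : adOp b lin x = 0 := by
  refine LinearMap.ext fun f => ?_
  rw [adOp_apply]
  refine Finset.sum_eq_zero fun i _ => ?_
  rw [hH.lie_eq_zero (by norm_num) hx (b i).2, map_zero, zero_mul]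

omit hlin hc hl0 hl1 hc1 in
lemma modelOp_neg {x : g} (hx : x ∈ gr H (-1)) (f : MvPolynomial ι ℂ) :
    modelOp b lin c x f = lin x * f := by
  have h : ∀ i, ⁅x, (b i : g)⁆ = 0 := fun i => hH.lie_eq_zero (by norm_num) hx (b i).2
  rw [modelOp_apply, rho_apply, hcn x hx, raiseOp_apply, adOp_neg hH hx]
  simp [h]

omit hlin hc hl1 hc1 in
lemma modelOp_zero {x : g} (hx : x ∈ gr H 0) (f : MvPolynomial ι ℂ) :
    modelOp b lin c x f = rho b lin c x f := by
  have h : ∀ i, ⁅x, (b i : g)⁆ ∈ gr H (-1) := fun i => by simpa using lie_mem_gr hx (b i).2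
  rw [modelOp_apply, raiseOp_apply, hl0 x hx]
  simp [adOp_neg hH (h _), hcn _ (h _)]

omit hlin hH hc hcn in
lemma modelOp_pos {x : g} (hx : x ∈ gr H 1) (f : MvPolynomial ι ℂ) :
    modelOp b lin c x f = raiseOp b lin c x f := by
  have h : ∀ i, ⁅x, (b i : g)⁆ ∈ gr H 0 := fun i => by simpa using lie_mem_gr hx (b i).2
  rw [modelOp_apply, rho_apply, adOp_apply, hl1 x hx, hc1 x hx]
  simp [hl0 _ (h _)]

/-- The operators `modelOp` define a representation: it suffices to compare homogeneous elements,
and the two sides agree at `1` and have the same commutators with multiplications. -/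
lemma modelOp_lie (x y : g) (f : MvPolynomial ι ℂ) : modelOp b lin c ⁅x, y⁆ f =
    modelOp b lin c x (modelOp b lin c y f) - modelOp b lin c y (modelOp b lin c x f) := by
  have hadd : ∀ x y f, modelOp b lin c (x + y) f = modelOp b lin c x f + modelOp b lin c y f := by
    intro x y f
    simp only [modelOp_apply, map_add, LinearMap.add_apply]
    ring
  have hsmul : ∀ (r : ℂ) x f, modelOp b lin c (r • x) f = r • modelOp b lin c x f := by
    intro r x f
    simp only [modelOp_apply, map_smul, LinearMap.smul_apply, smul_add, smul_mul_assoc]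
  have hzero : ∀ f, modelOp b lin c 0 f = 0 := fun f => by
    simp [modelOp_apply]
  have mneg := fun {x : g} (hx : x ∈ gr H (-1)) => modelOp_neg (b := b) (lin := lin) hH hcn hx
  have mzero := fun {x : g} (hx : x ∈ gr H 0) => modelOp_zero (b := b) hH hl0 hcn hx
  have mpos := fun {x : g} (hx : x ∈ gr H 1) => modelOp_pos (b := b) hl0 hl1 hc1 hx
  let P : g → g → Prop := fun x y => ∀ f, modelOp b lin c ⁅x, y⁆ f =
    modelOp b lin c x (modelOp b lin c y f) - modelOp b lin c y (modelOp b lin c x f)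
  have hsymm : ∀ {x y}, P x y → P y x := by
    intro x y h f
    rw [← lie_skew, ← neg_one_smul ℂ, hsmul, h, neg_one_smul, neg_sub]
  let T : g → Submodule ℂ g := fun x =>
    { carrier := {y | P x y}
      zero_mem' := fun f => by simp [hzero]
      add_mem' := fun {y y'} h h' f => by
        rw [lie_add, hadd, h, h', hadd, hadd, map_add]
        abel
      smul_mem' := fun r y h f => by
        rw [lie_smul, hsmul, h, hsmul, hsmul, map_smul, smul_sub] }
  have hnn : ∀ x ∈ gr H (-1), ∀ y ∈ gr H (-1), P x y := fun x hx y hy f => by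
    rw [hH.lie_eq_zero (by norm_num) hx hy, hzero]
    simp only [mneg hx, mneg hy]
    ring
  have h0n : ∀ x ∈ gr H 0, ∀ y ∈ gr H (-1), P x y := fun x hx y hy f => by
    rw [mneg (by simpa using lie_mem_gr hx hy)]
    simp only [mneg hy, mzero hx, rho_mul hlin x hy]
    ring
  have h00 : ∀ x ∈ gr H 0, ∀ y ∈ gr H 0, P x y := fun x hx y hy f => by
    rw [mzero (by simpa using lie_mem_gr hx hy)]
    simp only [mzero hx, mzero hy, rho_lie hlin hc hx hy]
  have hpn : ∀ x ∈ gr H 1, ∀ y ∈ gr H (-1), P x y := fun x hx y hy f => by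
    rw [mzero (by simpa using lie_mem_gr hx hy)]
    simp only [mneg hy, mpos hx, raiseOp_mul hlin hH hy]
    ring
  have h0p : ∀ x ∈ gr H 0, ∀ y ∈ gr H 1, P x y := fun x hx y hy f => by
    rw [mpos (by simpa using lie_mem_gr hx hy)]
    simp only [mzero hx, mpos hy, raiseOp_lie hlin hH hc hx hy]
  have hpp : ∀ x ∈ gr H 1, ∀ y ∈ gr H 1, P x y := fun x hx y hy f => by
    rw [hH.lie_eq_zero (by norm_num) hx hy, hzero]
    simp only [mpos hx, mpos hy]
    rw [raiseOp_comm hlin hH hc hx hy, sub_self]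
  have key : ∀ x y, P x y := fun x y => by
    have h1 : ∀ x ∈ gr H (-1), ∀ y, P x y := fun x hx y => hH.induction (T := T x)
      (fun y hy => hnn x hx y hy) (fun y hy => hsymm (h0n y hy x hx))
      (fun y hy => hsymm (hpn y hy x hx)) y
    have h2 : ∀ x ∈ gr H 0, ∀ y, P x y := fun x hx y => hH.induction (T := T x)
      (fun y hy => h0n x hx y hy) (fun y hy => h00 x hx y hy) (fun y hy => h0p x hx y hy) y
    have h3 : ∀ x ∈ gr H 1, ∀ y, P x y := fun x hx y => hH.induction (T := T x)
      (fun y hy => hpn x hx y hy) (fun y hy => hsymm (h0p y hy x hx))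
      (fun y hy => hpp x hx y hy) y
    exact hsymm (hH.induction (T := T y) (fun x hx => hsymm (h1 x hx y))
      (fun x hx => hsymm (h2 x hx y)) (fun x hx => hsymm (h3 x hx y)) x)
  exact key x y f

end Model

section Nonzero

open MvPolynomial

attribute [local instance 100] LieRing.ofAssociativeRing

variable {g : Type u} [LieRing g] [LieAlgebra ℂ g] [Module.Finite ℂ g] {H : g}

omit [Module.Finite ℂ g] in
/-- The induced module maps onto the submodule generated by an eigenvector `m` of weight `χ`. -/
lemma unit_oneDim_ne_zero_of_hom (p : LieSubalgebra ℂ g) (χ : LieAlgebra.LieCharacter ℂ p)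
    {V : Type*} [AddCommGroup V] [Module ℂ V] (ρ : g →ₗ⁅ℂ⁆ Module.End ℂ V) {m : V} (hm : m ≠ 0)
    (h : ∀ x : p, ρ x m = χ x • m) : unit p (OneDim χ) (1 : ℂ) ≠ 0 := by
  let _ : LieRingModule g V := LieRingModule.compLieHom V ρ
  have _ : LieModule ℂ g V := LieModule.compLieHom V ρ
  let ψ : OneDim χ →ₗ[ℂ] V := LinearMap.toSpanSingleton ℂ V m
  obtain ⟨φ, hφ⟩ := exists_hom_of_equivariant p (OneDim χ) ψ (fun x (a : ℂ) => by
      change (χ x • a) • m = ρ x (a • m)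
      rw [map_smul, h, smul_smul, smul_eq_mul, mul_comm])
  intro h0
  have h2 := hφ (1 : ℂ)
  rw [h0, map_zero] at h2
  exact hm (h2.trans (one_smul ℂ m)).symm

/-- If the positive part of the grading is abelian, the module induced from a character of `p` is
not zero: it maps onto the symmetric algebra of `g₋₁`. -/
theorem unit_oneDim_ne_zero (hH : IsShortGrading H) (p : LieSubalgebra ℂ g)
    (h0 : gr H 0 ≤ p.toSubmodule) (h1 : gr H 1 ≤ p.toSubmodule)
    (hp : p.toSubmodule ≤ gr H 0 ⊔ gr H 1) (χ : LieAlgebra.LieCharacter ℂ p) :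
    unit p (OneDim χ) (1 : ℂ) ≠ 0 := by
  let A := LieAlgebra.ad ℂ g H
  let pn : g →ₗ[ℂ] gr H (-1) := LinearMap.codRestrict _ ((2⁻¹ : ℂ) • (A ∘ₗ A - A)) fun x => by
    change ⁅H, (2⁻¹ : ℂ) • (⁅H, ⁅H, x⁆⁆ - ⁅H, x⁆)⁆ = _ • (2⁻¹ : ℂ) • (⁅H, ⁅H, x⁆⁆ - ⁅H, x⁆)
    rw [lie_smul, lie_sub, hH]
    module
  let p0 : g →ₗ[ℂ] p := LinearMap.codRestrict p.toSubmodule (LinearMap.id - A ∘ₗ A) fun x => by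
    refine h0 ?_
    change ⁅H, x - ⁅H, ⁅H, x⁆⁆⁆ = _
    rw [lie_sub, hH]
    simp
  have hpn : ∀ x, (pn x : g) = (2⁻¹ : ℂ) • (⁅H, ⁅H, x⁆⁆ - ⁅H, x⁆) := fun x => rfl
  have hp0 : ∀ x, (p0 x : g) = x - ⁅H, ⁅H, x⁆⁆ := fun x => rfl
  have hHp : H ∈ p := h0 (by rw [mem_gr]; simp)
  let b := Module.finBasis ℂ (gr H (-1))
  let lin : g →ₗ[ℂ] MvPolynomial (Fin (Module.finrank ℂ (gr H (-1)))) ℂ := b.constr ℂ X ∘ₗ pn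
  let c : g →ₗ[ℂ] ℂ := (χ : p →ₗ[ℂ] ℂ) ∘ₗ p0
  have hpn' : ∀ x : gr H (-1), pn x = x := fun x => by
    refine Subtype.ext ?_
    rw [hpn, mem_gr.1 x.2, lie_smul, mem_gr.1 x.2]
    module
  have hp0' : ∀ x (hx : x ∈ gr H 0), p0 x = ⟨x, h0 hx⟩ := fun x hx => by
    refine Subtype.ext ?_
    rw [hp0, mem_gr.1 hx]
    simp
  have hχ1 : ∀ x (hx : x ∈ gr H 1), χ ⟨x, h1 hx⟩ = 0 := fun x hx => by
    have h : (⟨x, h1 hx⟩ : p) = ⁅(⟨H, hHp⟩ : p), (⟨x, h1 hx⟩ : p)⁆ :=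
      Subtype.ext (by rw [LieSubalgebra.coe_bracket, mem_gr.1 hx]; simp)
    rw [h, LieAlgebra.lieCharacter_apply_lie]
  have hlin : ∀ i, lin (b i) = X i := fun i => by
    change b.constr ℂ X (pn (b i)) = _
    rw [hpn', Module.Basis.constr_basis]
  have hl0 : ∀ x ∈ gr H 0, lin x = 0 := fun x hx => by
    have : pn x = 0 := Subtype.ext (by rw [hpn, mem_gr.1 hx]; simp)
    change b.constr ℂ X (pn x) = _
    rw [this, map_zero]
  have hl1 : ∀ x ∈ gr H 1, lin x = 0 := fun x hx => by
    have : pn x = 0 := Subtype.ext (by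
      rw [hpn, mem_gr.1 hx, lie_smul, mem_gr.1 hx]; simp)
    change b.constr ℂ X (pn x) = _
    rw [this, map_zero]
  have hc0 : ∀ x (hx : x ∈ gr H 0), c x = χ ⟨x, h0 hx⟩ := fun x hx => by
    change χ (p0 x) = _
    rw [hp0' x hx]
  have hc1 : ∀ x ∈ gr H 1, c x = 0 := fun x hx => by
    have : p0 x = 0 := Subtype.ext (by
      rw [hp0, mem_gr.1 hx, lie_smul, mem_gr.1 hx]; simp)
    change χ (p0 x) = _
    rw [this, map_zero]
  have hcn : ∀ x ∈ gr H (-1), c x = 0 := fun x hx => by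
    have : p0 x = 0 := Subtype.ext (by
      rw [hp0, mem_gr.1 hx, lie_smul, mem_gr.1 hx]; simp)
    change χ (p0 x) = _
    rw [this, map_zero]
  have hc : ∀ x ∈ gr H 0, ∀ y ∈ gr H 0, c ⁅x, y⁆ = 0 := fun x hx y hy => by
    have hxy : ⁅x, y⁆ ∈ gr H 0 := by simpa using lie_mem_gr hx hy
    rw [hc0 _ hxy]
    exact LieAlgebra.lieCharacter_apply_lie χ ⟨x, h0 hx⟩ ⟨y, h0 hy⟩
  let ρ : g →ₗ⁅ℂ⁆ Module.End ℂ (MvPolynomial (Fin (Module.finrank ℂ (gr H (-1)))) ℂ) :=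
    { toFun := modelOp b lin c
      map_add' := fun x y => LinearMap.ext fun f => by
        simp only [modelOp_apply, map_add, LinearMap.add_apply]
        ring
      map_smul' := fun r x => LinearMap.ext fun f => by
        simp only [modelOp_apply, map_smul, LinearMap.smul_apply, smul_add, smul_mul_assoc,
          RingHom.id_apply]
      map_lie' := fun {x y} => LinearMap.ext fun f =>
        modelOp_lie hlin hH hc hl0 hl1 hc1 hcn x y f }
  refine unit_oneDim_ne_zero_of_hom p χ ρ (m := 1) one_ne_zero fun x => ?_
  obtain ⟨y, hy, z, hz, hyz⟩ := Submodule.mem_sup.1 (hp x.2)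
  have hx : x = ⟨y, h0 hy⟩ + ⟨z, h1 hz⟩ := Subtype.ext hyz.symm
  rw [hx, map_add, hχ1 z hz, add_zero]
  change ρ (y + z) 1 = _
  rw [map_add]
  change modelOp b lin c y 1 + modelOp b lin c z 1 = _
  rw [modelOp_zero hH hl0 hcn hy, modelOp_pos hl0 hl1 hc1 hz, raiseOp_one, rho_one, add_zero,
    hc0 y hy]

end Nonzero

/-! ### Roots and the Killing form -/

section RootForm

open LieAlgebra LieModule IsKilling

variable {S : Type*} [LieRing S] [LieAlgebra ℂ S] [Module.Finite ℂ S] [IsKilling ℂ S]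
variable {J : LieSubalgebra ℂ S} [J.IsCartanSubalgebra]

lemma killingForm_cartanEquivDual_symm (μ : Module.Dual ℂ J) (h : J) :
    killingForm ℂ S ((cartanEquivDual J).symm μ : J) h = μ h := by
  have := LinearMap.congr_fun ((cartanEquivDual J).apply_symm_apply μ) h
  rw [← this]
  rfl

/-- The square length of a nonzero root is a positive real number: the square length of the coroot
is a sum of squares of integers. -/
lemma exists_pos_root_apply (α : Weight ℂ J S) (hα : α.IsNonZero) :
    ∃ q : ℝ, 0 < q ∧ α ((cartanEquivDual J).symm α.toLinear) = q := by
  classical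
  set a := α ((cartanEquivDual J).symm α.toLinear) with ha
  have ha0 : a ≠ 0 := root_apply_cartanEquivDual_symm_ne_zero hα
  have h1 : killingForm ℂ S (coroot α : S) (coroot α) = 4 * a⁻¹ := by
    change traceForm ℂ J S (coroot α) (coroot α) = _
    rw [traceForm_coroot, root_apply_coroot hα]
    simp only [smul_eq_mul, nsmul_eq_mul]
    push_cast
    ring
  have h2 : killingForm ℂ S (coroot α : S) (coroot α) =
      ∑ β ∈ J.root, (((chainLength α β - 2 * chainTopCoeff α β : ℤ) : ℝ) ^ 2 : ℝ) := by
    have := LinearMap.congr_fun (LinearMap.congr_fun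
      (restrict_killingForm_eq_sum (K := ℂ) (L := S) (H := J)) (coroot α)) (coroot α)
    rw [LinearMap.BilinForm.restrict_apply] at this
    change killingForm ℂ S (coroot α : S) (coroot α) = _ at this
    rw [this]
    simp only [LinearMap.sum_apply, LinearMap.smulRight_apply, LinearMap.smul_apply, smul_eq_mul]
    rw [Complex.ofReal_sum]
    refine Finset.sum_congr rfl fun β _ => ?_
    change β (coroot α) * β (coroot α) = _
    rw [apply_coroot_eq_cast' α β, sq]
    push_cast
    ring
  set N : ℝ := ∑ β ∈ J.root, (((chainLength α β - 2 * chainTopCoeff α β : ℤ) : ℝ) ^ 2 : ℝ)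
  have hN : 0 ≤ N := Finset.sum_nonneg fun β _ => sq_nonneg _
  have h3 : (4 : ℂ) * a⁻¹ = N := by rw [← h1, h2]
  have hN0 : N ≠ 0 := fun h => by
    rw [h, Complex.ofReal_zero] at h3
    exact mul_ne_zero (by norm_num) (inv_ne_zero ha0) h3
  refine ⟨4 / N, by positivity, ?_⟩
  push_cast
  rw [← h3]
  field_simp

/-- Two roots whose sum is not a root enclose an angle of at most `90` degrees. -/
lemma root_apply_nonneg (α β : Weight ℂ J S) (hα : α.IsNonZero)
    (h : ∀ e ∈ rootSpace J α, ∀ x ∈ rootSpace J β, ⁅e, x⁆ = 0) :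
    ∃ q : ℝ, 0 ≤ q ∧ β ((cartanEquivDual J).symm α.toLinear) = q := by
  obtain ⟨q, hq, hαq⟩ := exists_pos_root_apply α hα
  obtain ⟨x, hx, hx0⟩ := β.exists_ne_zero
  obtain ⟨h', e, f, t, he, hf⟩ := exists_isSl2Triple_of_weight_isNonZero hα
  have hh := t.h_eq_coroot hα he hf
  have P : t.HasPrimitiveVectorWith x (β (coroot α)) :=
    { ne_zero := hx0
      lie_h := by rw [hh]; exact lie_eq_smul_of_mem_rootSpace hx (coroot α)
      lie_e := h e he x hx }
  obtain ⟨n, hn⟩ := P.exists_nat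
  refine ⟨q / 2 * n, by positivity, ?_⟩
  have hq0 : (q : ℂ) ≠ 0 := by exact_mod_cast hq.ne'
  have h1 : β (coroot α) = 2 * (q : ℂ)⁻¹ * β ((cartanEquivDual J).symm α.toLinear) := by
    rw [coroot]
    have h2 : ((2 : ℕ) • (α ((cartanEquivDual J).symm α.toLinear))⁻¹ •
        (cartanEquivDual J).symm α.toLinear : J) =
        (2 * (q : ℂ)⁻¹) • (cartanEquivDual J).symm α.toLinear := by
      rw [hαq, ← Nat.cast_smul_eq_nsmul ℂ, smul_smul]
      norm_num
    rw [h2]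
    exact map_smul (β.toLinear : J →ₗ[ℂ] ℂ) _ _
  rw [h1] at hn
  push_cast
  rw [← hn]
  field_simp

variable (J) in
/-- A basis of root vectors together with the dual basis with respect to the Killing form. -/
lemma exists_root_dual_bases : ∃ (n : ℕ) (b b' : Fin n → S)
    (w : Fin n → Weight ℂ J S), (∀ x, x = ∑ i, killingForm ℂ S x (b' i) • b i) ∧
      (∀ x, x = ∑ i, killingForm ℂ S x (b i) • b' i) ∧ (∀ i, b i ∈ rootSpace J (w i)) ∧
      (∀ i, b' i ∈ rootSpace J (-w i)) ∧ ∀ i, killingForm ℂ S (b i) (b' i) = 1 := by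
  classical
  let s : Set S := {x | ∃ α : Weight ℂ J S, x ∈ rootSpace J α}
  have hs : ⊤ ≤ Submodule.span ℂ s :=
    (eq_top_of_rootSpace_le (J := J) fun α x hx => Submodule.subset_span (show x ∈ s from ⟨α, hx⟩)).ge
  let b₀ := Module.Basis.ofSpan hs
  let _ := Module.Basis.fintypeIndexOfRankLtAleph0 b₀ (Module.rank_lt_aleph0 ℂ S)
  let b := b₀.reindex (Fintype.equivFin _)
  have hbs : ∀ i, ∃ α : Weight ℂ J S, b i ∈ rootSpace J α := fun i => by
    rw [Module.Basis.reindex_apply]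
    exact Module.Basis.ofSpan_subset hs (Set.mem_range_self _)
  choose w hw using hbs
  have hnd := IsKilling.killingForm_nondegenerate ℂ S
  let b' := (killingForm ℂ S).dualBasis hnd b
  have hb'b : ∀ i j, killingForm ℂ S (b' i) (b j) = if j = i then 1 else 0 := fun i j =>
    LinearMap.BilinForm.apply_dualBasis_left hnd b i j
  refine ⟨_, b, b', w, fun x => ?_, fun x => ?_, hw, fun i => ?_, fun i => ?_⟩
  · conv_lhs => rw [← b.sum_repr x]
    refine Finset.sum_congr rfl fun i _ => ?_
    congr 1
    conv_rhs => rw [← b.sum_repr x, map_sum, LinearMap.sum_apply]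
    simp [killingForm_symm _ (b' i), hb'b]
  · conv_lhs => rw [← b'.sum_repr x]
    refine Finset.sum_congr rfl fun i _ => ?_
    rw [LinearMap.BilinForm.dualBasis_repr_apply]
  · refine weightSpace_le_genWeightSpace S _ ?_
    rw [mem_weightSpace]
    intro h
    rw [← sub_eq_zero]
    refine hnd.1 _ fun y => ?_
    have : killingForm ℂ S (⁅h, b' i⁆ - (-⇑(w i)) h • b' i) = 0 := by
      refine b.ext fun j => ?_
      have hj : ⁅(h : S), b j⁆ = w j h • b j := lie_eq_smul_of_mem_rootSpace (hw j) h
      have : killingForm ℂ S ⁅(h : S), b' i⁆ (b j) = -(w j h * if j = i then 1 else 0) := by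
        rw [← lie_skew, map_neg, LinearMap.neg_apply, killingForm_invariant, hj, map_smul,
          smul_eq_mul, hb'b]
      rw [map_sub, LinearMap.sub_apply, map_smul, LinearMap.smul_apply, hb'b]
      change killingForm ℂ S ⁅(h : S), b' i⁆ (b j) - _ = 0
      rw [this]
      by_cases hij : j = i
      · subst hij; simp
      · simp [hij]
    rw [this]; rfl
  · rw [killingForm_symm, hb'b, if_pos rfl]

/-- An element of the Cartan subalgebra that is regular with real parts, and dominates the grading
by `ad H₀`. -/
lemma exists_regular_element {H₀ : S} (hH₀ : H₀ ∈ J) (hgr : IsShortGrading H₀) :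
    ∃ h₁ : J, ∀ α : Weight ℂ J S, α.IsNonZero →
      (0 < (α h₁).re ∧ (α ⟨H₀, hH₀⟩ = 0 ∨ α ⟨H₀, hH₀⟩ = 1)) ∨
      ((α h₁).re < 0 ∧ (α ⟨H₀, hH₀⟩ = 0 ∨ α ⟨H₀, hH₀⟩ = -1)) := by
  classical
  have hdeg : ∀ α : Weight ℂ J S,
      α ⟨H₀, hH₀⟩ = 0 ∨ α ⟨H₀, hH₀⟩ = 1 ∨ α ⟨H₀, hH₀⟩ = -1 := fun α => by
    obtain ⟨x, hx, hx0⟩ := α.exists_ne_zero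
    have h := lie_eq_smul_of_mem_rootSpace hx ⟨H₀, hH₀⟩
    change ⁅H₀, x⁆ = _ at h
    have h3 := hgr x
    simp only [h, lie_smul, smul_smul] at h3
    have h4 := smul_left_injective ℂ hx0 h3
    have h5 : α ⟨H₀, hH₀⟩ * ((α ⟨H₀, hH₀⟩ - 1) * (α ⟨H₀, hH₀⟩ + 1)) = 0 := by
      linear_combination h4
    rcases mul_eq_zero.1 h5 with h6 | h6
    · exact Or.inl h6
    rcases mul_eq_zero.1 h6 with h7 | h7
    · exact Or.inr (Or.inl (sub_eq_zero.1 h7))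
    · exact Or.inr (Or.inr (eq_neg_of_add_eq_zero_left h7))
  -- a regular element, to which a large multiple of `H₀` is added
  obtain ⟨h₂, hh₂⟩ : ∃ h₂ : J, ∀ α : J.root, ((α : Weight ℂ J S) h₂).re ≠ 0 := by
    let f : J.root → Module.Dual ℝ J := fun α => Complex.reLm ∘ₗ
      ((α : Weight ℂ J S).toLinear.restrictScalars ℝ)
    obtain ⟨v, hv⟩ := Module.Dual.exists_forall_ne_zero_of_forall_exists f fun α =>
      ⟨coroot α, by
        change ((α : Weight ℂ J S) (coroot α)).re ≠ 0
        rw [root_apply_coroot (LieSubalgebra.isNonZero_coe_root α)]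
        norm_num⟩
    exact ⟨v, hv⟩
  obtain ⟨a, ha⟩ := (Set.finite_range fun α : Weight ℂ J S => |(α h₂).re|).bddAbove
  have ha' : ∀ α : Weight ℂ J S, |(α h₂).re| ≤ a := fun α => ha ⟨α, rfl⟩
  refine ⟨h₂ + (a + 1 : ℂ) • ⟨H₀, hH₀⟩, fun α hα => ?_⟩
  have hval : (α (h₂ + (a + 1 : ℂ) • ⟨H₀, hH₀⟩)).re =
      (α h₂).re + (a + 1) * (α ⟨H₀, hH₀⟩).re := by
    have h2 : α (h₂ + (a + 1 : ℂ) • ⟨H₀, hH₀⟩) = α h₂ + (a + 1) * α ⟨H₀, hH₀⟩ := by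
      have h3 := map_add (α.toLinear : J →ₗ[ℂ] ℂ) h₂ ((a + 1 : ℂ) • ⟨H₀, hH₀⟩)
      rw [map_smul] at h3
      exact h3
    rw [h2]
    simp
  have hne := hh₂ ⟨α, by simpa using hα⟩
  have hle := abs_le.1 (ha' α)
  rw [hval]
  rcases hdeg α with h | h | h
  · rcases lt_or_gt_of_ne hne with h' | h'
    · exact Or.inr ⟨by rw [h]; simpa using h', Or.inl h⟩
    · exact Or.inl ⟨by rw [h]; simpa using h', Or.inl h⟩
  · exact Or.inl ⟨by rw [h, Complex.one_re]; linarith, Or.inr h⟩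
  · exact Or.inr ⟨by rw [h, Complex.neg_re, Complex.one_re]; linarith, Or.inr h⟩

end RootForm

/-! ### The Casimir operator and weights of the induced module -/

section Casimir

open LieAlgebra LieModule IsKilling

variable {S : Type*} [LieRing S] [LieAlgebra ℂ S]
variable {M : Type*} [AddCommGroup M] [Module ℂ M] [LieRingModule S M] [LieModule ℂ S M]
variable {n : ℕ} {b b' : Fin n → S}

/-- The Casimir operator of a pair of dual bases with respect to the Killing form. -/
def casimir (b b' : Fin n → S) : M →ₗ[ℂ] M :=
  ∑ i, toEnd ℂ S M (b i) ∘ₗ toEnd ℂ S M (b' i)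

lemma casimir_apply (m : M) : casimir b b' m = ∑ i, ⁅b i, ⁅b' i, m⁆⁆ := by
  rw [casimir, LinearMap.sum_apply]
  rfl

variable (hb : ∀ x, x = ∑ i, killingForm ℂ S x (b' i) • b i)
  (hb' : ∀ x, x = ∑ i, killingForm ℂ S x (b i) • b' i)
include hb hb'

/-- The Casimir operator commutes with the action, because the Killing form is invariant. -/
lemma casimir_lie (x : S) (m : M) : casimir b b' ⁅x, m⁆ = ⁅x, casimir b b' m⁆ := by
  have hA : ∀ i, ⁅⁅x, b i⁆, ⁅b' i, m⁆⁆ =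
      ∑ j, killingForm ℂ S ⁅x, b i⁆ (b' j) • ⁅b j, ⁅b' i, m⁆⁆ := fun i => by
    conv_lhs => rw [hb ⁅x, b i⁆]
    simp only [sum_lie, smul_lie]
  have hB : ∀ i, ⁅b i, ⁅⁅x, b' i⁆, m⁆⁆ =
      ∑ j, killingForm ℂ S ⁅x, b' i⁆ (b j) • ⁅b i, ⁅b' j, m⁆⁆ := fun i => by
    conv_lhs => rw [hb' ⁅x, b' i⁆]
    simp only [sum_lie, smul_lie, lie_sum, lie_smul]
  have hsum : ∑ i, ⁅⁅x, b i⁆, ⁅b' i, m⁆⁆ + ∑ i, ⁅b i, ⁅⁅x, b' i⁆, m⁆⁆ = 0 := by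
    simp only [hA, hB]
    rw [Finset.sum_comm (f := fun i j => killingForm ℂ S ⁅x, b' i⁆ (b j) • ⁅b i, ⁅b' j, m⁆⁆),
      ← Finset.sum_add_distrib]
    refine Finset.sum_eq_zero fun i _ => ?_
    rw [← Finset.sum_add_distrib]
    refine Finset.sum_eq_zero fun j _ => ?_
    rw [← add_smul]
    have : killingForm ℂ S ⁅x, b i⁆ (b' j) = -killingForm ℂ S ⁅x, b' j⁆ (b i) := by
      rw [← lie_skew, map_neg, LinearMap.neg_apply, killingForm_invariant, killingForm_symm]
    rw [this, neg_add_cancel, zero_smul]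
  rw [casimir_apply, casimir_apply, lie_sum]
  have hi : ∀ i, ⁅x, ⁅b i, ⁅b' i, m⁆⁆⁆ =
      ⁅b i, ⁅b' i, ⁅x, m⁆⁆⁆ + (⁅⁅x, b i⁆, ⁅b' i, m⁆⁆ + ⁅b i, ⁅⁅x, b' i⁆, m⁆⁆) := fun i => by
    rw [leibniz_lie x (b i), leibniz_lie x (b' i), lie_add]
    abel
  rw [Finset.sum_congr rfl fun i _ => hi i, Finset.sum_add_distrib, Finset.sum_add_distrib, hsum,
    add_zero]

variable [Module.Finite ℂ S] [IsKilling ℂ S] {J : LieSubalgebra ℂ S} [J.IsCartanSubalgebra]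
  {w : Fin n → Weight ℂ J S} (hw : ∀ i, b i ∈ rootSpace J (w i))
  (hw' : ∀ i, b' i ∈ rootSpace J (-w i)) (hdual : ∀ i, killingForm ℂ S (b i) (b' i) = 1)

omit hb hb' in
/-- The sum of the positive roots, as an element of the Cartan subalgebra; `h₁` defines the
positive system. -/
def twoRho (w : Fin n → Weight ℂ J S) (h₁ : J) : J :=
  ∑ i with 0 < (w i h₁).re, (cartanEquivDual J).symm (w i).toLinear

omit hb' in
include hw hw' hdual in
/-- The Casimir operator acts on a highest weight vector of weight `μ` by `⟨μ, μ + 2ρ⟩`. -/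
lemma casimir_apply_highest {h₁ : J} (hreg : ∀ α : Weight ℂ J S, α.IsNonZero → (α h₁).re ≠ 0)
    {μ : Module.Dual ℂ J} {v : M} (hv : ∀ h : J, ⁅(h : S), v⁆ = μ h • v)
    (hpos : ∀ α : Weight ℂ J S, 0 < (α h₁).re → ∀ x ∈ rootSpace J α, ⁅x, v⁆ = 0) :
    casimir b b' v = (μ ((cartanEquivDual J).symm μ) + μ (twoRho w h₁)) • v := by
  classical
  have hzero : ∀ i, (w i).IsZero → b i ∈ J ∧ b' i ∈ J := fun i hi => by
    have h1 := hw i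
    have h2 := hw' i
    rw [hi.eq] at h1 h2
    rw [neg_zero] at h2
    rw [rootSpace_zero_eq] at h1 h2
    exact ⟨h1, h2⟩
  have hJ : ∀ i, ¬ (w i).IsZero → killingForm ℂ S ((cartanEquivDual J).symm μ : J) (b i) = 0 := by
    intro i hi
    refine killingForm_apply_eq_zero_of_mem_rootSpace_of_add_ne_zero ℂ S J (α := 0) (β := w i)
      ?_ (hw i) (by rwa [zero_add])
    rw [rootSpace_zero_eq]
    exact ((cartanEquivDual J).symm μ).2
  have hquad : μ ((cartanEquivDual J).symm μ) = ∑ i, if (w i).IsZero then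
      killingForm ℂ S ((cartanEquivDual J).symm μ : J) (b' i) *
        killingForm ℂ S ((cartanEquivDual J).symm μ : J) (b i) else 0 := by
    rw [← killingForm_cartanEquivDual_symm μ]
    refine (congrArg (killingForm ℂ S ((cartanEquivDual J).symm μ : J))
      (hb ((cartanEquivDual J).symm μ : J))).trans ?_
    rw [map_sum]
    refine Finset.sum_congr rfl fun i _ => ?_
    rw [map_smul, smul_eq_mul]
    by_cases hi : (w i).IsZero
    · rw [if_pos hi]
    · rw [if_neg hi, hJ i hi, mul_zero]
  have hterm : ∀ i, ⁅b i, ⁅b' i, v⁆⁆ = (if (w i).IsZero then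
      killingForm ℂ S ((cartanEquivDual J).symm μ : J) (b' i) *
        killingForm ℂ S ((cartanEquivDual J).symm μ : J) (b i) else 0) • v +
      (if 0 < (w i h₁).re then μ ((cartanEquivDual J).symm (w i).toLinear) else 0) • v := by
    intro i
    by_cases hi : (w i).IsZero
    · have hre : ¬ 0 < (w i h₁).re := by rw [hi.eq]; simp
      obtain ⟨h1, h2⟩ := hzero i hi
      have e1 := hv ⟨b i, h1⟩
      have e2 := hv ⟨b' i, h2⟩
      have k1 := killingForm_cartanEquivDual_symm μ ⟨b i, h1⟩
      have k2 := killingForm_cartanEquivDual_symm μ ⟨b' i, h2⟩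
      simp only at e1 e2 k1 k2
      rw [if_pos hi, if_neg hre, e2, lie_smul, e1, smul_smul, k1, k2, zero_smul, add_zero]
    · rw [if_neg hi, zero_smul, zero_add]
      rcases lt_or_gt_of_ne (hreg (w i) hi) with hre | hre
      · rw [if_neg hre.not_gt, zero_smul, hpos (-w i) (by simpa using hre) _
          (by rw [Weight.coe_neg]; exact hw' i), lie_zero]
      · rw [if_pos hre, leibniz_lie, hpos (w i) hre _ (hw i), lie_zero, add_zero,
          lie_eq_killingForm_smul_of_mem_rootSpace_of_mem_rootSpace_neg (hw i) (hw' i), hdual,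
          one_smul, hv]
  rw [casimir_apply, Finset.sum_congr rfl fun i _ => hterm i, Finset.sum_add_distrib,
    ← Finset.sum_smul, ← Finset.sum_smul, ← hquad, twoRho, map_sum, Finset.sum_filter, ← add_smul]

end Casimir

section Vanishing

open LieAlgebra LieModule IsKilling

variable {S : Type*} [LieRing S] [LieAlgebra ℂ S] [Module.Finite ℂ S] [IsKilling ℂ S]
variable {J : LieSubalgebra ℂ S} [J.IsCartanSubalgebra] {H₀ : S} (hH₀ : H₀ ∈ J)
variable {M : Type*} [AddCommGroup M] [Module ℂ M] [LieRingModule S M] [LieModule ℂ S M]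
variable {m₀ : M} {lam : Module.Dual ℂ J}

/-- The sum of a multiset of weights, as a linear form. -/
def weightSum (s : Multiset (Weight ℂ J S)) : Module.Dual ℂ J := (s.map (Weight.toLinear ℂ J S)).sum

include hH₀ in
/-- The weights of the words of length `k` are obtained from the weight of the generator by
subtracting `k` roots of degree `1`. -/
lemma words_le_iSup_weightSpace (hm₀ : ∀ h : J, ⁅(h : S), m₀⁆ = lam h • m₀) (k : ℕ) :
    words (gr H₀ (-1)) (Submodule.span ℂ {m₀}) k ≤
      ⨆ s : {s : Multiset (Weight ℂ J S) // s.card = k ∧ ∀ γ ∈ s, γ ⟨H₀, hH₀⟩ = 1},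
        (weightSpace M ((lam - weightSum s.1 : Module.Dual ℂ J) : J → ℂ)).toSubmodule := by
  induction k with
  | zero =>
    rw [words, Submodule.span_singleton_le_iff_mem]
    refine Submodule.mem_iSup_of_mem ⟨0, rfl, by simp⟩ ?_
    change m₀ ∈ weightSpace M _
    rw [mem_weightSpace]
    intro h
    simpa [weightSum] using hm₀ h
  | succ k ih =>
    rw [words_succ_le]
    intro y hy m hm
    obtain ⟨n, b, b', w, hb, hb', hw, hw', -⟩ := exists_root_dual_bases (S := S) J
    replace hm := ih hm
    induction hm using Submodule.iSup_induction' with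
    | zero => simp
    | add x₁ x₂ _ _ h₁ h₂ => rw [lie_add]; exact add_mem h₁ h₂
    | mem s m hm =>
      rw [hb y, sum_lie]
      refine sum_mem fun i _ => ?_
      rw [smul_lie]
      by_cases hi : killingForm ℂ S y (b' i) = 0
      · rw [hi, zero_smul]; exact zero_mem _
      refine Submodule.smul_mem _ _ ?_
      have hwi : w i ⟨H₀, hH₀⟩ = -1 := by
        have h1 : ⁅H₀, b' i⁆ = _ := lie_eq_smul_of_mem_rootSpace (hw' i) ⟨H₀, hH₀⟩
        have h2 := killingForm_invariant y H₀ (b' i)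
        rw [h1, ← lie_skew, mem_gr.1 hy, map_neg, LinearMap.neg_apply, map_smul,
          LinearMap.smul_apply, map_smul, smul_eq_mul, smul_eq_mul] at h2
        have h3 := mul_right_cancel₀ hi ((neg_mul _ _).trans h2)
        simp only [Pi.neg_apply] at h3
        push_cast at h3
        linear_combination h3
      refine Submodule.mem_iSup_of_mem ⟨-w i ::ₘ s.1, by simp [s.2.1], ?_⟩ ?_
      · intro γ hγ
        rcases Multiset.mem_cons.1 hγ with rfl | hγ
        · simp [hwi]
        · exact s.2.2 γ hγ
      · change _ ∈ weightSpace M _ at hm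
        change _ ∈ weightSpace M _
        rw [mem_weightSpace] at hm ⊢
        intro h
        have h1 : ⁅(h : S), b i⁆ = w i h • b i := lie_eq_smul_of_mem_rootSpace (hw i) h
        have h2 : ⁅(h : S), m⁆ = _ := hm h
        change ⁅(h : S), ⁅b i, m⁆⁆ = _
        rw [leibniz_lie, h1, h2, smul_lie, lie_smul, ← add_smul]
        congr 1
        simp only [weightSum, Multiset.map_cons, Multiset.sum_cons, LinearMap.sub_apply,
          LinearMap.add_apply, Weight.toLinear_neg, LinearMap.neg_apply]
        change w i h + (_ - _) = _ - (-w i h + _)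
        ring

/-- The weight of a simultaneous eigenvector in the space of words of length `k`. -/
lemma exists_weight_eq (hm₀ : ∀ h : J, ⁅(h : S), m₀⁆ = lam h • m₀) {k : ℕ} {v : M}
    (hv : v ∈ words (gr H₀ (-1)) (Submodule.span ℂ {m₀}) k) (hv0 : v ≠ 0) {μ : Module.Dual ℂ J}
    (hμ : ∀ h : J, ⁅(h : S), v⁆ = μ h • v) :
    ∃ s : Multiset (Weight ℂ J S), s.card = k ∧ (∀ γ ∈ s, γ ⟨H₀, hH₀⟩ = 1) ∧
      μ = lam - weightSum s := by
  by_contra! hcon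
  refine hv0 ?_
  have hind := iSupIndep_genWeightSpace ℂ J M
  have h1 : v ∈ genWeightSpace M (μ : J → ℂ) :=
    weightSpace_le_genWeightSpace M _ ((mem_weightSpace ..).2 hμ)
  have h2 : v ∈ (⨆ χ : J → ℂ, ⨆ _ : χ ≠ μ, genWeightSpace M χ).toSubmodule := by
    have hle : (⨆ s : {s : Multiset (Weight ℂ J S) // s.card = k ∧ ∀ γ ∈ s, γ ⟨H₀, hH₀⟩ = 1},
        (weightSpace M ((lam - weightSum s.1 : Module.Dual ℂ J) : J → ℂ)).toSubmodule) ≤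
        (⨆ χ : J → ℂ, ⨆ _ : χ ≠ μ, genWeightSpace M χ).toSubmodule := by
      refine iSup_le fun s => ?_
      have hne : ((lam - weightSum s.1 : Module.Dual ℂ J) : J → ℂ) ≠ μ := fun h =>
        hcon s.1 s.2.1 s.2.2 (DFunLike.coe_injective h).symm
      exact (weightSpace_le_genWeightSpace M _).trans (le_iSup₂_of_le _ hne le_rfl)
    exact hle (words_le_iSup_weightSpace hH₀ hm₀ k hv)
  have := (hind (μ : J → ℂ)).le_bot ⟨h1, h2⟩
  simpa using this

end Vanishing

/-! ### Vectors killed by the elements of degree one -/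

section Graded

variable {g : Type*} [LieRing g] [LieAlgebra ℂ g]
variable {M : Type*} [AddCommGroup M] [Module ℂ M] [LieRingModule g M] [LieModule ℂ g M]
variable {H : g} {S : Submodule ℂ M}

lemma lie_mem_words_of_gr_zero (hS : ∀ x ∈ gr H 0, ∀ m ∈ S, ⁅x, m⁆ ∈ S) (k : ℕ) :
    ∀ x ∈ gr H 0, ∀ m ∈ words (gr H (-1)) S k, ⁅x, m⁆ ∈ words (gr H (-1)) S k := by
  intro x hx
  induction k with
  | zero => exact hS x hx
  | succ k ih =>
    have hle : words (gr H (-1)) S (k + 1) ≤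
        (words (gr H (-1)) S (k + 1)).comap (LieModule.toEnd ℂ g M x) := by
      refine words_succ_le.2 fun y hy m hm => ?_
      rw [Submodule.mem_comap, LieModule.toEnd_apply_apply, leibniz_lie]
      exact Submodule.add_mem _ (lie_mem_words (by simpa using lie_mem_gr hx hy) hm)
        (lie_mem_words hy (ih m hm))
    exact hle

end Graded

section SingularVectors

open LieAlgebra LieModule IsKilling

variable {S : Type*} [LieRing S] [LieAlgebra ℂ S] [Module.Finite ℂ S] [IsKilling ℂ S]
variable {J : LieSubalgebra ℂ S} [J.IsCartanSubalgebra] {H₀ : S} (hH₀ : H₀ ∈ J)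

section HighestWeight

variable {M : Type*} [AddCommGroup M] [Module ℂ M] [LieRingModule S M] [LieModule ℂ S M]

/-- A finite-dimensional subspace that is stable under the elements of degree `0` and is killed by
the elements of degree `1` contains a vector that is killed by all positive root vectors. -/
lemma exists_highest_vector {h₁ : J} (hreg : ∀ α : Weight ℂ J S, α.IsNonZero →
      (0 < (α h₁).re ∧ (α ⟨H₀, hH₀⟩ = 0 ∨ α ⟨H₀, hH₀⟩ = 1)) ∨
      ((α h₁).re < 0 ∧ (α ⟨H₀, hH₀⟩ = 0 ∨ α ⟨H₀, hH₀⟩ = -1)))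
    {N : Submodule ℂ M} [Module.Finite ℂ N] (hN : N ≠ ⊥)
    (h0 : ∀ x ∈ gr H₀ 0, ∀ m ∈ N, ⁅x, m⁆ ∈ N) (h1 : ∀ x ∈ gr H₀ 1, ∀ m ∈ N, ⁅x, m⁆ = 0) :
    ∃ v ∈ N, v ≠ 0 ∧ ∃ μ : Module.Dual ℂ J, (∀ h : J, ⁅(h : S), v⁆ = μ h • v) ∧
      ∀ α : Weight ℂ J S, 0 < (α h₁).re → ∀ x ∈ rootSpace J α, ⁅x, v⁆ = 0 := by
  have hcomm : ∀ h h' : J, ⁅(h : S), (h' : S)⁆ = 0 := fun h h' => by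
    have : ⁅h, h'⁆ = 0 := trivial_lie_zero J J h h'
    exact congrArg Subtype.val this
  have hJ0 : ∀ h : J, (h : S) ∈ gr H₀ 0 := fun h => by
    rw [mem_gr, hcomm ⟨H₀, hH₀⟩ h]
    simp
  let A : Module.End ℂ N := (toEnd ℂ S M h₁).restrict (h0 h₁ (hJ0 h₁))
  have hA : ∀ x, ((A x : N) : M) = ⁅(h₁ : S), (x : M)⁆ := fun x => rfl
  have : Nontrivial N := Submodule.nontrivial_iff_ne_bot.2 hN
  let s : Finset ℂ := (Module.End.finite_hasEigenvalue A).toFinset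
  have hs : s.Nonempty := by
    obtain ⟨ν, hν⟩ := Module.End.exists_eigenvalue A
    exact ⟨ν, by simpa [s] using hν⟩
  obtain ⟨ν, hνs, hmax⟩ := s.exists_max_image Complex.re hs
  have hν : A.HasEigenvalue ν := by simpa [s] using hνs
  -- the eigenspace for an eigenvalue with the largest real part
  let E : LieSubmodule ℂ J M :=
    { carrier := {m | m ∈ N ∧ ⁅(h₁ : S), m⁆ = ν • m}
      zero_mem' := ⟨N.zero_mem, by simp⟩
      add_mem' := fun {a b} ha hb => ⟨N.add_mem ha.1 hb.1, by
        rw [lie_add, ha.2, hb.2, smul_add]⟩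
      smul_mem' := fun c a ha => ⟨N.smul_mem c ha.1, by rw [lie_smul, ha.2, smul_comm]⟩
      lie_mem := fun {h m} hm => ⟨h0 h (hJ0 h) m hm.1, by
        change ⁅(h₁ : S), ⁅(h : S), m⁆⁆ = ν • ⁅(h : S), m⁆
        rw [leibniz_lie, hcomm, zero_lie, zero_add, hm.2, lie_smul]⟩ }
  have hEN : E.toSubmodule ≤ N := fun m hm => hm.1
  have : Module.Finite ℂ E :=
    Module.Finite.of_injective (Submodule.inclusion hEN) (Submodule.inclusion_injective hEN)
  have : Nontrivial E := by
    obtain ⟨x, hx⟩ := hν.exists_hasEigenvector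
    refine ⟨⟨⟨x, x.2, ?_⟩, 0, fun h => hx.2 (Subtype.ext (congrArg (fun z : E => (z : M)) h))⟩⟩
    rw [← hA, hx.apply_eq_smul]
    rfl
  obtain ⟨μ, hμ⟩ := exists_nontrivial_weightSpace_of_isNilpotent ℂ J E
  obtain ⟨⟨v, hv⟩, hv0⟩ := exists_ne (0 : weightSpace E μ)
  rw [mem_weightSpace] at hv
  refine ⟨v, v.2.1, fun h => hv0 (Subtype.ext (Subtype.ext h)), μ,
    fun h => congrArg Subtype.val (hv h), fun α hα x hx => ?_⟩
  have hα0 : α.IsNonZero := fun h => by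
    rw [h.eq] at hα
    simp at hα
  have hxH : ⁅H₀, x⁆ = _ := lie_eq_smul_of_mem_rootSpace hx ⟨H₀, hH₀⟩
  rcases hreg α hα0 with h | h
  · rcases h.2 with hd | hd
    · have hx0 : x ∈ gr H₀ 0 := by rw [mem_gr, hxH, hd]; simp
      have hxN := h0 x hx0 v v.2.1
      by_contra hne
      have hev : A.HasEigenvalue (ν + α h₁) := by
        refine Module.End.hasEigenvalue_of_hasEigenvector (x := ⟨⁅x, (v : M)⁆, hxN⟩)
          ⟨Module.End.mem_eigenspace_iff.2 (Subtype.ext ?_), fun h => hne (congrArg Subtype.val h)⟩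
        have h1 : ⁅(h₁ : S), x⁆ = α h₁ • x := lie_eq_smul_of_mem_rootSpace hx h₁
        rw [hA]
        change ⁅(h₁ : S), ⁅x, (v : M)⁆⁆ = (ν + α h₁) • ⁅x, (v : M)⁆
        rw [leibniz_lie, h1, v.2.2, smul_lie, lie_smul, ← add_smul, add_comm]
      have := hmax (ν + α h₁) (by simpa [s] using hev)
      rw [Complex.add_re] at this
      linarith
    · exact h1 x (by rw [mem_gr, hxH, hd]; simp) v v.2.1
  · exact absurd hα h.1.not_gt

end HighestWeight

omit [IsKilling ℂ S] in
lemma weightSum_apply (s : Multiset (Weight ℂ J S)) (h : J) :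
    weightSum s h = (s.map fun γ => γ h).sum := by
  induction s using Multiset.induction_on with
  | empty => simp [weightSum]
  | cons a s ih =>
    rw [Multiset.map_cons, Multiset.sum_cons, ← ih]
    simp only [weightSum, Multiset.map_cons, Multiset.sum_cons, LinearMap.add_apply]
    rfl

include hH₀ in
/-- If the weight of the generator is sufficiently negative, a vector of positive depth in a
highest weight module is not killed by all elements of degree `1`. Otherwise there is a highest weight
vector of weight `λ - s` with a sum `s` of `k` roots of degree `1`, and the Casimir operator yields
`⟨λ, λ + 2ρ⟩ = ⟨λ - s, λ - s + 2ρ⟩`. That is impossible: `⟨s, s⟩ ≥ 0`, since the sum of two roots of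
degree `1` is not a root, and `⟨s, 2λ + 2ρ⟩ < 0`. -/
theorem exists_bound_singular (hgr : IsShortGrading H₀) :
    ∃ C : ℝ, ∀ (M : Type v) [AddCommGroup M] [Module ℂ M] [LieRingModule S M] [LieModule ℂ S M]
      (m₀ : M) (lam : Module.Dual ℂ J), (∀ h : J, ⁅(h : S), m₀⁆ = lam h • m₀) →
      (∀ x ∈ gr H₀ 0, ∃ a : ℂ, ⁅x, m₀⁆ = a • m₀) → (∀ x ∈ gr H₀ 1, ⁅x, m₀⁆ = 0) →
      (∀ T : Submodule ℂ M, m₀ ∈ T → (∀ (x : S), ∀ m ∈ T, ⁅x, m⁆ ∈ T) → T = ⊤) →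
      (∀ γ : Weight ℂ J S, γ ⟨H₀, hH₀⟩ = 1 →
        (lam ((cartanEquivDual J).symm γ.toLinear)).re < -C) →
      ∀ k, k ≠ 0 → ∀ v ∈ words (gr H₀ (-1)) (Submodule.span ℂ {m₀}) k,
        (∀ x ∈ gr H₀ 1, ⁅x, v⁆ = 0) → v = 0 := by
  classical
  obtain ⟨n, b, b', w, hb, hb', hw, hw', hdual⟩ := exists_root_dual_bases (S := S) J
  obtain ⟨h₁, hreg⟩ := exists_regular_element hH₀ hgr
  have hreg' : ∀ α : Weight ℂ J S, α.IsNonZero → (α h₁).re ≠ 0 := fun α hα => by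
    rcases hreg α hα with h | h
    exacts [h.1.ne', h.1.ne]
  set hρ : J := twoRho w h₁ with hρ_def
  obtain ⟨a, ha⟩ := (Set.finite_range fun α : Weight ℂ J S => |(α hρ).re|).bddAbove
  have ha' : ∀ α : Weight ℂ J S, |(α hρ).re| ≤ a := fun α => ha ⟨α, rfl⟩
  refine ⟨a, fun M _ _ _ _ m₀ lam hm₀ hm₀0 hm₀1 hgen hlam k hk v hv hv1 => ?_⟩
  by_contra hv0
  have hm₀ne : m₀ ≠ 0 := by
    rintro rfl
    refine hv0 ((Submodule.mem_bot ℂ).1 ?_)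
    rw [hgen ⊥ (Submodule.zero_mem _) (fun x m hm => by
      rw [(Submodule.mem_bot ℂ).1 hm, lie_zero]; exact Submodule.zero_mem _)]
    trivial
  -- the action of the Casimir operator
  have hm₀pos : ∀ α : Weight ℂ J S, 0 < (α h₁).re → ∀ x ∈ rootSpace J α, ⁅x, m₀⁆ = 0 := by
    intro α hα x hx
    have hα0 : α.IsNonZero := fun h => by
      rw [h.eq] at hα
      simp at hα
    have hxH : ⁅H₀, x⁆ = _ := lie_eq_smul_of_mem_rootSpace hx ⟨H₀, hH₀⟩
    rcases hreg α hα0 with h | h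
    · rcases h.2 with hd | hd
      · obtain ⟨c, hc⟩ := hm₀0 x (by rw [mem_gr, hxH, hd]; simp)
        have h2 : ⁅(h₁ : S), x⁆ = α h₁ • x := lie_eq_smul_of_mem_rootSpace hx h₁
        have h3 : ⁅⁅(h₁ : S), x⁆, m₀⁆ = 0 := by
          rw [lie_lie, hc, hm₀, lie_smul, lie_smul, hm₀, hc, smul_comm, sub_self]
        rw [h2, smul_lie] at h3
        refine (smul_eq_zero.1 h3).resolve_left fun h4 => ?_
        rw [h4] at hα
        simp at hα
      · exact hm₀1 x (by rw [mem_gr, hxH, hd]; simp)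
    · exact absurd hα h.1.not_gt
  have hcas₀ := casimir_apply_highest hb hw hw' hdual hreg' hm₀ hm₀pos
  have hcas : ∀ m : M, casimir b b' m =
      (lam ((cartanEquivDual J).symm lam) + lam (twoRho w h₁)) • m := by
    intro m
    have htop := hgen (LinearMap.eqLocus (casimir b b')
      ((lam ((cartanEquivDual J).symm lam) + lam (twoRho w h₁)) • LinearMap.id))
      (LinearMap.mem_eqLocus.2 hcas₀) fun x m hm => by
        rw [LinearMap.mem_eqLocus] at hm ⊢
        rw [casimir_lie hb hb', hm]
        exact lie_smul _ _ _
    exact LinearMap.mem_eqLocus.1 (htop ▸ Submodule.mem_top : m ∈ LinearMap.eqLocus (casimir b b')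
      ((lam ((cartanEquivDual J).symm lam) + lam (twoRho w h₁)) • LinearMap.id))
  -- a highest weight vector among the singular vectors
  let N : Submodule ℂ M :=
    { carrier := {m | m ∈ words (gr H₀ (-1)) (Submodule.span ℂ {m₀}) k ∧
        ∀ x ∈ gr H₀ 1, ⁅x, m⁆ = 0}
      zero_mem' := ⟨Submodule.zero_mem _, fun x _ => lie_zero x⟩
      add_mem' := fun {p q} hp hq => ⟨Submodule.add_mem _ hp.1 hq.1, fun x hx => by
        rw [lie_add, hp.2 x hx, hq.2 x hx, add_zero]⟩
      smul_mem' := fun c p hp => ⟨Submodule.smul_mem _ c hp.1, fun x hx => by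
        rw [lie_smul, hp.2 x hx, smul_zero]⟩ }
  have hNfin : Module.Finite ℂ N := by
    have := Module.Finite.iff_fg.2
      (words_finite (g := S) (n := gr H₀ (-1)) (Submodule.fg_span_singleton m₀) k)
    have hle : N ≤ words (gr H₀ (-1)) (Submodule.span ℂ {m₀}) k := fun m hm => hm.1
    exact Module.Finite.of_injective (Submodule.inclusion hle) (Submodule.inclusion_injective hle)
  have hwords := lie_mem_words_of_gr_zero (H := H₀) (S := Submodule.span ℂ {m₀}) fun x hx m hm => by
    obtain ⟨c, rfl⟩ := Submodule.mem_span_singleton.1 hm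
    obtain ⟨d, hd⟩ := hm₀0 x hx
    rw [lie_smul, hd]
    exact Submodule.smul_mem _ _ (Submodule.smul_mem _ _ (Submodule.mem_span_singleton_self m₀))
  obtain ⟨u, huN, hu0, μ, hμ, hupos⟩ := exists_highest_vector hH₀ hreg (N := N)
    (fun h => hv0 ((Submodule.mem_bot ℂ).1 (h ▸ (⟨hv, hv1⟩ : v ∈ N))))
    (fun x hx m hm => ⟨hwords k x hx m hm.1, fun y hy => by
      rw [leibniz_lie, hm.2 y hy, lie_zero, add_zero,
        hm.2 _ (by simpa using lie_mem_gr hy hx)]⟩)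
    (fun x hx m hm => hm.2 x hx)
  obtain ⟨s, hs, hs1, rfl⟩ := exists_weight_eq hH₀ hm₀ huN.1 hu0 hμ
  have heq := (casimir_apply_highest hb hw hw' hdual hreg' hμ hupos).symm.trans (hcas u)
  have heq := smul_left_injective ℂ hu0 heq
  simp only [← hρ_def, map_sub, LinearMap.sub_apply] at heq
  -- the terms of the difference of the two values
  set d := (cartanEquivDual J).symm
  have hsymm : weightSum s (d lam) = lam (d (weightSum s)) := by
    rw [← killingForm_cartanEquivDual_symm, ← killingForm_cartanEquivDual_symm, killingForm_symm]
  have hds : d (weightSum s) = (s.map fun γ => d γ.toLinear).sum := by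
    rw [weightSum, map_multiset_sum, Multiset.map_map]
    rfl
  have hre : ∀ (t : Multiset (Weight ℂ J S)) (f : Weight ℂ J S → ℂ),
      ((t.map f).sum).re = (t.map fun γ => (f γ).re).sum := fun t f => by
    have := map_multiset_sum Complex.reAddGroupHom (t.map f)
    rw [Multiset.map_map] at this
    exact this
  have hquad : 0 ≤ (weightSum s (d (weightSum s))).re := by
    rw [hds, map_multiset_sum, Multiset.map_map, hre]
    refine Multiset.sum_nonneg fun x hx => ?_
    obtain ⟨γ, hγ, rfl⟩ := Multiset.mem_map.1 hx
    change 0 ≤ (weightSum s (d γ.toLinear)).re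
    rw [weightSum_apply, hre]
    refine Multiset.sum_nonneg fun x hx => ?_
    obtain ⟨δ, hδ, rfl⟩ := Multiset.mem_map.1 hx
    have hγ0 : γ.IsNonZero := fun h => by
      have := hs1 γ hγ
      rw [h.eq] at this
      simp at this
    obtain ⟨q, hq, hqe⟩ := root_apply_nonneg γ δ hγ0 fun e he x hx => by
      have he1 : ⁅H₀, e⁆ = _ := lie_eq_smul_of_mem_rootSpace he ⟨H₀, hH₀⟩
      have hx1 : ⁅H₀, x⁆ = _ := lie_eq_smul_of_mem_rootSpace hx ⟨H₀, hH₀⟩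
      rw [hs1 γ hγ] at he1
      rw [hs1 δ hδ] at hx1
      exact hgr.lie_eq_zero (k := 1) (l := 1) (by norm_num) (by rw [mem_gr, he1]; simp)
        (by rw [mem_gr, hx1]; simp)
    change 0 ≤ (δ (d γ.toLinear)).re
    rw [hqe]
    exact hq
  have hlin : (2 * lam (d (weightSum s)) + weightSum s hρ).re < 0 := by
    rw [hds, map_multiset_sum, Multiset.map_map, weightSum_apply, ← Multiset.sum_map_mul_left,
      ← Multiset.sum_map_add, hre]
    have hs0 : s ≠ 0 := by
      rintro rfl
      exact hk (by simpa using hs.symm)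
    have := Multiset.sum_lt_sum_of_nonempty (s := s) hs0
      (f := fun γ => (2 * lam (d γ.toLinear) + γ hρ).re) (g := fun _ => (0 : ℝ)) fun γ hγ => by
        have h1 := hlam γ (hs1 γ hγ)
        have h2 := abs_le.1 (ha' γ)
        simp only [Complex.add_re, Complex.mul_re, Complex.re_ofNat, Complex.im_ofNat]
        linarith
    simpa using this
  have hfin : weightSum s (d (weightSum s)) = 2 * lam (d (weightSum s)) + weightSum s hρ := by
    rw [hsymm] at heq
    linear_combination heq
  rw [hfin] at hquad
  exact absurd hquad hlin.not_ge

end SingularVectors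

/-! ### Criteria for reductive and solvable subalgebras -/

section Reductive

open LieAlgebra LieModule

variable {L : Type*} [LieRing L] [LieAlgebra ℂ L] [Module.Finite ℂ L]

/-- Some nonzero submodule is killed by the brackets `⁅x, y⁆` with `y` in the radical: the radical
acts on it by a character, and the trace of a bracket vanishes. -/
lemma exists_submodule_lie_radical {V : Type v} [AddCommGroup V] [Module ℂ V]
    [Module.Finite ℂ V] [Nontrivial V] [LieRingModule L V] [LieModule ℂ L V] :
    ∃ W : LieSubmodule ℂ L V, W ≠ ⊥ ∧ ∀ x : L, ∀ y ∈ radical ℂ L, ∀ v ∈ W, ⁅⁅x, y⁆, v⁆ = 0 := by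
  obtain ⟨χ, hχ⟩ := exists_nontrivial_weightSpace_of_isSolvable ℂ (radical ℂ L) V
  let W : LieSubmodule ℂ L V := weightSpaceOfIsLieTower ℂ V (χ : radical ℂ L → ℂ)
  have hmem : ∀ v, v ∈ W ↔ ∀ y : radical ℂ L, ⁅(y : L), v⁆ = χ y • v := fun v => by
    change v ∈ weightSpace V _ ↔ _
    rw [mem_weightSpace]
    rfl
  have hW : Nontrivial W := hχ
  refine ⟨W, (LieSubmodule.nontrivial_iff_ne_bot ℂ L V).1 hW, fun x y hy v hv => ?_⟩
  · have hxy : ⁅x, y⁆ ∈ radical ℂ L := lie_mem_right ℂ L _ x y hy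
    have hend : toEnd ℂ L W ⁅x, y⁆ = χ ⟨⁅x, y⁆, hxy⟩ • LinearMap.id := LinearMap.ext fun w =>
      Subtype.ext ((hmem w).1 w.2 ⟨_, hxy⟩)
    have htr : LinearMap.trace ℂ W (toEnd ℂ L W ⁅x, y⁆) = 0 := by
      have : toEnd ℂ L W ⁅x, y⁆ = toEnd ℂ L W x * toEnd ℂ L W y - toEnd ℂ L W y * toEnd ℂ L W x :=
        LinearMap.ext fun w => lie_lie x y w
      rw [this, map_sub, LinearMap.trace_mul_comm, sub_self]
    rw [hend, map_smul, LinearMap.trace_id, smul_eq_mul] at htr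
    have h0 : χ ⟨⁅x, y⁆, hxy⟩ = 0 := by
      refine (mul_eq_zero.1 htr).resolve_right ?_
      exact_mod_cast (Module.finrank_pos (R := ℂ) (M := W)).ne'
    rw [(hmem v).1 hv ⟨_, hxy⟩, h0, zero_smul]

/-- Products with a factor `⁅x, y⁆`, where `y` lies in the radical, act nilpotently on
finite-dimensional modules. -/
lemma isNilpotent_toEnd_lie_radical_mul (x : L) {y : L} (hy : y ∈ radical ℂ L) (z : L) (d : ℕ) :
    ∀ (V : Type v) [AddCommGroup V] [Module ℂ V] [Module.Finite ℂ V] [LieRingModule L V]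
      [LieModule ℂ L V], Module.finrank ℂ V = d →
      IsNilpotent (toEnd ℂ L V ⁅x, y⁆ ∘ₗ toEnd ℂ L V z : Module.End ℂ V) := by
  induction d using Nat.strong_induction_on with
  | _ d ih =>
    intro V _ _ _ _ _ hd
    rcases subsingleton_or_nontrivial V with hV | hV
    · exact ⟨1, Subsingleton.elim _ _⟩
    obtain ⟨W, hW, hWz⟩ := exists_submodule_lie_radical (L := L) (V := V)
    have hlt : Module.finrank ℂ (V ⧸ W) < d := by
      have h1 : Module.finrank ℂ (V ⧸ W) + Module.finrank ℂ W = Module.finrank ℂ V :=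
        Submodule.finrank_quotient_add_finrank W.toSubmodule
      have h2 : 0 < Module.finrank ℂ W := by
        have : Nontrivial W := (LieSubmodule.nontrivial_iff_ne_bot ℂ L V).2 hW
        exact Module.finrank_pos
      omega
    obtain ⟨n, hn⟩ := ih _ hlt (V ⧸ W) rfl
    refine ⟨n + 1, LinearMap.ext fun v => ?_⟩
    have hq : ∀ (m : ℕ) (v : V), LieSubmodule.Quotient.mk (N := W)
        (((toEnd ℂ L V ⁅x, y⁆ ∘ₗ toEnd ℂ L V z : Module.End ℂ V) ^ m) v) =
        ((toEnd ℂ L (V ⧸ W) ⁅x, y⁆ ∘ₗ toEnd ℂ L (V ⧸ W) z : Module.End ℂ (V ⧸ W)) ^ m)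
          (LieSubmodule.Quotient.mk v) := by
      intro m
      induction m with
      | zero => intro v; rfl
      | succ m ihm =>
        intro v
        rw [pow_succ, pow_succ, Module.End.mul_apply, Module.End.mul_apply, ihm]
        rfl
    have hmem : ((toEnd ℂ L V ⁅x, y⁆ ∘ₗ toEnd ℂ L V z : Module.End ℂ V) ^ n) v ∈ W := by
      rw [← LieSubmodule.Quotient.mk_eq_zero', hq, hn]
      rfl
    rw [pow_succ', Module.End.mul_apply]
    exact hWz x y hy _ (W.lie_mem hmem)

/-- A subalgebra `r` on which the Killing form of the ambient algebra is nondegenerate is reductive: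
brackets with the radical of `r` are orthogonal to `r`. -/
lemma hasCentralRadical_of_nondegenerate {K : Type*} [LieRing K] [LieAlgebra ℂ K]
    [Module.Finite ℂ K] (r : LieSubalgebra ℂ K)
    (h : ∀ x ∈ r, (∀ y ∈ r, killingForm ℂ K x y = 0) → x = 0) : HasCentralRadical ℂ r := by
  refine ⟨le_antisymm (fun y hy => ?_) (center_le_radical ℂ r)⟩
  rw [mem_center_iff']
  intro x
  refine Subtype.ext (h _ (⁅x, y⁆ : r).2 fun z hz => ?_)
  have := isNilpotent_toEnd_lie_radical_mul x hy ⟨z, hz⟩ _ K rfl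
  exact (LinearMap.isNilpotent_trace_of_isNilpotent this).eq_zero

end Reductive

section Solvable

open LieAlgebra

variable {L : Type*} [LieRing L] [LieAlgebra ℂ L]

/-- A subalgebra `b = b₁ + A` is solvable, if the subalgebra `b₁` is solvable and `A` is an abelian
ideal. -/
lemma isSolvable_of_sup {b₁ b : LieSubalgebra ℂ L} (hb₁ : IsSolvable b₁) {A : Submodule ℂ L}
    (hA : ∀ x ∈ A, ∀ y ∈ A, ⁅x, y⁆ = 0) (hbA : ∀ x ∈ b₁, ∀ y ∈ A, ⁅x, y⁆ ∈ A)
    (hb : b.toSubmodule ≤ b₁.toSubmodule ⊔ A) : IsSolvable b := by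
  obtain ⟨k, hk⟩ := IsSolvable.solvable ℂ b₁
  have key : ∀ n, ∀ x ∈ derivedSeries ℂ b n,
      (x : L) ∈ (derivedSeries ℂ b₁ n).toSubmodule.map b₁.toSubmodule.subtype ⊔ A := by
    intro n
    induction n with
    | zero =>
      intro x _
      obtain ⟨u, hu, a, ha, hx⟩ := Submodule.mem_sup.1 (hb x.2)
      exact Submodule.mem_sup.2 ⟨u, ⟨⟨u, hu⟩, trivial, rfl⟩, a, ha, hx⟩
    | succ n ih =>
      intro x hx
      have hle : (derivedSeries ℂ b (n + 1)).toSubmodule ≤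
          ((derivedSeries ℂ b₁ (n + 1)).toSubmodule.map b₁.toSubmodule.subtype ⊔ A).comap
            b.toSubmodule.subtype := by
        rw [derivedSeries_def, derivedSeriesOfIdeal_succ,
          LieSubmodule.lieIdeal_oper_eq_linear_span, Submodule.span_le]
        rintro _ ⟨⟨p, hp⟩, ⟨q, hq⟩, rfl⟩
        obtain ⟨_, ⟨(u : b₁), hu, rfl⟩, a, ha, hp'⟩ := Submodule.mem_sup.1 (ih p hp)
        obtain ⟨_, ⟨(v : b₁), hv, rfl⟩, c, hc, hq'⟩ := Submodule.mem_sup.1 (ih q hq)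
        change ⁅(p : L), (q : L)⁆ ∈ (derivedSeries ℂ b₁ (n + 1)).toSubmodule.map
          b₁.toSubmodule.subtype ⊔ A
        rw [← hp', ← hq']
        refine Submodule.mem_sup.2 ⟨⁅(u : L), (v : L)⁆, ⟨⁅u, v⁆, ?_, rfl⟩,
          ⁅(u : L), c⁆ - ⁅(v : L), a⁆, A.sub_mem (hbA _ u.2 _ hc) (hbA _ v.2 _ ha), ?_⟩
        · change ⁅u, v⁆ ∈ derivedSeries ℂ b₁ (n + 1)
          rw [derivedSeries_def, derivedSeriesOfIdeal_succ]
          exact LieSubmodule.lie_mem_lie hu hv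
        · change _ = ⁅(u : L) + a, (v : L) + c⁆
          rw [add_lie, lie_add, lie_add, hA a ha c hc, ← lie_skew a]
          abel
      exact hle hx
  refine IsSolvable.mk (R := ℂ) (k := k + 1) ?_
  rw [eq_bot_iff, derivedSeries_def, derivedSeriesOfIdeal_succ, LieSubmodule.lie_le_iff]
  intro p hp q hq
  have hmem : ∀ x ∈ derivedSeries ℂ b k, (x : L) ∈ A := fun x hx => by
    have := key k x hx
    rw [hk] at this
    simpa using this
  have : ⁅p, q⁆ = 0 := Subtype.ext (hA _ (hmem p hp) _ (hmem q hq))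
  rw [this]
  exact zero_mem _

end Solvable

section CartanContaining

open LieAlgebra

variable {K : Type*} [LieRing K] [LieAlgebra ℂ K]

/-- The centralizer of an element. -/
def centralizerOf (h : K) : LieSubalgebra ℂ K where
  carrier := {x | ⁅h, x⁆ = 0}
  zero_mem' := by simp
  add_mem' {x y} hx hy := by
    change ⁅h, x + y⁆ = 0
    rw [lie_add, hx, hy, add_zero]
  smul_mem' c x hx := by
    change ⁅h, c • x⁆ = 0
    rw [lie_smul, hx, smul_zero]
  lie_mem' {x y} hx hy := by
    change ⁅h, ⁅x, y⁆⁆ = 0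
    rw [leibniz_lie, hx, hy, zero_lie, lie_zero, add_zero]

lemma mem_centralizerOf {h x : K} : x ∈ centralizerOf h ↔ ⁅h, x⁆ = 0 := Iff.rfl

/-- An element that defines a short grading lies in a Cartan subalgebra, namely in any Cartan
subalgebra of its centralizer. -/
lemma IsShortGrading.exists_mem_cartan [Module.Finite ℂ K] {H : K} (hH : IsShortGrading H) :
    ∃ J : LieSubalgebra ℂ K, J.IsCartanSubalgebra ∧ H ∈ J := by
  obtain ⟨x₀, hC⟩ := exists_isCartanSubalgebra_engel ℂ (centralizerOf H)
  set C := LieSubalgebra.engel ℂ x₀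
  have hHz : H ∈ centralizerOf H := by rw [mem_centralizerOf, lie_self]
  have hHC : (⟨H, hHz⟩ : centralizerOf H) ∈ C := by
    rw [← LieSubalgebra.IsCartanSubalgebra.self_normalizing (H := C),
      LieSubalgebra.mem_normalizer_iff]
    intro y _
    have : ⁅(⟨H, hHz⟩ : centralizerOf H), y⁆ = 0 := Subtype.ext y.2
    rw [this]
    exact C.zero_mem
  let J := C.map (centralizerOf H).incl
  have hJ : ∀ x, x ∈ J ↔ ∃ hx : x ∈ centralizerOf H, (⟨x, hx⟩ : centralizerOf H) ∈ C := fun x => by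
    constructor
    · rintro ⟨y, hy, rfl⟩
      exact ⟨y.2, hy⟩
    · rintro ⟨hx, h⟩
      exact ⟨_, h, rfl⟩
  refine ⟨J, ⟨?_, le_antisymm (fun x hx => ?_) (LieSubalgebra.le_normalizer J)⟩, (hJ H).2 ⟨hHz, hHC⟩⟩
  · have e := C.equivMapOfInjective (centralizerOf H).incl Subtype.val_injective
    exact (LieEquiv.nilpotent_iff_equiv_nilpotent e).1 inferInstance
  · rw [LieSubalgebra.mem_normalizer_iff] at hx
    have h1 : ⁅H, ⁅H, x⁆⁆ = 0 := by
      obtain ⟨h, -⟩ := (hJ _).1 (hx H ((hJ H).2 ⟨hHz, hHC⟩))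
      rw [mem_centralizerOf, ← lie_skew x H, lie_neg, neg_eq_zero] at h
      exact h
    have h2 : x ∈ centralizerOf H := by
      rw [mem_centralizerOf, ← hH x, h1, lie_zero]
    rw [hJ]
    refine ⟨h2, ?_⟩
    rw [← LieSubalgebra.IsCartanSubalgebra.self_normalizing (H := C),
      LieSubalgebra.mem_normalizer_iff]
    intro y hy
    obtain ⟨_, h⟩ := (hJ _).1 (hx y ((hJ y).2 ⟨y.2, hy⟩))
    exact h

end CartanContaining

/-! ### Longest roots of degree one -/

section RootCombinatorics

open LieAlgebra LieModule IsKilling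

variable {K : Type*} [LieRing K] [LieAlgebra ℂ K] [Module.Finite ℂ K] [IsKilling ℂ K]
variable {J : LieSubalgebra ℂ K} [J.IsCartanSubalgebra]

/-- Only root vectors for weights `α` with `α h = c` occur in the expansion of an eigenvector of `h`
with eigenvalue `c`. A component is detected by pairing with the opposite root space. -/
lemma weight_apply_eq {h : J} {c : ℂ} {z : K} (hz : ⁅(h : K), z⁆ = c • z) {α : Weight ℂ J K}
    {y : K} (hy : y ∈ rootSpace J (-α)) (hne : killingForm ℂ K z y ≠ 0) : α h = c := by
  have h1 : ⁅(h : K), y⁆ = _ := lie_eq_smul_of_mem_rootSpace hy h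
  have h2 := killingForm_invariant z (h : K) y
  rw [h1, ← lie_skew, hz, map_neg, LinearMap.neg_apply, map_smul,
    LinearMap.smul_apply, map_smul, smul_eq_mul, smul_eq_mul] at h2
  have h3 := mul_right_cancel₀ hne ((neg_mul _ _).trans h2)
  simp only [Pi.neg_apply] at h3
  exact (neg_injective h3).symm

/-- An element lies in a subspace if all root vectors do that can occur in its expansion. -/
lemma mem_of_rootSpace_le {T : Submodule ℂ K} {z : K} {P : Weight ℂ J K → Prop}
    (hP : ∀ α : Weight ℂ J K, ∀ y ∈ rootSpace J (-α), killingForm ℂ K z y ≠ 0 → P α)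
    (hT : ∀ α : Weight ℂ J K, P α → ∀ x ∈ rootSpace J α, x ∈ T) : z ∈ T := by
  obtain ⟨n, b, b', w, hb, -, hw, hw', -⟩ := exists_root_dual_bases (S := K) J
  rw [hb z]
  refine sum_mem fun i _ => ?_
  by_cases hi : killingForm ℂ K z (b' i) = 0
  · rw [hi, zero_smul]; exact zero_mem _
  · exact T.smul_mem _ (hT _ (hP _ _ (hw' i) hi) _ (hw i))

lemma killingForm_eq_sum_root (x y : J) :
    killingForm ℂ K (x : K) y = ∑ β ∈ J.root, β x * β y := by
  have := LinearMap.congr_fun (LinearMap.congr_fun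
    (restrict_killingForm_eq_sum (K := ℂ) (L := K) (H := J)) x) y
  rw [LinearMap.BilinForm.restrict_apply] at this
  refine Eq.trans this ?_
  simp only [LinearMap.sum_apply, LinearMap.smulRight_apply, LinearMap.smul_apply, smul_eq_mul]
  rfl

/-- A root of maximal length among those that take the value `1` at `H`. No other such root `δ` has
`⟨δ, γ^∨⟩ = 2`: then `|δ - γ|² = |δ|² - |γ|² ≤ 0`, and the form is positive definite on the real span
of the roots. -/
lemma exists_longest_root {H : J} (hex : ∃ α : Weight ℂ J K, α H = 1) :
    ∃ γ : Weight ℂ J K, γ H = 1 ∧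
      ∀ δ : Weight ℂ J K, δ H = 1 → δ (coroot γ) = 2 → δ = γ := by
  classical
  have _ := Fintype.ofFinite (Weight ℂ J K)
  let s : Finset (Weight ℂ J K) := Finset.univ.filter fun α => α H = 1
  let d := (cartanEquivDual J).symm
  obtain ⟨γ, hγs, hmax⟩ := s.exists_max_image (fun α => (α (d α.toLinear)).re) (by
    obtain ⟨α, hα⟩ := hex
    exact ⟨α, by simpa [s] using hα⟩)
  have hγ : γ H = 1 := by simpa [s] using hγs
  refine ⟨γ, hγ, fun δ hδ h2 => ?_⟩
  have hnz : ∀ α : Weight ℂ J K, α H = 1 → α.IsNonZero := fun α hα h => by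
    rw [h.eq] at hα
    simp at hα
  obtain ⟨q, hq, hγq⟩ := exists_pos_root_apply γ (hnz γ hγ)
  obtain ⟨q', hq', hδq⟩ := exists_pos_root_apply δ (hnz δ hδ)
  have hle : q' ≤ q := by
    have := hmax δ (by simpa [s] using hδ)
    change (δ (d δ.toLinear)).re ≤ (γ (d γ.toLinear)).re at this
    rwa [show δ (d δ.toLinear) = _ from hδq, show γ (d γ.toLinear) = _ from hγq] at this
  have hd : ∀ (α : Weight ℂ J K) (q : ℝ), α (d α.toLinear) = q → q ≠ 0 →
      ∀ β : Weight ℂ J K, β (d α.toLinear) = q / 2 * β (coroot α) := by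
    intro α q hα hq β
    have h2 : coroot α = (2 * (q : ℂ)⁻¹) • d α.toLinear := by
      rw [coroot, show α ((cartanEquivDual J).symm α.toLinear) = _ from hα,
        ← Nat.cast_smul_eq_nsmul ℂ, smul_smul]
      norm_num
      rfl
    have h3 : β (coroot α) = (2 * (q : ℂ)⁻¹) * β (d α.toLinear) := by
      rw [h2]
      exact map_smul (β.toLinear : J →ₗ[ℂ] ℂ) _ _
    have hq0 : (q : ℂ) ≠ 0 := by exact_mod_cast hq
    rw [h3]
    field_simp
  set u : J := d δ.toLinear - d γ.toLinear with hu
  have happ : ∀ β : Weight ℂ J K, β u = β (d δ.toLinear) - β (d γ.toLinear) := fun β =>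
    map_sub (β.toLinear : J →ₗ[ℂ] ℂ) _ _
  have hreal : ∀ β : Weight ℂ J K, ∃ a : ℝ, β u = a := fun β => by
    refine ⟨q' / 2 * ((chainLength δ β - 2 * chainTopCoeff δ β : ℤ) : ℝ) -
      q / 2 * ((chainLength γ β - 2 * chainTopCoeff γ β : ℤ) : ℝ), ?_⟩
    rw [happ, hd δ q' hδq hq'.ne', hd γ q hγq hq.ne', apply_coroot_eq_cast', apply_coroot_eq_cast']
    push_cast
    ring
  choose a ha using hreal
  have hδγ : δ (d γ.toLinear) = q := by
    rw [hd γ q hγq hq.ne', h2]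
    ring
  have hγδ : γ (d δ.toLinear) = q := by
    rw [← hδγ]
    have h1 := killingForm_cartanEquivDual_symm (S := K) δ.toLinear (d γ.toLinear)
    have h2 := killingForm_cartanEquivDual_symm (S := K) γ.toLinear (d δ.toLinear)
    rw [killingForm_symm] at h2
    exact h2.symm.trans h1
  have hsub : ∀ y : J, killingForm ℂ K (u : K) y = δ y - γ y := fun y => by
    have h1 := killingForm_cartanEquivDual_symm (S := K) δ.toLinear y
    have h2 := killingForm_cartanEquivDual_symm (S := K) γ.toLinear y
    change killingForm ℂ K ((d δ.toLinear : K) - (d γ.toLinear : K)) y = _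
    rw [map_sub, LinearMap.sub_apply]
    exact congrArg₂ _ h1 h2
  -- `u` represents `δ - γ`; its square length is nonpositive and a sum of squares
  have huu : killingForm ℂ K (u : K) u = ((q' - q : ℝ) : ℂ) := by
    rw [hsub, happ, happ, hδγ, hγδ, show δ (d δ.toLinear) = _ from hδq,
      show γ (d γ.toLinear) = _ from hγq]
    push_cast
    ring
  have hsum : ∑ β ∈ J.root, a β ^ 2 = q' - q := by
    have h1 := killingForm_eq_sum_root u u
    rw [huu] at h1
    have h3 : ((q' - q : ℝ) : ℂ) = ((∑ β ∈ J.root, a β ^ 2 : ℝ) : ℂ) := by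
      rw [h1, Complex.ofReal_sum]
      refine Finset.sum_congr rfl fun β _ => ?_
      rw [ha, Complex.ofReal_pow, sq]
    exact (Complex.ofReal_injective h3).symm
  have hzero : ∀ β ∈ J.root, a β = 0 := fun β hβ => by
    have h1 : ∑ β ∈ J.root, a β ^ 2 = 0 :=
      le_antisymm (by linarith) (Finset.sum_nonneg fun β _ => sq_nonneg _)
    exact pow_eq_zero_iff (two_ne_zero) |>.1
      ((Finset.sum_eq_zero_iff_of_nonneg fun β _ => sq_nonneg _).1 h1 β hβ)
  refine Weight.ext fun y => ?_
  rw [← sub_eq_zero, ← hsub, killingForm_eq_sum_root]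
  refine Finset.sum_eq_zero fun β hβ => ?_
  rw [ha, hzero β hβ, Complex.ofReal_zero, zero_mul]

end RootCombinatorics

section GradedTriple

variable {K : Type*} [LieRing K] [LieAlgebra ℂ K] [Module.Finite ℂ K] {H h e f : K}
  (hH : IsShortGrading H) (t : IsSl2Triple h e f) (he : e ∈ gr H 1) (hf : f ∈ gr H (-1))
include hH t he hf

/-- The eigenvalues of `h` on the part of degree `1` are `0`, `1` and `2`. -/
lemma eigenvalue_of_mem_gr_one {x : K} (hx : x ∈ gr H 1) (hx0 : x ≠ 0) {c : ℂ}
    (hc : ⁅h, x⁆ = c • x) : c = 0 ∨ c = 1 ∨ c = 2 := by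
  have P : t.HasPrimitiveVectorWith x c := ⟨hx0, hc, hH.lie_eq_zero (by norm_num) he hx⟩
  obtain ⟨n, hn⟩ := P.exists_nat
  have h3 : ⁅f, ⁅f, ⁅f, x⁆⁆⁆ = 0 := by
    have := lie_mem_gr hf (lie_mem_gr hf hx)
    exact hH.lie_eq_zero (by norm_num) hf this
  have hn2 : n ≤ 2 := by
    by_contra! hlt
    exact P.pow_toEnd_f_ne_zero_of_eq_nat hn (i := 3) (by omega) h3
  rw [hn]
  interval_cases n <;> simp

omit [Module.Finite ℂ K] in
/-- The number `-2` is not an eigenvalue of `h` on the part of degree `0`. -/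
lemma eq_zero_of_mem_gr_zero {x : K} (hx : x ∈ gr H 0) (hc : ⁅h, x⁆ = (-2 : ℂ) • x) : x = 0 := by
  by_contra hx0
  by_cases hfx : ⁅f, x⁆ = 0
  · have P : t.symm.HasPrimitiveVectorWith x (2 : ℂ) :=
      ⟨hx0, by rw [neg_lie, hc, neg_smul, neg_neg], hfx⟩
    refine P.pow_toEnd_f_ne_zero_of_eq_nat (n := 2) (by norm_num) (i := 2) le_rfl ?_
    exact hH.lie_eq_zero (by norm_num) he (lie_mem_gr he hx)
  · have hff : ⁅f, ⁅f, x⁆⁆ = 0 := hH.lie_eq_zero (by norm_num) hf (lie_mem_gr hf hx)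
    have P : t.symm.HasPrimitiveVectorWith ⁅f, x⁆ (4 : ℂ) := by
      refine ⟨hfx, ?_, hff⟩
      rw [neg_lie, leibniz_lie, t.lie_lie_smul_f ℂ, hc, lie_smul, neg_lie, smul_lie]
      module
    refine P.pow_toEnd_f_ne_zero_of_eq_nat (n := 4) (by norm_num) (i := 3) (by norm_num) ?_
    exact hH.lie_eq_zero (by norm_num) he (lie_mem_gr he (lie_mem_gr he (lie_mem_gr hf hx)))

end GradedTriple

/-! ### Sphericity of the part of degree one -/

section Sphericity

open LieAlgebra LieModule IsKilling

/-- The part of degree `1` is a spherical module of the part of degree `0`: some solvable subalgebra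
`b` of the part of degree `0`, which may be assumed to contain the center, has a dense orbit. The
density of the orbit of `x₀` is expressed by its tangent space: `⁅b, x₀⁆` is the whole part of
degree `1`. -/
def IsSpherical (L : Type*) [LieRing L] [LieAlgebra ℂ L] (H : L) : Prop :=
  ∃ b : LieSubalgebra ℂ L, IsSolvable b ∧ b.toSubmodule ≤ gr H 0 ∧
    (center ℂ L).toSubmodule ≤ b.toSubmodule ∧
    ∃ x₀ ∈ gr H 1, ∀ y ∈ gr H 1, ∃ x ∈ b, ⁅x, x₀⁆ = y

/-- The induction step: the centralizer `r` of the coroot `h` of a longest root `γ` of degree `1` is a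
smaller reductive Lie algebra, so it has a solvable subalgebra `b'` and an element `x₀` with dense
orbit. On the part of degree `1` the eigenvalues of `h` are `2` (on the root space of `γ`, spanned by
`e`), `1` and `0` (on the part of degree `1` of `r`). The sum of `b'` and of the `(-1)`-eigenspace of
`h` in degree `0` is solvable, and the orbit of `e + x₀` is dense. -/
lemma isSpherical_of_isKilling {K : Type u} [LieRing K] [LieAlgebra ℂ K] [Module.Finite ℂ K]
    [IsKilling ℂ K] {H : K} (hH : IsShortGrading H)
    (ih : ∀ (r : LieSubalgebra ℂ K), Module.finrank ℂ r < Module.finrank ℂ K →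
      HasCentralRadical ℂ r → ∀ H' : r, IsShortGrading H' → IsSpherical r H') :
    IsSpherical K H := by
  obtain ⟨J, hJ, hHJ⟩ := hH.exists_mem_cartan
  have hcenter : (center ℂ K).toSubmodule ≤ (⊥ : LieSubalgebra ℂ K).toSubmodule := by
    rw [center_eq_bot]
    exact le_rfl
  by_cases hex : ∃ α : Weight ℂ J K, α ⟨H, hHJ⟩ = 1
  swap
  · -- there is no root of degree `1`
    have hbot : ∀ y ∈ gr H 1, y = 0 := fun y hy => by
      have : y ∈ (⊥ : Submodule ℂ K) := mem_of_rootSpace_le (J := J)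
        (P := fun α => α ⟨H, hHJ⟩ = 1)
        (fun α z hz hne => weight_apply_eq (h := ⟨H, hHJ⟩) (c := 1) (by
          have := mem_gr.1 hy
          simpa using this) hz hne)
        (fun α hα => absurd ⟨α, hα⟩ hex)
      exact (Submodule.mem_bot ℂ).1 this
    have _ : IsLieAbelian (⊥ : LieSubalgebra ℂ K) := ⟨fun x y => Subtype.ext (by
      change ⁅(x : K), (y : K)⁆ = 0
      rw [(LieSubalgebra.mem_bot _).1 x.2, zero_lie])⟩
    refine ⟨⊥, inferInstance, bot_le, hcenter, 0, Submodule.zero_mem _, fun y hy => ⟨0, ?_, ?_⟩⟩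
    · exact Submodule.zero_mem _
    · rw [hbot y hy, lie_zero]
  obtain ⟨γ, hγ, hγmax⟩ := exists_longest_root hex
  have hγ0 : γ.IsNonZero := fun h => by
    rw [h.eq] at hγ
    simp at hγ
  obtain ⟨h, e, f, t, heγ, hfγ⟩ := exists_isSl2Triple_of_weight_isNonZero hγ0
  have hh := t.h_eq_coroot hγ0 heγ hfγ
  have hdeg : ∀ (α : Weight ℂ J K) (k : ℤ), α ⟨H, hHJ⟩ = k → ∀ x ∈ rootSpace J α, x ∈ gr H k :=
    fun α k hα x hx => by
      rw [mem_gr, ← hα]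
      exact lie_eq_smul_of_mem_rootSpace hx ⟨H, hHJ⟩
  have he : e ∈ gr H 1 := hdeg γ 1 (by simpa using hγ) e heγ
  have hf : f ∈ gr H (-1) := hdeg (-γ) (-1) (by simp [hγ]) f (by rwa [Weight.coe_neg])
  have hJabel : ∀ x y : J, ⁅(x : K), (y : K)⁆ = 0 := fun x y =>
    congrArg Subtype.val (trivial_lie_zero J J x y)
  have hhH : ⁅h, H⁆ = 0 := by rw [hh]; exact hJabel (coroot γ) ⟨H, hHJ⟩
  have hHh : ⁅H, h⁆ = 0 := by rw [← lie_skew, hhH, neg_zero]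
  have hlie_h : ∀ (α : Weight ℂ J K), ∀ x ∈ rootSpace J α, ⁅h, x⁆ = α (coroot γ) • x :=
    fun α x hx => by rw [hh]; exact lie_eq_smul_of_mem_rootSpace hx (coroot γ)
  have hhe : ⁅h, e⁆ = (2 : ℂ) • e := t.lie_h_e_smul ℂ
  -- the eigenspace of `h` in degree `1` for the eigenvalue `2` is spanned by `e`
  have htwo : ∀ x ∈ rootSpace J γ, ∃ c : ℂ, x = c • e := fun x hx => by
    have h1 := finrank_rootSpace_eq_one γ hγ0
    have hne : (⟨e, heγ⟩ : rootSpace J γ) ≠ 0 := fun h => t.e_ne_zero (congrArg Subtype.val h)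
    obtain ⟨c, hc⟩ := (finrank_eq_one_iff_of_nonzero' _ hne).1 h1 ⟨x, hx⟩
    exact ⟨c, (congrArg Subtype.val hc).symm⟩
  have htwo' : ∀ x ∈ gr H 1, ⁅h, x⁆ = (2 : ℂ) • x → ∃ c : ℂ, x = c • e := fun x hx hx2 => by
    refine htwo x ?_
    refine mem_of_rootSpace_le (J := J) (T := (rootSpace J γ).toSubmodule)
      (P := fun α => α = γ) (fun α y hy hne => ?_) (fun α hα x hx => by subst hα; exact hx)
    refine hγmax α (weight_apply_eq (h := ⟨H, hHJ⟩) (by simpa using mem_gr.1 hx) hy hne)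
      (weight_apply_eq (h := coroot γ) ?_ hy hne)
    rw [← hh]
    exact hx2
  -- the centralizer of `h`
  let r : LieSubalgebra ℂ K := centralizerOf h
  have hr : HasCentralRadical ℂ r := by
    refine hasCentralRadical_of_nondegenerate r fun x hx hxr => ?_
    refine eq_zero_of_killingForm_rootSpace (J := J) fun α y hy => ?_
    by_cases hα : α (coroot γ) = 0
    · refine hxr y ?_
      change ⁅h, y⁆ = 0
      rw [hlie_h α y hy, hα, zero_smul]
    · have h1 := killingForm_invariant x h y
      rw [← lie_skew, show ⁅h, x⁆ = 0 from hx, hlie_h α y hy] at h1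
      simp only [neg_zero, map_zero, LinearMap.zero_apply, map_smul, smul_eq_mul] at h1
      exact (mul_eq_zero.1 h1.symm).resolve_left hα
  have hlt : Module.finrank ℂ r < Module.finrank ℂ K := by
    refine Submodule.finrank_lt (s := r.toSubmodule) fun htop => ?_
    have : e ∈ r.toSubmodule := htop ▸ Submodule.mem_top
    have h0 : ⁅h, e⁆ = 0 := this
    rw [hhe] at h0
    exact t.e_ne_zero ((smul_eq_zero.1 h0).resolve_left two_ne_zero)
  have hHr : H ∈ r := hhH
  obtain ⟨b', hb'sol, hb'0, hb'z, x₀, hx₀, hx₀b'⟩ := ih r hlt hr ⟨H, hHr⟩ fun x => Subtype.ext (hH x)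
  have hgr : ∀ (k : ℤ) (x : r), x ∈ gr (⟨H, hHr⟩ : r) k ↔ (x : K) ∈ gr H k := fun k x => by
    rw [mem_gr, mem_gr, Subtype.ext_iff]
    rfl
  have hhr : h ∈ r := lie_self h
  have hhb' : (⟨h, hhr⟩ : r) ∈ b' := hb'z (by
    refine mem_center_iff'.2 fun y => Subtype.ext ?_
    change ⁅(y : K), h⁆ = 0
    rw [← lie_skew, show ⁅h, (y : K)⁆ = 0 from y.2, neg_zero])
  let b₁ : LieSubalgebra ℂ K := b'.map r.incl
  have hb₁ : ∀ x ∈ b₁, ∃ x' ∈ b', (x' : K) = x := fun x hx => hx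
  have hb₁h : ∀ x ∈ b₁, ⁅h, x⁆ = 0 := fun x hx => by
    obtain ⟨x', -, rfl⟩ := hb₁ x hx
    exact x'.2
  have hb₁0 : ∀ x ∈ b₁, x ∈ gr H 0 := fun x hx => by
    obtain ⟨x', hx', rfl⟩ := hb₁ x hx
    exact (hgr 0 x').1 (hb'0 hx')
  let A : Submodule ℂ K :=
    { carrier := {x | x ∈ gr H 0 ∧ ⁅h, x⁆ = -x}
      zero_mem' := ⟨Submodule.zero_mem _, by simp⟩
      add_mem' := fun {x y} hx hy => ⟨add_mem hx.1 hy.1, by rw [lie_add, hx.2, hy.2]; abel⟩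
      smul_mem' := fun c x hx => ⟨Submodule.smul_mem _ c hx.1, by rw [lie_smul, hx.2, smul_neg]⟩ }
  have hA : ∀ x ∈ A, ∀ y ∈ A, ⁅x, y⁆ = 0 := fun x hx y hy => by
    refine eq_zero_of_mem_gr_zero hH t he hf (by simpa using lie_mem_gr hx.1 hy.1) ?_
    rw [leibniz_lie, hx.2, hy.2, neg_lie, lie_neg]
    module
  have hb₁A : ∀ x ∈ b₁, ∀ y ∈ A, ⁅x, y⁆ ∈ A := fun x hx y hy => by
    refine ⟨by simpa using lie_mem_gr (hb₁0 x hx) hy.1, ?_⟩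
    rw [leibniz_lie, hb₁h x hx, hy.2, zero_lie, zero_add, lie_neg]
  let b : LieSubalgebra ℂ K :=
    { toSubmodule := b₁.toSubmodule ⊔ A
      lie_mem' := fun {x y} hx hy => by
        obtain ⟨u, hu, a, ha, rfl⟩ := Submodule.mem_sup.1 hx
        obtain ⟨v, hv, c, hc, rfl⟩ := Submodule.mem_sup.1 hy
        refine Submodule.mem_sup.2 ⟨⁅u, v⁆, b₁.lie_mem hu hv, ⁅u, c⁆ - ⁅v, a⁆,
          A.sub_mem (hb₁A _ hu _ hc) (hb₁A _ hv _ ha), ?_⟩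
        rw [add_lie, lie_add, lie_add, hA a ha c hc, ← lie_skew a]
        abel }
  have hb₁b : ∀ x ∈ b₁, x ∈ b := fun x hx => Submodule.mem_sup_left hx
  have hAb : ∀ x ∈ A, x ∈ b := fun x hx => Submodule.mem_sup_right hx
  have hhb : h ∈ b := hb₁b h ⟨_, hhb', rfl⟩
  have hx₀h : ⁅h, (x₀ : K)⁆ = 0 := x₀.2
  have hx₀1 : (x₀ : K) ∈ gr H 1 := (hgr 1 x₀).1 hx₀
  have hb₁sol : IsSolvable b₁ :=
    (solvable_iff_equiv_solvable (R := ℂ)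
      (b'.equivMapOfInjective r.incl Subtype.val_injective)).1 hb'sol
  refine ⟨b, isSolvable_of_sup hb₁sol hA hb₁A le_rfl, ?_, hcenter.trans bot_le, e + x₀,
    add_mem he hx₀1, fun y hy => ?_⟩
  · exact sup_le (fun x hx => hb₁0 x hx) (fun x hx => hx.1)
  -- surjectivity can be checked on root vectors
  let T : Submodule ℂ K :=
    { carrier := {y | ∃ x ∈ b, ⁅x, e + (x₀ : K)⁆ = y}
      zero_mem' := ⟨0, b.zero_mem, zero_lie _⟩
      add_mem' := by
        rintro _ _ ⟨x, hx, rfl⟩ ⟨y, hy, rfl⟩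
        exact ⟨x + y, b.add_mem hx hy, add_lie _ _ _⟩
      smul_mem' := by
        rintro c _ ⟨x, hx, rfl⟩
        exact ⟨c • x, b.smul_mem c hx, smul_lie _ _ _⟩ }
  change y ∈ T
  have heT : e ∈ T := by
    refine ⟨(2⁻¹ : ℂ) • h, b.smul_mem _ hhb, ?_⟩
    rw [smul_lie, lie_add, hhe, hx₀h, add_zero, smul_smul]
    norm_num
  refine mem_of_rootSpace_le (J := J) (P := fun α => α ⟨H, hHJ⟩ = 1)
    (fun α z hz hne => weight_apply_eq (h := ⟨H, hHJ⟩) (by simpa using mem_gr.1 hy) hz hne)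
    (fun α hα z hz => ?_)
  have hz1 : z ∈ gr H 1 := hdeg α 1 (by simpa using hα) z hz
  by_cases hz0 : z = 0
  · rw [hz0]; exact T.zero_mem
  have hhz := hlie_h α z hz
  rcases eigenvalue_of_mem_gr_one hH t he hf hz1 hz0 hhz with h0 | h0 | h0
  · rw [h0, zero_smul] at hhz
    obtain ⟨x, hx, hxz⟩ := hx₀b' ⟨z, hhz⟩ ((hgr 1 ⟨z, hhz⟩).2 hz1)
    have hxz' : ⁅(x : K), (x₀ : K)⁆ = z := congrArg Subtype.val hxz
    have hxb₁ : (x : K) ∈ b₁ := ⟨x, hx, rfl⟩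
    obtain ⟨c, hc⟩ := htwo' ⁅(x : K), e⁆ (by simpa using lie_mem_gr (hb₁0 _ hxb₁) he) (by
      rw [leibniz_lie, hb₁h _ hxb₁, hhe, zero_lie, zero_add, lie_smul])
    have hT : c • e + z ∈ T := ⟨x, hb₁b _ hxb₁, by rw [lie_add, hc, hxz']⟩
    have := T.sub_mem hT (T.smul_mem c heT)
    rwa [add_sub_cancel_left] at this
  · rw [h0, one_smul] at hhz
    have hfz0 : ⁅f, z⁆ ∈ gr H 0 := by simpa using lie_mem_gr hf hz1
    have hfzA : ⁅f, z⁆ ∈ A := by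
      refine ⟨hfz0, ?_⟩
      rw [leibniz_lie, t.lie_lie_smul_f ℂ, hhz, neg_lie, smul_lie]
      module
    refine ⟨-⁅f, z⁆, b.neg_mem (hAb _ hfzA), ?_⟩
    have h1 : ⁅⁅f, z⁆, e⁆ = -z := by
      rw [← lie_skew, leibniz_lie e, t.lie_e_f, hhz, hH.lie_eq_zero (by norm_num) he hz1, lie_zero,
        add_zero]
    -- the other term has degree `1` and `h`-eigenvalue `-1`
    have h2 : ⁅⁅f, z⁆, (x₀ : K)⁆ = 0 := by
      by_contra hne
      have := eigenvalue_of_mem_gr_one hH t he hf (by simpa using lie_mem_gr hfz0 hx₀1) hne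
        (c := -1) (by
          rw [leibniz_lie, hfzA.2, hx₀h, lie_zero, add_zero, neg_lie, neg_one_smul])
      norm_num at this
    rw [neg_lie, lie_add, h1, h2, add_zero, neg_neg]
  · have hαγ := hγmax α hα h0
    subst hαγ
    obtain ⟨c, rfl⟩ := htwo z hz
    exact T.smul_mem c heT

/-- The part of degree `1` of a short grading of a reductive Lie algebra is a spherical module. -/
theorem isSpherical (d : ℕ) : ∀ (L : Type u) [LieRing L] [LieAlgebra ℂ L] [Module.Finite ℂ L]
    [HasCentralRadical ℂ L], Module.finrank ℂ L = d → ∀ H : L, IsShortGrading H →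
      IsSpherical L H := by
  induction d using Nat.strong_induction_on with
  | _ d ih =>
    intro L _ _ _ _ hd H hH
    let K := derivedSeries ℂ L 1
    obtain ⟨z, hz, H', hH', hzH⟩ := Submodule.mem_sup.1
      (center_sup_derived (g := L) ▸ Submodule.mem_top : H ∈ (center ℂ L).toSubmodule ⊔
        (derivedSeries ℂ L 1).toSubmodule)
    have hcen : ∀ x ∈ center ℂ L, ∀ y : L, ⁅x, y⁆ = 0 := fun x hx y => by
      rw [← lie_skew, mem_center_iff'.1 hx, neg_zero]
    have hlie : ∀ x : L, ⁅H', x⁆ = ⁅H, x⁆ := fun x => by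
      rw [← hzH, add_lie, hcen z hz, zero_add]
    have hgr : ∀ (k : ℤ) (x : K), x ∈ gr (⟨H', hH'⟩ : K) k ↔ (x : L) ∈ gr H k := fun k x => by
      rw [mem_gr, mem_gr, Subtype.ext_iff, ← hlie]
      rfl
    have hshort : IsShortGrading (⟨H', hH'⟩ : K) := fun x => Subtype.ext (by
      change ⁅H', ⁅H', ⁅H', (x : L)⁆⁆⁆ = ⁅H', (x : L)⁆
      simp only [hlie, hH (x : L)])
    have hKle : Module.finrank ℂ K ≤ d := hd ▸ Submodule.finrank_le K.toSubmodule
    obtain ⟨b', hb'sol, hb'0, -, x₀, hx₀, hx₀b'⟩ := isSpherical_of_isKilling hshort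
      fun r hr hrc H'' hH'' => ih _ (hr.trans_le hKle) r rfl H'' hH''
    let b₁ : LieSubalgebra ℂ L := b'.map K.incl
    have hb₁sol : IsSolvable b₁ := (solvable_iff_equiv_solvable (R := ℂ)
      (b'.equivMapOfInjective K.incl K.incl_injective)).1 hb'sol
    have hb₁0 : b₁.toSubmodule ≤ gr H 0 := by
      rintro _ ⟨x, hx, rfl⟩
      exact (hgr 0 x).1 (hb'0 hx)
    have hcen0 : (center ℂ L).toSubmodule ≤ gr H 0 := fun x hx => by
      rw [mem_gr, mem_center_iff'.1 hx]
      simp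
    let b : LieSubalgebra ℂ L :=
      { toSubmodule := b₁.toSubmodule ⊔ (center ℂ L).toSubmodule
        lie_mem' := fun {x y} hx hy => by
          obtain ⟨u, hu, a, ha, rfl⟩ := Submodule.mem_sup.1 hx
          obtain ⟨v, hv, c, hc, rfl⟩ := Submodule.mem_sup.1 hy
          refine Submodule.mem_sup_left ?_
          rw [lie_add, mem_center_iff'.1 hc, add_lie, hcen a ha, add_zero, add_zero]
          exact b₁.lie_mem hu hv }
    refine ⟨b, isSolvable_of_sup hb₁sol (A := (center ℂ L).toSubmodule)
      (fun x hx y _ => hcen x hx y) (fun x _ y hy => ?_) le_rfl, sup_le hb₁0 hcen0, le_sup_right,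
      x₀, (hgr 1 x₀).1 hx₀, fun y hy => ?_⟩
    · rw [mem_center_iff'.1 hy]
      exact Submodule.zero_mem _
    · have hyK : y ∈ K := by
        have : ⁅H, y⁆ = y := by simpa using mem_gr.1 hy
        rw [← this]
        exact lie_mem_derived H y
      obtain ⟨x, hx, hxy⟩ := hx₀b' ⟨y, hyK⟩ ((hgr 1 ⟨y, hyK⟩).2 hy)
      exact ⟨x, Submodule.mem_sup_left ⟨x, hx, rfl⟩, congrArg Subtype.val hxy⟩

end Sphericity

/-! ### Involutions that preserve a short grading -/

section Involution

open LieAlgebra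

variable {g : Type u} [LieRing g] [LieAlgebra ℂ g]

/-- The automorphism that is `(-1)^k` on the part of degree `k` of a short grading. -/
def parity {H : g} (hH : IsShortGrading H) : g ≃ₗ⁅ℂ⁆ g where
  toFun x := x - (2 : ℂ) • ⁅H, ⁅H, x⁆⁆
  map_add' x y := by
    simp only [lie_add, smul_add]
    abel
  map_smul' c x := by
    simp only [lie_smul, smul_sub, RingHom.id_apply, smul_comm c]
  map_lie' {x y} := by
    let θ : g → g := fun x => x - (2 : ℂ) • ⁅H, ⁅H, x⁆⁆
    have hgr : ∀ (k : ℤ), ∀ x ∈ gr H k, θ x = (1 - 2 * (k : ℂ) ^ 2) • x := fun k x hx => by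
      change x - (2 : ℂ) • ⁅H, ⁅H, x⁆⁆ = _
      rw [mem_gr.1 hx, lie_smul, mem_gr.1 hx]
      module
    have hadd : ∀ x y, θ (x + y) = θ x + θ y := fun x y => by
      simp only [θ, lie_add, smul_add]
      abel
    have hsmul : ∀ (c : ℂ) x, θ (c • x) = c • θ x := fun c x => by
      simp only [θ, lie_smul, smul_sub, smul_comm c]
    have h0 : θ 0 = 0 := by simp [θ]
    have hom : ∀ i ∈ ({-1, 0, 1} : Finset ℤ), ∀ k ∈ ({-1, 0, 1} : Finset ℤ),
        ∀ x ∈ gr H i, ∀ y ∈ gr H k, θ ⁅x, y⁆ = ⁅θ x, θ y⁆ := by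
      intro i hi k hk x hx y hy
      rw [hgr i x hx, hgr k y hy, smul_lie, lie_smul, smul_smul, hgr _ _ (lie_mem_gr hx hy)]
      fin_cases hi <;> fin_cases hk
      all_goals first
        | (congr 1; push_cast; norm_num; done)
        | (have h0 : ⁅x, y⁆ = 0 := hH.lie_eq_zero (by norm_num) hx hy
           rw [h0, smul_zero, smul_zero])
    let T : g → Submodule ℂ g := fun x =>
      { carrier := {y | θ ⁅x, y⁆ = ⁅θ x, θ y⁆}
        zero_mem' := by simp [h0]
        add_mem' := fun {a b} ha hb => by
          change θ _ = _
          rw [lie_add, hadd, hadd, lie_add, ha, hb]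
        smul_mem' := fun c a ha => by
          change θ _ = _
          rw [lie_smul, hsmul, hsmul, lie_smul, ha] }
    let T' : g → Submodule ℂ g := fun y =>
      { carrier := {x | θ ⁅x, y⁆ = ⁅θ x, θ y⁆}
        zero_mem' := by simp [h0]
        add_mem' := fun {a b} ha hb => by
          change θ _ = _
          rw [add_lie, hadd, hadd, add_lie, ha, hb]
        smul_mem' := fun c a ha => by
          change θ _ = _
          rw [smul_lie, hsmul, hsmul, smul_lie, ha] }
    have h1 : ∀ i ∈ ({-1, 0, 1} : Finset ℤ), ∀ x ∈ gr H i, ∀ y, θ ⁅x, y⁆ = ⁅θ x, θ y⁆ :=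
      fun i hi x hx y => hH.induction (T := T x) (fun y hy => hom i hi (-1) (by simp) x hx y hy)
        (fun y hy => hom i hi 0 (by simp) x hx y hy) (fun y hy => hom i hi 1 (by simp) x hx y hy) y
    exact hH.induction (T := T' y) (fun x hx => h1 (-1) (by simp) x hx y)
      (fun x hx => h1 0 (by simp) x hx y) (fun x hx => h1 1 (by simp) x hx y) x
  invFun x := x - (2 : ℂ) • ⁅H, ⁅H, x⁆⁆
  left_inv x := by
    change x - (2 : ℂ) • ⁅H, ⁅H, x⁆⁆ - (2 : ℂ) • ⁅H, ⁅H, x - (2 : ℂ) • ⁅H, ⁅H, x⁆⁆⁆⁆ = x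
    simp only [lie_sub, lie_smul, hH x]
    module
  right_inv x := by
    change x - (2 : ℂ) • ⁅H, ⁅H, x⁆⁆ - (2 : ℂ) • ⁅H, ⁅H, x - (2 : ℂ) • ⁅H, ⁅H, x⁆⁆⁆⁆ = x
    simp only [lie_sub, lie_smul, hH x]
    module

lemma parity_apply {H : g} (hH : IsShortGrading H) (x : g) :
    parity hH x = x - (2 : ℂ) • ⁅H, ⁅H, x⁆⁆ := rfl

variable [Module.Finite ℂ g] [HasCentralRadical ℂ g]

/-- For an involution `τ` that fixes the grading element, the `(-1)`-eigenspace of `τ` in degree `1`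
is a spherical module of the fixed points in degree `0`: together they are the parts of degree `1`
and `0` of the fixed points of the involution `τ ∘ parity` of the derived algebra. -/
theorem exists_solvable_dense {H : g} (hH : IsShortGrading H) (hHS : H ∈ derivedSeries ℂ g 1)
    (τ : g ≃ₗ⁅ℂ⁆ g) (hτ : ∀ x, τ (τ x) = x) (hτH : τ H = H) :
    ∃ b : LieSubalgebra ℂ g, IsSolvable b ∧ (∀ x ∈ b, τ x = x ∧ x ∈ gr H 0) ∧
      ∃ x₀ ∈ gr H 1, τ x₀ = -x₀ ∧ ∀ y ∈ gr H 1, τ y = -y → ∃ x ∈ b, ⁅x, x₀⁆ = y := by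
  let S := derivedSeries ℂ g 1
  let σ : g ≃ₗ⁅ℂ⁆ g := (parity hH).trans τ
  have hσ : ∀ x, σ x = τ x - (2 : ℂ) • ⁅H, ⁅H, τ x⁆⁆ := fun x => by
    change τ (x - (2 : ℂ) • ⁅H, ⁅H, x⁆⁆) = _
    rw [map_sub, map_smul, LieEquiv.map_lie, LieEquiv.map_lie, hτH]
  have hσσ : ∀ x, σ (σ x) = x := fun x => by
    have h1 : ∀ x, τ (σ x) = parity hH x := fun x => hτ _
    change τ (parity hH (σ x)) = x
    rw [parity_apply, map_sub, map_smul, LieEquiv.map_lie, LieEquiv.map_lie, hτH, h1]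
    exact (parity hH).left_inv x
  have hσ0 : ∀ x ∈ gr H 0, σ x = τ x := fun x hx => by
    change τ (parity hH x) = _
    rw [parity_apply, mem_gr.1 hx]
    simp
  have hσ1 : ∀ x ∈ gr H 1, σ x = -τ x := fun x hx => by
    have h2 : ⁅H, x⁆ = x := by simpa using mem_gr.1 hx
    change τ (parity hH x) = _
    rw [parity_apply, h2, h2, map_sub, map_smul]
    module
  have hσS : ∀ x ∈ S, σ x ∈ S := fun x hx => by
    have hle : S.toSubmodule ≤ S.toSubmodule.comap (σ : g →ₗ[ℂ] g) :=
      derived_le_of_lie_mem fun x y => by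
        change σ ⁅x, y⁆ ∈ S
        rw [LieEquiv.map_lie]
        exact lie_mem_derived _ _
    exact hle hx
  let r : LieSubalgebra ℂ S :=
    { carrier := {x | σ x = x}
      zero_mem' := map_zero σ
      add_mem' := fun {x y} hx hy => by
        change σ ((x : g) + y) = (x : g) + y
        rw [map_add, show σ x = x from hx, show σ y = y from hy]
      smul_mem' := fun c x hx => by
        change σ (c • (x : g)) = c • (x : g)
        rw [map_smul, show σ x = x from hx]
      lie_mem' := fun {x y} hx hy => by
        change σ ⁅(x : g), (y : g)⁆ = ⁅(x : g), (y : g)⁆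
        rw [LieEquiv.map_lie, show σ x = x from hx, show σ y = y from hy] }
  have hmem : ∀ x : S, x ∈ r ↔ σ x = x := fun x => Iff.rfl
  have hr : HasCentralRadical ℂ r := by
    refine hasCentralRadical_of_nondegenerate r fun x hx hxr => ?_
    refine (IsKilling.killingForm_nondegenerate ℂ S).1 x fun y => ?_
    let y' : S := ⟨σ y, hσS y y.2⟩
    have h1 := hxr (y + y') (by
      change σ ((y : g) + σ y) = (y : g) + σ y
      rw [map_add, hσσ, add_comm])
    have h2 : killingForm ℂ S x y' = killingForm ℂ S x y := by
      rw [killingForm_derived, killingForm_derived]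
      have h3 := killingForm_of_equiv_apply σ (x : g) (y : g)
      rw [show σ x = x from hx] at h3
      exact h3
    rw [map_add, h2, ← two_mul] at h1
    exact (mul_eq_zero.1 h1).resolve_left two_ne_zero
  have hHr : (⟨H, hHS⟩ : S) ∈ r := by
    change σ H = H
    rw [hσ0 H (by rw [mem_gr]; simp), hτH]
  have hgr : ∀ (k : ℤ) (x : r), x ∈ gr (⟨⟨H, hHS⟩, hHr⟩ : r) k ↔ ((x : S) : g) ∈ gr H k :=
    fun k x => by
      rw [mem_gr, mem_gr, Subtype.ext_iff, Subtype.ext_iff]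
      rfl
  have hshort : IsShortGrading (⟨⟨H, hHS⟩, hHr⟩ : r) := fun x =>
    Subtype.ext (Subtype.ext (hH ((x : S) : g)))
  obtain ⟨b', hb', hb'0, -, x₀, hx₀, hb'x₀⟩ := isSpherical _ r rfl _ hshort
  let b₁ : LieSubalgebra ℂ S := b'.map r.incl
  have hb₁ : IsSolvable b₁ := (solvable_iff_equiv_solvable (R := ℂ)
    (b'.equivMapOfInjective r.incl Subtype.val_injective)).1 hb'
  let b : LieSubalgebra ℂ g := b₁.map S.incl
  have hb : IsSolvable b := (solvable_iff_equiv_solvable (R := ℂ)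
    (b₁.equivMapOfInjective S.incl S.incl_injective)).1 hb₁
  have hx₀1 : ((x₀ : S) : g) ∈ gr H 1 := (hgr 1 x₀).1 hx₀
  refine ⟨b, hb, ?_, ((x₀ : S) : g), hx₀1, ?_, fun y hy hτy => ?_⟩
  · rintro _ ⟨_, ⟨x, hx, rfl⟩, rfl⟩
    have hx0 : ((x : S) : g) ∈ gr H 0 := (hgr 0 x).1 (hb'0 hx)
    exact ⟨(hσ0 _ hx0).symm.trans x.2, hx0⟩
  · rw [← neg_eq_iff_eq_neg, ← hσ1 _ hx₀1]
    exact x₀.2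
  · have hyS : y ∈ S := by
      have : ⁅H, y⁆ = y := by simpa using mem_gr.1 hy
      rw [← this]
      exact lie_mem_derived H y
    have hyr : (⟨y, hyS⟩ : S) ∈ r := by
      change σ y = y
      rw [hσ1 y hy, hτy, neg_neg]
    obtain ⟨x, hx, hxy⟩ := hb'x₀ ⟨⟨y, hyS⟩, hyr⟩ ((hgr 1 _).2 hy)
    exact ⟨((x : S) : g), ⟨_, ⟨x, hx, rfl⟩, rfl⟩, congrArg (fun z : r => ((z : S) : g)) hxy⟩

end Involution

/-! ### Extremal vectors and vectors killed by products -/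

section ExtremalVector

open LieAlgebra LieModule

variable {L : Type*} [LieRing L] [LieAlgebra ℂ L]

/-- In a finite-dimensional module, a solvable subalgebra `b` that commutes with `h` has a common
eigenvector that is also an eigenvector of `h` and is killed by the elements of degree `1` with
respect to `h`: take the eigenvalue of `h` with the largest real part and apply Lie's theorem to
its eigenspace. -/
lemma exists_extremal_vector (h : L) (b : LieSubalgebra ℂ L) (hb : IsSolvable b)
    (hcomm : ∀ x ∈ b, ⁅h, x⁆ = 0) (F : Type*) [AddCommGroup F] [Module ℂ F] [LieRingModule L F]
    [LieModule ℂ L F] [Module.Finite ℂ F] [Nontrivial F] :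
    ∃ v : F, v ≠ 0 ∧ (∃ c : ℂ, ⁅h, v⁆ = c • v) ∧ (∀ x : L, ⁅h, x⁆ = x → ⁅x, v⁆ = 0) ∧
      ∀ x ∈ b, ∃ β : ℂ, ⁅x, v⁆ = β • v := by
  let A : Module.End ℂ F := toEnd ℂ L F h
  let s : Finset ℂ := (Module.End.finite_hasEigenvalue A).toFinset
  have hs : s.Nonempty := by
    obtain ⟨ν, hν⟩ := Module.End.exists_eigenvalue A
    exact ⟨ν, by simpa [s] using hν⟩
  obtain ⟨ν, hνs, hmax⟩ := s.exists_max_image Complex.re hs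
  have hν : A.HasEigenvalue ν := by simpa [s] using hνs
  let E : LieSubmodule ℂ b F :=
    { carrier := {m | ⁅h, m⁆ = ν • m}
      zero_mem' := by simp
      add_mem' := fun {p q} hp hq => by
        change ⁅h, p + q⁆ = _
        rw [lie_add, hp, hq, smul_add]
      smul_mem' := fun c p hp => by
        change ⁅h, c • p⁆ = _
        rw [lie_smul, hp, smul_comm]
      lie_mem := fun {x m} hm => by
        change ⁅h, ⁅(x : L), m⁆⁆ = ν • ⁅(x : L), m⁆
        rw [leibniz_lie, hcomm x x.2, zero_lie, zero_add, hm, lie_smul] }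
  have : Nontrivial E := by
    obtain ⟨x, hx⟩ := hν.exists_hasEigenvector
    exact ⟨⟨⟨x, hx.apply_eq_smul⟩, 0, fun h => hx.2 (congrArg (fun z : E => (z : F)) h)⟩⟩
  have hE : Module.Finite ℂ E := inferInstanceAs (Module.Finite ℂ E.toSubmodule)
  obtain ⟨μ, hμ⟩ := exists_nontrivial_weightSpace_of_isSolvable ℂ b E
  obtain ⟨⟨v, hv⟩, hv0⟩ := exists_ne (0 : weightSpace E μ)
  rw [mem_weightSpace] at hv
  have hvE : ⁅h, (v : F)⁆ = ν • (v : F) := v.2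
  refine ⟨v, fun h => hv0 (Subtype.ext (Subtype.ext h)), ⟨ν, hvE⟩, fun x hx => ?_,
    fun x hx => ⟨μ ⟨x, hx⟩, congrArg Subtype.val (hv ⟨x, hx⟩)⟩⟩
  by_contra hne
  have hev : A.HasEigenvalue (ν + 1) := by
    refine Module.End.hasEigenvalue_of_hasEigenvector (x := ⁅x, (v : F)⁆)
      ⟨Module.End.mem_eigenspace_iff.2 ?_, hne⟩
    change ⁅h, ⁅x, (v : F)⁆⁆ = _
    rw [leibniz_lie, hx, hvE, lie_smul]
    module
  have := hmax (ν + 1) (by simpa [s] using hev)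
  simp at this
  linarith

end ExtremalVector

section Graded

variable {g : Type*} [LieRing g] [LieAlgebra ℂ g]
variable {M : Type*} [AddCommGroup M] [Module ℂ M] [LieRingModule g M] [LieModule ℂ g M]
variable {H : g} {S : Submodule ℂ M}

/-- Elements of degree `1` lower the depth. -/
lemma lie_mem_words_of_gr_one (hS : ∀ x ∈ gr H 0, ∀ m ∈ S, ⁅x, m⁆ ∈ S)
    (hS1 : ∀ x ∈ gr H 1, ∀ m ∈ S, ⁅x, m⁆ = 0) (k : ℕ) :
    ∀ u ∈ gr H 1, ∀ m ∈ words (gr H (-1)) S (k + 1), ⁅u, m⁆ ∈ words (gr H (-1)) S k := by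
  intro u hu
  have hle : words (gr H (-1)) S (k + 1) ≤
      (words (gr H (-1)) S k).comap (LieModule.toEnd ℂ g M u) := by
    refine words_succ_le.2 fun y hy m hm => ?_
    rw [Submodule.mem_comap, LieModule.toEnd_apply_apply, leibniz_lie]
    refine Submodule.add_mem _
      (lie_mem_words_of_gr_zero hS k _ (by simpa using lie_mem_gr hu hy) m hm) ?_
    cases k with
    | zero => rw [hS1 u hu m hm, lie_zero]; exact Submodule.zero_mem _
    | succ k => exact lie_mem_words hy (lie_mem_words_of_gr_one hS hS1 k u hu m hm)
  exact hle

lemma lie_eq_of_mem_words {c₀ : ℂ} (hS : ∀ m ∈ S, ⁅H, m⁆ = c₀ • m) (k : ℕ) :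
    ∀ m ∈ words (gr H (-1)) S k, ⁅H, m⁆ = (c₀ - k) • m := by
  induction k with
  | zero =>
    intro m hm
    simpa using hS m hm
  | succ k ih =>
    have hle : words (gr H (-1)) S (k + 1) ≤
        (LieModule.toEnd ℂ g M H).eigenspace (c₀ - (k + 1 : ℕ)) := by
      refine words_succ_le.2 fun y hy m hm => ?_
      rw [Module.End.mem_eigenspace_iff, LieModule.toEnd_apply_apply, leibniz_lie, mem_gr.1 hy,
        ih m hm, lie_smul, smul_lie]
      push_cast
      module
    exact fun m hm => Module.End.mem_eigenspace_iff.1 (hle hm)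

/-- An eigenvector of the grading element is homogeneous. -/
lemma mem_words_of_eigenvector {c₀ : ℂ} (hS : ∀ m ∈ S, ⁅H, m⁆ = c₀ • m)
    (htop : (⨆ k, words (gr H (-1)) S k) = ⊤) (c : ℂ) :
    (∀ z : M, ⁅H, z⁆ = c • z → z = 0) ∨ ∃ k, ∀ z : M, ⁅H, z⁆ = c • z →
      z ∈ words (gr H (-1)) S k := by
  let A := LieModule.toEnd ℂ g M H
  have hle : ∀ k, words (gr H (-1)) S k ≤ A.maxGenEigenspace (c₀ - k) := fun k m hm =>
    Module.End.eigenspace_le_maxGenEigenspace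
      (Module.End.mem_eigenspace_iff.2 (lie_eq_of_mem_words hS k m hm))
  have hz : ∀ z : M, ⁅H, z⁆ = c • z → z ∈ A.maxGenEigenspace c := fun z hz =>
    Module.End.eigenspace_le_maxGenEigenspace (Module.End.mem_eigenspace_iff.2 hz)
  by_cases hc : ∃ k : ℕ, c₀ - k = c
  · obtain ⟨k, rfl⟩ := hc
    refine Or.inr ⟨k, fun z h => maxGenEigenspace_le_of_sup A (words (gr H (-1)) S k) ?_
      (fun i : {i : ℕ // i ≠ k} => c₀ - (i : ℕ)) (fun i h => i.2 (by simpa using h)) ?_ (hz z h)⟩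
    · intro m hm
      change ⁅H, m⁆ ∈ _
      rw [lie_eq_of_mem_words hS k m hm]
      exact Submodule.smul_mem _ _ hm
    · rw [eq_top_iff, ← htop]
      refine iSup_le fun i => ?_
      by_cases hi : i = k
      · rw [hi]; exact le_sup_left
      · exact le_sup_of_le_right
          ((hle i).trans (le_iSup (fun i : {i : ℕ // i ≠ k} => A.maxGenEigenspace (c₀ - (i : ℕ)))
            ⟨i, hi⟩))
  · push Not at hc
    refine Or.inl fun z h => (Submodule.mem_bot ℂ).1 (maxGenEigenspace_le_of_sup A ⊥ ?_
      (fun i : ℕ => c₀ - i) hc ?_ (hz z h))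
    · intro m hm
      rw [(Submodule.mem_bot ℂ).1 hm, map_zero]
      exact Submodule.zero_mem _
    · rw [bot_sup_eq, eq_top_iff, ← htop]
      exact iSup_mono hle

end Graded

section Annihilator

variable {g : Type*} [LieRing g] [LieAlgebra ℂ g]
variable {M : Type*} [AddCommGroup M] [Module ℂ M] [LieRingModule g M] [LieModule ℂ g M]

/-- The vectors that are killed by all products of `k` elements of `N`. -/
def annihilated (M : Type*) [AddCommGroup M] [Module ℂ M] [LieRingModule g M] [LieModule ℂ g M]
    (N : Set g) : ℕ → Submodule ℂ M
  | 0 => ⊥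
  | k + 1 => ⨅ u ∈ N, (annihilated M N k).comap (LieModule.toEnd ℂ g M u)

lemma mem_annihilated_succ {N : Set g} {k : ℕ} {z : M} :
    z ∈ annihilated M N (k + 1) ↔ ∀ u ∈ N, ⁅u, z⁆ ∈ annihilated M N k := by
  simp [annihilated]

lemma lie_mem_annihilated {N : Set g} {x : g} (hx : ∀ u ∈ N, ⁅x, u⁆ ∈ N) (k : ℕ) :
    ∀ z ∈ annihilated M N k, ⁅x, z⁆ ∈ annihilated M N k := by
  induction k with
  | zero =>
    intro z hz
    rw [(Submodule.mem_bot ℂ).1 hz, lie_zero]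
    exact Submodule.zero_mem _
  | succ k ih =>
    intro z hz
    rw [mem_annihilated_succ] at hz ⊢
    intro u hu
    have h : ⁅u, ⁅x, z⁆⁆ = ⁅x, ⁅u, z⁆⁆ - ⁅⁅x, u⁆, z⁆ := by rw [lie_lie]; abel
    rw [h]
    exact Submodule.sub_mem _ (ih _ (hz u hu)) (hz _ (hx u hu))

/-- The commutator of `x` with a power of `x₀`, if `⁅x, x₀⁆` commutes with `x₀`. -/
lemma lie_pow_apply {x x₀ : g} (hcomm : ⁅x₀, ⁅x, x₀⁆⁆ = 0) (w : M) (j : ℕ) :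
    ⁅x, (LieModule.toEnd ℂ g M x₀ ^ (j + 1)) w⁆ =
      (LieModule.toEnd ℂ g M x₀ ^ (j + 1)) ⁅x, w⁆ +
        ((j + 1 : ℕ) : ℂ) • ⁅⁅x, x₀⁆, (LieModule.toEnd ℂ g M x₀ ^ j) w⁆ := by
  have hpow : ∀ (j : ℕ) (m : M), (LieModule.toEnd ℂ g M x₀ ^ (j + 1)) m =
      ⁅x₀, (LieModule.toEnd ℂ g M x₀ ^ j) m⁆ := fun j m => by
    rw [pow_succ']
    rfl
  induction j with
  | zero =>
    rw [hpow, hpow, pow_zero, Module.End.one_apply, Module.End.one_apply, leibniz_lie]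
    simp [add_comm]
  | succ j ih =>
    have h : ⁅x₀, ⁅⁅x, x₀⁆, (LieModule.toEnd ℂ g M x₀ ^ j) w⁆⁆ =
        ⁅⁅x, x₀⁆, (LieModule.toEnd ℂ g M x₀ ^ (j + 1)) w⁆ := by
      rw [leibniz_lie, hcomm, zero_lie, zero_add, hpow]
    rw [hpow (j + 1) w, leibniz_lie, ih, lie_add, lie_smul, h, hpow (j + 1) ⁅x, w⁆]
    push_cast
    module

/-- If `[b, x₀]` contains `N`, a common eigenvector of `b` killed by `x₀ᵏ` is killed by all
products of `k` elements of `N`. -/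
lemma mem_annihilated_of_pow {b : LieSubalgebra ℂ g} {N : Set g} {x₀ : g} (hx₀ : x₀ ∈ N)
    (hN : ∀ u ∈ N, ∀ u' ∈ N, ⁅u, u'⁆ = 0) (hbN : ∀ x ∈ b, ∀ u ∈ N, ⁅x, u⁆ ∈ N)
    (hdense : ∀ u ∈ N, ∃ x ∈ b, ⁅x, x₀⁆ = u) {w : M} (hw : ∀ x ∈ b, ∃ β : ℂ, ⁅x, w⁆ = β • w)
    {k : ℕ} (hk : (LieModule.toEnd ℂ g M x₀ ^ k) w = 0) : w ∈ annihilated M N k := by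
  have key : ∀ m ≤ k, (LieModule.toEnd ℂ g M x₀ ^ (k - m)) w ∈ annihilated M N m := by
    intro m
    induction m with
    | zero =>
      intro _
      rw [Nat.sub_zero, hk]
      exact Submodule.zero_mem _
    | succ m ih =>
      intro hm
      obtain ⟨j, rfl⟩ : ∃ j, k = j + (m + 1) := ⟨k - (m + 1), by omega⟩
      have h := ih (by omega)
      rw [show j + (m + 1) - m = j + 1 by omega] at h
      rw [Nat.add_sub_cancel, mem_annihilated_succ]
      intro u hu
      obtain ⟨x, hx, rfl⟩ := hdense u hu
      obtain ⟨β, hβ⟩ := hw x hx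
      have h1 := lie_pow_apply (hN x₀ hx₀ _ hu) w j
      rw [hβ, map_smul] at h1
      have h2 : ((j + 1 : ℕ) : ℂ) ≠ 0 := Nat.cast_ne_zero.2 (Nat.succ_ne_zero j)
      rw [← inv_smul_smul₀ h2 ⁅⁅x, x₀⁆, (LieModule.toEnd ℂ g M x₀ ^ j) w⁆, ← sub_eq_iff_eq_add'.2 h1]
      exact Submodule.smul_mem _ _ (Submodule.sub_mem _
        (lie_mem_annihilated (hbN x hx) m _ h) (Submodule.smul_mem _ _ h))
  have := key k le_rfl
  rwa [Nat.sub_self, pow_zero, Module.End.one_apply] at this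

/-- If no vector of positive depth is killed by all elements of degree `1`, a vector of depth `k`
that is killed by the `τ`-invariant elements of degree `1` and by the products of `k`
`τ`-antiinvariant ones is zero. By induction, the antiinvariant elements kill it as well. -/
lemma eq_zero_of_mem_annihilated {H : g} {S : Submodule ℂ M} (hH : IsShortGrading H)
    (hS : ∀ x ∈ gr H 0, ∀ m ∈ S, ⁅x, m⁆ ∈ S) (hS1 : ∀ x ∈ gr H 1, ∀ m ∈ S, ⁅x, m⁆ = 0)
    (hsing : ∀ k, k ≠ 0 → ∀ v ∈ words (gr H (-1)) S k, (∀ x ∈ gr H 1, ⁅x, v⁆ = 0) → v = 0)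
    (τ : g ≃ₗ⁅ℂ⁆ g) (hτ : ∀ x, τ (τ x) = x) (hτH : τ H = H) (k : ℕ) :
    ∀ z ∈ words (gr H (-1)) S k, (∀ u ∈ gr H 1, τ u = u → ⁅u, z⁆ = 0) →
      z ∈ annihilated M {u | u ∈ gr H 1 ∧ τ u = -u} k → z = 0 := by
  induction k with
  | zero => exact fun z _ _ hz => (Submodule.mem_bot ℂ).1 hz
  | succ k ih =>
    intro z hz hz1 hza
    rw [mem_annihilated_succ] at hza
    have hanti : ∀ u ∈ gr H 1, τ u = -u → ⁅u, z⁆ = 0 := fun u hu hτu => by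
      refine ih _ (lie_mem_words_of_gr_one hS hS1 k u hu z hz) (fun u' hu' hτu' => ?_)
        (hza u ⟨hu, hτu⟩)
      rw [leibniz_lie, hH.lie_eq_zero (by norm_num) hu' hu, zero_lie, hz1 u' hu' hτu', lie_zero,
        add_zero]
    refine hsing (k + 1) (Nat.succ_ne_zero k) z hz fun x hx => ?_
    have hτx : τ x ∈ gr H 1 := by
      have := congrArg τ (mem_gr.1 hx)
      rwa [LieEquiv.map_lie, hτH, map_smul] at this
    have h1 := hz1 (x + τ x) (Submodule.add_mem _ hx hτx) (by rw [map_add, hτ, add_comm])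
    have h2 := hanti (x - τ x) (Submodule.sub_mem _ hx hτx) (by rw [map_sub, hτ, neg_sub])
    have h3 : ⁅x, z⁆ = (2⁻¹ : ℂ) • (⁅x + τ x, z⁆ + ⁅x - τ x, z⁆) := by
      rw [add_lie, sub_lie]
      module
    rw [h3, h1, h2, add_zero, smul_zero]

end Annihilator

/-! ### The multiplicities are at most one, and one is attained -/

section Scalar

variable {g : Type u} [LieRing g] [LieAlgebra ℂ g]
variable (p : LieSubalgebra ℂ g) (χ : LieAlgebra.LieCharacter ℂ p)

/-- The canonical generator `1 ⊗ 1` of the module induced from the character `χ`. -/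
def generator : Induced p (OneDim χ) := unit p (OneDim χ) (1 : ℂ)

lemma unit_eq_smul_generator (a : ℂ) : unit p (OneDim χ) a = a • generator p χ :=
  (congrArg (unit p (OneDim χ)) (mul_one a).symm).trans
    ((unit p (OneDim χ)).map_smul a (1 : ℂ))

lemma lie_generator (x : p) : ⁅(x : g), generator p χ⁆ = χ x • generator p χ :=
  (unit_lie p (OneDim χ) x (1 : ℂ)).symm.trans ((unit p (OneDim χ)).map_smul (χ x) (1 : ℂ))

lemma lie_mem_span_generator {x : g} (hx : x ∈ p) :
    ∀ m ∈ Submodule.span ℂ {generator p χ}, ⁅x, m⁆ ∈ Submodule.span ℂ {generator p χ} := by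
  intro m hm
  obtain ⟨c, rfl⟩ := Submodule.mem_span_singleton.1 hm
  rw [lie_smul, lie_generator p χ ⟨x, hx⟩]
  exact Submodule.smul_mem _ _ (Submodule.smul_mem _ _ (Submodule.mem_span_singleton_self _))

lemma eq_top_of_generator_mem {T : Submodule ℂ (Induced p (OneDim χ))} (h : generator p χ ∈ T)
    (hT : ∀ (x : g), ∀ m ∈ T, ⁅x, m⁆ ∈ T) : T = ⊤ :=
  eq_top_of_unit_mem p (OneDim χ) T
    (fun f => (unit_eq_smul_generator p χ f).symm ▸ T.smul_mem _ h) hT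

variable {p χ} {H : g}

lemma character_of_gr_one (h0 : gr H 0 ≤ p.toSubmodule) (h1 : gr H 1 ≤ p.toSubmodule) {x : g}
    (hx : x ∈ gr H 1) : χ ⟨x, h1 hx⟩ = 0 := by
  have hHp : H ∈ p := h0 (by rw [mem_gr]; simp)
  have h : (⟨x, h1 hx⟩ : p) = ⁅(⟨H, hHp⟩ : p), (⟨x, h1 hx⟩ : p)⁆ :=
    Subtype.ext (by rw [LieSubalgebra.coe_bracket, mem_gr.1 hx]; simp)
  rw [h, LieAlgebra.lieCharacter_apply_lie]

lemma lie_span_generator_of_gr_one (h0 : gr H 0 ≤ p.toSubmodule) (h1 : gr H 1 ≤ p.toSubmodule)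
    {x : g} (hx : x ∈ gr H 1) : ∀ m ∈ Submodule.span ℂ {generator p χ}, ⁅x, m⁆ = 0 := by
  intro m hm
  obtain ⟨c, rfl⟩ := Submodule.mem_span_singleton.1 hm
  rw [lie_smul, lie_generator p χ ⟨x, h1 hx⟩, character_of_gr_one h0 h1 hx, zero_smul, smul_zero]

lemma iSup_words_generator (hH : IsShortGrading H) (h0 : gr H 0 ≤ p.toSubmodule)
    (h1 : gr H 1 ≤ p.toSubmodule) :
    (⨆ k, words (gr H (-1)) (Submodule.span ℂ {generator p χ}) k) = ⊤ := by
  refine eq_top_of_generator_mem p χ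
    (Submodule.mem_iSup_of_mem 0 (Submodule.mem_span_singleton_self _))
    (iSup_words_stable (p := p.toSubmodule) ?_ fun x hx => lie_mem_span_generator p χ hx)
  exact eq_top_iff.2 fun x _ => hH.induction le_sup_left (h0.trans le_sup_right)
    (h1.trans le_sup_right) x

end Scalar

section Multiplicity

open LieAlgebra

variable {g : Type u} [LieRing g] [LieAlgebra ℂ g] [Module.Finite ℂ g] [HasCentralRadical ℂ g]

/-- A homomorphism is determined by the image of an extremal vector of the simple module `F'`, and
this image by the multiple of the generator that it is mapped to by a power of `x₀`. -/
theorem rank_vermaHom_le_one (g' p : LieSubalgebra ℂ g) (χ : LieCharacter ℂ p) {H : g}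
    (hH : IsShortGrading H) (hHS : H ∈ derivedSeries ℂ g 1) (hHg' : H ∈ g')
    (τ : g ≃ₗ⁅ℂ⁆ g) (hτ : ∀ x, τ (τ x) = x) (hτg' : ∀ x, x ∈ g' ↔ τ x = x)
    (h0 : gr H 0 ≤ p.toSubmodule) (h1 : gr H 1 ≤ p.toSubmodule)
    (hsing : ∀ k, k ≠ 0 → ∀ v ∈ words (gr H (-1)) (Submodule.span ℂ {generator p χ}) k,
      (∀ x ∈ gr H 1, ⁅x, v⁆ = 0) → v = 0)
    (F' : Type w) [AddCommGroup F'] [Module ℂ F'] [LieRingModule (inter g' p) F']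
    [LieModule ℂ (inter g' p) F'] [Module.Finite ℂ F']
    [LieModule.IsIrreducible ℂ (inter g' p) F'] :
    Module.rank ℂ (VermaHom g' p F' (OneDim χ)) ≤ 1 := by
  have hτH : τ H = H := (hτg' H).1 hHg'
  have hHp : H ∈ p := h0 (by rw [mem_gr]; simp)
  obtain ⟨b, hb, hb0, x₀, hx₀, hτx₀, hdense⟩ := exists_solvable_dense hH hHS τ hτ hτH
  set S : Submodule ℂ (Induced p (OneDim χ)) := Submodule.span ℂ {generator p χ}
  have hS : ∀ x ∈ gr H 0, ∀ m ∈ S, ⁅x, m⁆ ∈ S := fun x hx => lie_mem_span_generator p χ (h0 hx)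
  have hS1 : ∀ x ∈ gr H 1, ∀ m ∈ S, ⁅x, m⁆ = 0 := fun x hx =>
    lie_span_generator_of_gr_one h0 h1 hx
  have hS0 : ∀ m ∈ S, ⁅H, m⁆ = χ ⟨H, hHp⟩ • m := fun m hm => by
    obtain ⟨c, rfl⟩ := Submodule.mem_span_singleton.1 hm
    rw [lie_smul, lie_generator p χ ⟨H, hHp⟩, smul_comm]
  -- the extremal vector
  let h : inter g' p := ⟨⟨H, hHg'⟩, hHp⟩
  let b' : LieSubalgebra ℂ (inter g' p) := (b.comap g'.incl).comap (inter g' p).incl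
  have hb' : IsSolvable b' := by
    let f : b' →ₗ⁅ℂ⁆ b :=
      { toFun := fun x => ⟨(((x : inter g' p) : g') : g), x.2⟩
        map_add' := fun _ _ => rfl
        map_smul' := fun _ _ => rfl
        map_lie' := rfl }
    have hf : Function.Injective f := fun x y hxy =>
      Subtype.ext (Subtype.ext (Subtype.ext (congrArg (fun z : b => (z : g)) hxy)))
    exact hf.lieAlgebra_isSolvable
  have hF' : Nontrivial F' := (LieSubmodule.nontrivial_iff ℂ (inter g' p) F').1 inferInstance
  obtain ⟨v₀, hv₀, ⟨c, hc⟩, hn, hbv⟩ := exists_extremal_vector h b' hb' (fun x hx => by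
    refine Subtype.ext (Subtype.ext ?_)
    have := mem_gr.1 (hb0 _ hx).2
    simpa using this) F'
  let f : VermaHom g' p F' (OneDim χ) → Induced p (OneDim χ) := fun Φ => Φ (unit (inter g' p) F' v₀)
  have hlie : ∀ (Φ : VermaHom g' p F' (OneDim χ)) (x : g) (hx' : x ∈ g') (hx : x ∈ p),
      ⁅x, f Φ⁆ = Φ (unit (inter g' p) F' ⁅(⟨⟨x, hx'⟩, hx⟩ : inter g' p), v₀⁆) := by
    intro Φ x hx' hx
    rw [unit_lie, LieModuleHom.map_lie]
    rfl
  have hfH : ∀ Φ, ⁅H, f Φ⁆ = c • f Φ := fun Φ => by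
    rw [hlie Φ H hHg' hHp, hc, map_smul, map_smul]
  have hf1 : ∀ Φ, ∀ u ∈ gr H 1, τ u = u → ⁅u, f Φ⁆ = 0 := fun Φ u hu hτu => by
    rw [hlie Φ u ((hτg' u).2 hτu) (h1 hu), hn _ (Subtype.ext (Subtype.ext ?_)), map_zero, map_zero]
    have := mem_gr.1 hu
    simpa using this
  have hfb : ∀ Φ, ∀ x ∈ b, ∃ β : ℂ, ⁅x, f Φ⁆ = β • f Φ := fun Φ x hx => by
    obtain ⟨β, hβ⟩ := hbv ⟨⟨x, (hτg' x).2 (hb0 x hx).1⟩, h0 (hb0 x hx).2⟩ hx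
    exact ⟨β, by rw [hlie Φ x ((hτg' x).2 (hb0 x hx).1) (h0 (hb0 x hx).2), hβ, map_smul, map_smul]⟩
  -- the simple module `F'` is generated by `v₀`
  have hinj : ∀ Φ, f Φ = 0 → Φ = 0 := by
    intro Φ hΦ
    let K : LieSubmodule ℂ (inter g' p) F' :=
      { toSubmodule := LinearMap.ker
          ((Φ : Induced (inter g' p) F' →ₗ[ℂ] Induced p (OneDim χ)) ∘ₗ unit (inter g' p) F')
        lie_mem := fun {x m} hm => by
          change Φ (unit (inter g' p) F' m) = 0 at hm
          change Φ (unit (inter g' p) F' ⁅x, m⁆) = 0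
          rw [unit_lie, LieModuleHom.map_lie, hm, lie_zero] }
    have hK : K = ⊤ := (IsSimpleOrder.eq_bot_or_eq_top K).resolve_left fun hK =>
      hv₀ ((LieSubmodule.mem_bot (R := ℂ) (L := inter g' p) v₀).1 (hK ▸ (hΦ : v₀ ∈ K)))
    refine hom_ext_unit (inter g' p) F' fun m => ?_
    exact (hK ▸ LieSubmodule.mem_top m : m ∈ K)
  rcases mem_words_of_eigenvector hS0 (iSup_words_generator hH h0 h1) c with hz | ⟨k, hk⟩
  · have : Subsingleton (VermaHom g' p F' (OneDim χ)) :=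
      ⟨fun Φ Ψ => (hinj Φ (hz _ (hfH Φ))).trans (hinj Ψ (hz _ (hfH Ψ))).symm⟩
    rw [rank_subsingleton']
    exact zero_le_one
  · have hpow : ∀ j, ∀ m ∈ words (gr H (-1)) S j,
        (LieModule.toEnd ℂ g (Induced p (OneDim χ)) x₀ ^ j) m ∈ S := by
      intro j
      induction j with
      | zero => exact fun m hm => hm
      | succ j ih =>
        intro m hm
        rw [pow_succ, Module.End.mul_apply]
        exact ih _ (lie_mem_words_of_gr_one hS hS1 j x₀ hx₀ m hm)
    let q : VermaHom g' p F' (OneDim χ) →ₗ[ℂ] S :=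
      { toFun := fun Φ => ⟨(LieModule.toEnd ℂ g (Induced p (OneDim χ)) x₀ ^ k) (f Φ),
          hpow k _ (hk _ (hfH Φ))⟩
        map_add' := fun Φ Ψ => Subtype.ext (map_add _ (f Φ) (f Ψ))
        map_smul' := fun r Φ => Subtype.ext (map_smul _ r (f Φ)) }
    have hq : Function.Injective q := by
      refine (injective_iff_map_eq_zero q).2 fun Φ hΦ => hinj Φ ?_
      refine eq_zero_of_mem_annihilated hH hS hS1 hsing τ hτ hτH k _ (hk _ (hfH Φ)) (hf1 Φ) ?_
      refine mem_annihilated_of_pow (b := b) (N := {u | u ∈ gr H 1 ∧ τ u = -u}) ⟨hx₀, hτx₀⟩ ?_ ?_ ?_ (hfb Φ)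
        (congrArg Subtype.val hΦ)
      · exact fun u hu u' hu' => hH.lie_eq_zero (by norm_num) hu.1 hu'.1
      · intro x hx u hu
        refine ⟨by simpa using lie_mem_gr (hb0 x hx).2 hu.1, ?_⟩
        rw [LieEquiv.map_lie, (hb0 x hx).1, hu.2, lie_neg]
      · exact fun u hu => hdense u hu.1 hu.2
    have h2 := LinearMap.lift_rank_le_of_injective q hq
    have h3 : Module.rank ℂ S ≤ 1 := (rank_span_le _).trans (by simp)
    have h4 := h2.trans (Cardinal.lift_le.2 h3)
    simpa using h4

end Multiplicity

section LowerBound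

variable {g : Type u} [LieRing g] [LieAlgebra ℂ g]

/-- The restriction of the character `χ` to `p ∩ g'` is a simple module that maps to the module
induced from `χ`. -/
lemma exists_one_le_rank (g' p : LieSubalgebra ℂ g) (χ : LieAlgebra.LieCharacter ℂ p)
    (hne : generator p χ ≠ 0) :
    ∃ (F' : Type w) (_ : AddCommGroup F') (_ : Module ℂ F') (_ : LieRingModule (inter g' p) F')
      (_ : LieModule ℂ (inter g' p) F'), Module.Finite ℂ F' ∧
        LieModule.IsIrreducible ℂ (inter g' p) F' ∧
        1 ≤ Module.rank ℂ (VermaHom g' p F' (OneDim χ)) := by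
  let r : inter g' p →ₗ⁅ℂ⁆ p :=
    { toFun := fun x => ⟨((x : g') : g), x.2⟩
      map_add' := fun _ _ => rfl
      map_smul' := fun _ _ => rfl
      map_lie' := rfl }
  let _ : LieRingModule (inter g' p) (ULift.{w} ℂ) :=
    { bracket := fun x a => χ (r x) • a
      add_lie := fun x y a => by
        change χ (r (x + y)) • a = χ (r x) • a + χ (r y) • a
        rw [map_add, map_add, add_smul]
      lie_add := fun x a a' => smul_add _ _ _
      leibniz_lie := fun x y a => by
        change χ (r x) • χ (r y) • a = χ (r ⁅x, y⁆) • a + χ (r y) • χ (r x) • a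
        rw [LieHom.map_lie, LieAlgebra.lieCharacter_apply_lie, zero_smul, zero_add, smul_comm] }
  have hbr : ∀ (x : inter g' p) (a : ULift.{w} ℂ), ⁅x, a⁆ = χ (r x) • a := fun _ _ => rfl
  let _ : LieModule ℂ (inter g' p) (ULift.{w} ℂ) :=
    { smul_lie := fun c x a => by rw [hbr, hbr, map_smul, map_smul, smul_assoc]
      lie_smul := fun c x a => by rw [hbr, hbr, smul_comm] }
  refine ⟨ULift.{w} ℂ, inferInstance, inferInstance, inferInstance, inferInstance, inferInstance,
    ?_, ?_⟩
  · refine LieModule.IsIrreducible.mk fun N hN => ?_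
    obtain ⟨a, ha, ha0⟩ := (Submodule.ne_bot_iff N.toSubmodule).1 fun h =>
      hN ((LieSubmodule.toSubmodule_eq_bot N).1 h)
    have ha1 : a.down ≠ 0 := fun h => ha0 (ULift.ext _ _ h)
    refine eq_top_iff.2 fun z _ => ?_
    have hz : z = (z.down * a.down⁻¹) • a := ULift.ext _ _ (by
      change z.down = z.down * a.down⁻¹ * a.down
      rw [inv_mul_cancel_right₀ ha1])
    rw [hz]
    exact N.smul_mem _ ha
  · let ψ : ULift.{w} ℂ →ₗ[ℂ] Induced p (OneDim χ) :=
      (LinearMap.toSpanSingleton ℂ _ (generator p χ)) ∘ₗ (ULift.moduleEquiv : ULift.{w} ℂ ≃ₗ[ℂ] ℂ)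
    obtain ⟨φ, hφ⟩ := exists_hom_of_equivariant (L := g') (N := Induced p (OneDim χ)) (inter g' p)
      (ULift.{w} ℂ) ψ fun x a => by
        change (χ (r x) • a.down) • generator p χ = ⁅((r x : p) : g), a.down • generator p χ⁆
        rw [lie_smul, lie_generator, smul_smul, smul_eq_mul, mul_comm]
    have hφ0 : φ ≠ 0 := fun h => by
      have := hφ (ULift.up 1)
      rw [h] at this
      exact hne ((one_smul ℂ (generator p χ)).symm.trans this.symm)
    have : Nontrivial (VermaHom g' p (ULift.{w} ℂ) (OneDim χ)) := ⟨⟨φ, 0, hφ0⟩⟩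
    exact Cardinal.one_le_iff_pos.2 rank_pos

end LowerBound

/-! ### From hyperbolic elements to short gradings, and the uniform bound -/

section Levi

variable {g : Type u} [LieRing g] [LieAlgebra ℂ g] {H : g}

lemma mem_levi_iff {x : g} : x ∈ levi H ↔ ⁅H, x⁆ = 0 := by
  constructor
  · have : (levi H).toSubmodule ≤ LinearMap.ker (LieAlgebra.ad ℂ g H) := by
      refine eigenSum_le_iff.2 fun r hr x hx => ?_
      have hr' : r = 0 := hr
      rw [LinearMap.mem_ker, LieAlgebra.ad_apply, hx, hr', Complex.ofReal_zero, zero_smul]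
    exact fun hx => this hx
  · intro hx
    exact mem_eigenSum (S := ⟨{0}, _⟩) (r := 0) rfl (by rw [hx]; simp)

lemma levi_le_parabolic : levi H ≤ parabolic H := fun x hx =>
  mem_eigenSum (S := ⟨Set.Ici 0, _⟩) (r := 0) (le_refl (0 : ℝ)) (by rw [mem_levi_iff.1 hx]; simp)

lemma nPlus_le_parabolic : nPlus H ≤ parabolic H := by
  have hle : (nPlus H).toSubmodule ≤ (parabolic H).toSubmodule :=
    eigenSum_le_iff.2 fun r hr x hx =>
      mem_eigenSum (S := ⟨Set.Ici 0, _⟩) (show (0 : ℝ) ≤ r from (show (0 : ℝ) < r from hr).le) hx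
  exact hle

/-- The decomposition `g = n⁻(H) + l(H) + n⁺(H)`. -/
lemma IsHyperbolic.exists_components (hH : IsHyperbolic H) (x : g) :
    ∃ a ∈ nMinus H, ∃ b ∈ levi H, ∃ c ∈ nPlus H, x = a + b + c := by
  have htop : (nMinus H).toSubmodule ⊔ (levi H).toSubmodule ⊔ (nPlus H).toSubmodule = ⊤ := by
    refine hH.induction fun r x hx => ?_
    rcases lt_trichotomy r 0 with hr | hr | hr
    · exact Submodule.mem_sup_left (Submodule.mem_sup_left
        (mem_eigenSum (S := ⟨Set.Iio 0, _⟩) hr hx))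
    · exact Submodule.mem_sup_left (Submodule.mem_sup_right
        (mem_eigenSum (S := ⟨{0}, _⟩) hr hx))
    · exact Submodule.mem_sup_right (mem_eigenSum (S := ⟨Set.Ioi 0, _⟩) hr hx)
  obtain ⟨y, hy, c, hc, rfl⟩ := Submodule.mem_sup.1 (htop ▸ Submodule.mem_top : x ∈ _)
  obtain ⟨a, ha, b, hb, rfl⟩ := Submodule.mem_sup.1 hy
  exact ⟨a, ha, b, hb, c, hc, rfl⟩

end Levi

section SignGrading

variable {g : Type u} [LieRing g] [LieAlgebra ℂ g] {H H₀ : g} (hH : IsHyperbolic H)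
  (hs : ∀ (r : ℝ) (x : g), ⁅H, x⁆ = (r : ℂ) • x → ⁅H₀, x⁆ = (Real.sign r : ℂ) • x)

include hs

lemma nPlus_le_gr : (nPlus H).toSubmodule ≤ gr H₀ 1 := eigenSum_le_iff.2 fun r hr x hx => by
  rw [mem_gr, hs r x hx, Real.sign_of_pos hr]
  simp

lemma nMinus_le_gr : (nMinus H).toSubmodule ≤ gr H₀ (-1) := eigenSum_le_iff.2 fun r hr x hx => by
  rw [mem_gr, hs r x hx, Real.sign_of_neg hr]
  simp

lemma levi_le_gr : (levi H).toSubmodule ≤ gr H₀ 0 := fun x hx => by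
  have := hs 0 x (by rw [mem_levi_iff.1 hx]; simp)
  rw [mem_gr, this]
  simp

lemma parabolic_le_gr : (parabolic H).toSubmodule ≤ gr H₀ 0 ⊔ gr H₀ 1 :=
  eigenSum_le_iff.2 fun r hr x hx => by
    rcases (show (0 : ℝ) ≤ r from hr).eq_or_lt with h | h
    · refine Submodule.mem_sup_left (levi_le_gr hs (mem_levi_iff.2 ?_))
      rw [hx, ← h, Complex.ofReal_zero, zero_smul]
    · exact Submodule.mem_sup_right (nPlus_le_gr hs (mem_eigenSum (S := ⟨Set.Ioi 0, _⟩) h hx))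

include hH

lemma isShortGrading_of_sign : IsShortGrading H₀ := by
  intro x
  have h : LinearMap.eqLocus ((LieAlgebra.ad ℂ g H₀) ∘ₗ (LieAlgebra.ad ℂ g H₀) ∘ₗ
      (LieAlgebra.ad ℂ g H₀)) (LieAlgebra.ad ℂ g H₀) = ⊤ := by
    refine hH.induction fun r x hx => ?_
    change ⁅H₀, ⁅H₀, ⁅H₀, x⁆⁆⁆ = ⁅H₀, x⁆
    have hx' := hs r x hx
    rcases lt_trichotomy r 0 with hr | hr | hr
    · rw [Real.sign_of_neg hr] at hx'
      simp [hx']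
    · rw [hr, Real.sign_zero] at hx'
      simp [hx']
    · rw [Real.sign_of_pos hr] at hx'
      simp [hx']
  exact LinearMap.mem_eqLocus.1 (h ▸ Submodule.mem_top : x ∈ LinearMap.eqLocus _ _)

lemma gr_one_le_nPlus : gr H₀ 1 ≤ (nPlus H).toSubmodule := fun x hx => by
  obtain ⟨a, ha, b, hb, c, hc, rfl⟩ := hH.exists_components x
  have ha1 := mem_gr.1 (nMinus_le_gr hs ha)
  have hb1 := mem_gr.1 (levi_le_gr hs hb)
  have hc1 := mem_gr.1 (nPlus_le_gr hs hc)
  rw [mem_gr, lie_add, lie_add, ha1, hb1, hc1] at hx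
  have h1 : b + (2 : ℂ) • a = 0 := by
    have := sub_eq_zero.2 hx.symm
    rw [← this]
    push_cast
    module
  have h2 := congrArg (fun z => ⁅H₀, z⁆) h1
  simp only [lie_add, lie_smul, ha1, hb1, lie_zero] at h2
  have h3 : a = 0 := by
    have : a = -(2⁻¹ : ℂ) • (((0 : ℤ) : ℂ) • b + (2 : ℂ) • ((-1 : ℤ) : ℂ) • a) := by
      push_cast
      module
    rw [this, h2, smul_zero]
  rw [h3, smul_zero, add_zero] at h1
  rw [h3, h1, add_zero, zero_add]
  exact hc

lemma gr_zero_le_levi : gr H₀ 0 ≤ (levi H).toSubmodule := fun x hx => by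
  obtain ⟨a, ha, b, hb, c, hc, rfl⟩ := hH.exists_components x
  have ha1 := mem_gr.1 (nMinus_le_gr hs ha)
  have hb1 := mem_gr.1 (levi_le_gr hs hb)
  have hc1 := mem_gr.1 (nPlus_le_gr hs hc)
  rw [mem_gr, lie_add, lie_add, ha1, hb1, hc1] at hx
  have h1 : c - a = 0 := by
    have := sub_eq_zero.2 hx
    rw [← this]
    push_cast
    module
  have h2 := congrArg (fun z => ⁅H₀, z⁆) h1
  simp only [lie_sub, ha1, hc1, lie_zero] at h2
  rw [sub_eq_zero] at h1
  have h3 : a = 0 := by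
    have : a = (2⁻¹ : ℂ) • (((1 : ℤ) : ℂ) • c - ((-1 : ℤ) : ℂ) • a) := by
      rw [h1]
      push_cast
      module
    rw [this, h2, smul_zero]
  rw [h1, h3, add_zero, zero_add]
  exact hb

end SignGrading

section DerivedCartan

open LieAlgebra LieModule

variable {g : Type u} [LieRing g] [LieAlgebra ℂ g] [Module.Finite ℂ g] [HasCentralRadical ℂ g]

omit [Module.Finite ℂ g] [HasCentralRadical ℂ g] in
lemma center_le_cartan (j : LieSubalgebra ℂ g) [j.IsCartanSubalgebra] {z : g}
    (hz : z ∈ center ℂ g) : z ∈ j := by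
  rw [← LieSubalgebra.IsCartanSubalgebra.self_normalizing (H := j),
    LieSubalgebra.mem_normalizer_iff']
  intro y _
  rw [mem_center_iff'.1 hz]
  exact j.zero_mem

lemma exists_center_add_derived (x : g) :
    ∃ z ∈ center ℂ g, ∃ s : derivedSeries ℂ g 1, x = z + s := by
  obtain ⟨z, hz, s, hs, rfl⟩ := Submodule.mem_sup.1 (center_sup_derived (g := g) ▸
    Submodule.mem_top : x ∈ (center ℂ g).toSubmodule ⊔ (derivedSeries ℂ g 1).toSubmodule)
  exact ⟨z, hz, ⟨s, hs⟩, rfl⟩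

/-- The semisimple part `j ∩ [g, g]` of a Cartan subalgebra `j`. -/
def derivedCartan (j : LieSubalgebra ℂ g) : LieSubalgebra ℂ (derivedSeries ℂ g 1) :=
  j.comap (derivedSeries ℂ g 1).incl

lemma derivedCartan_isCartan (j : LieSubalgebra ℂ g) [j.IsCartanSubalgebra] :
    (derivedCartan j).IsCartanSubalgebra where
  nilpotent := by
    let f : derivedCartan j →ₗ⁅ℂ⁆ j :=
      { toFun := fun x => ⟨((x : derivedSeries ℂ g 1) : g), x.2⟩
        map_add' := fun _ _ => rfl
        map_smul' := fun _ _ => rfl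
        map_lie' := rfl }
    have hf : Function.Injective f := fun x y hxy =>
      Subtype.ext (Subtype.ext (congrArg (fun z : j => (z : g)) hxy))
    exact hf.lieAlgebra_isNilpotent
  self_normalizing := by
    refine le_antisymm (fun x hx => ?_) (LieSubalgebra.le_normalizer _)
    rw [LieSubalgebra.mem_normalizer_iff] at hx
    change (x : g) ∈ j
    rw [← LieSubalgebra.IsCartanSubalgebra.self_normalizing (H := j),
      LieSubalgebra.mem_normalizer_iff]
    intro y hy
    obtain ⟨z, hz, s, rfl⟩ := exists_center_add_derived y
    have hsj : (s : g) ∈ j := by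
      have := j.sub_mem hy (center_le_cartan j hz)
      rwa [add_sub_cancel_left] at this
    rw [lie_add, mem_center_iff'.1 hz, zero_add]
    exact hx s hsj

/-- For abelian `n⁺(H)` there is an element `H₀` of `j ∩ [g, g]` whose adjoint action is the sign of
that of `H`. -/
theorem exists_sign_grading_reductive {H : g} (hH : IsHyperbolic H)
    (hab : IsLieAbelian (nPlus H)) (j : LieSubalgebra ℂ g) [j.IsCartanSubalgebra]
    (hj : j ≤ levi H) :
    ∃ H₀ ∈ derivedCartan j, ∀ (r : ℝ) (x : g), ⁅H, x⁆ = (r : ℂ) • x →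
      ⁅(H₀ : g), x⁆ = (Real.sign r : ℂ) • x := by
  have hJ := derivedCartan_isCartan j
  have hHj : H ∈ j := by
    rw [← LieSubalgebra.IsCartanSubalgebra.self_normalizing (H := j),
      LieSubalgebra.mem_normalizer_iff]
    intro y hy
    rw [mem_levi_iff.1 (hj hy)]
    exact j.zero_mem
  obtain ⟨z, hz, s, hzs⟩ := exists_center_add_derived H
  have hcent : ∀ {z : g}, z ∈ center ℂ g → ∀ x : g, ⁅z, x⁆ = 0 := fun hz x => by
    rw [← lie_skew, mem_center_iff'.1 hz, neg_zero]
  have hsH : ∀ x : g, ⁅(s : g), x⁆ = ⁅H, x⁆ := fun x => by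
    rw [hzs, add_lie, hcent hz, zero_add]
  have hsJ : s ∈ derivedCartan j := by
    have := j.sub_mem hHj (center_le_cartan j hz)
    rw [hzs, add_sub_cancel_left] at this
    exact this
  have hsr : ∀ {r : ℝ} {x : derivedSeries ℂ g 1}, ⁅s, x⁆ = (r : ℂ) • x →
      ⁅H, (x : g)⁆ = (r : ℂ) • (x : g) := fun {r x} h => by
    rw [← hsH]
    exact congrArg Subtype.val h
  have habS : AbelianPositivePart s := by
    intro a b ha hb x y hx hy
    have hx' : (x : g) ∈ nPlus H := mem_eigenSum (S := ⟨Set.Ioi 0, _⟩) ha (hsr hx)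
    have hy' : (y : g) ∈ nPlus H := mem_eigenSum (S := ⟨Set.Ioi 0, _⟩) hb (hsr hy)
    have := hab.trivial ⟨x, hx'⟩ ⟨y, hy'⟩
    exact Subtype.ext (congrArg (fun z : nPlus H => (z : g)) this)
  have hreal : ∀ α : Weight ℂ (derivedCartan j) (derivedSeries ℂ g 1), (α ⟨s, hsJ⟩).im = 0 := by
    intro α
    obtain ⟨x, hx, hx0⟩ := α.exists_ne_zero
    have h := IsKilling.lie_eq_smul_of_mem_rootSpace hx ⟨s, hsJ⟩
    refine hH.2 _ (Module.End.hasEigenvalue_of_hasEigenvector (x := (x : g))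
      ⟨Module.End.mem_eigenspace_iff.2 ?_, fun h => hx0 (Subtype.ext h)⟩)
    rw [ad_apply, ← hsH]
    exact congrArg Subtype.val h
  obtain ⟨H₀, hH₀, hsign⟩ := exists_sign_grading habS hsJ hreal
  refine ⟨H₀, hH₀, fun r x hx => ?_⟩
  rcases eq_or_ne r 0 with rfl | hr
  · obtain ⟨z', hz', s', rfl⟩ := exists_center_add_derived x
    rw [lie_add, mem_center_iff'.1 hz', zero_add, Complex.ofReal_zero, zero_smul] at hx
    have h := hsign 0 s' (Subtype.ext ((hsH _).trans (by rw [hx]; simp)))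
    rw [lie_add, mem_center_iff'.1 hz', zero_add]
    have h' : ⁅(H₀ : g), (s' : g)⁆ = ((Real.sign 0 : ℝ) : ℂ) • (s' : g) := congrArg Subtype.val h
    rw [h', Real.sign_zero]
    simp
  · have hxS : x ∈ derivedSeries ℂ g 1 := by
      have hr' : (r : ℂ) ≠ 0 := Complex.ofReal_ne_zero.2 hr
      rw [← inv_smul_smul₀ hr' x, ← hx]
      exact (derivedSeries ℂ g 1).smul_mem _ (lie_mem_derived H x)
    exact congrArg Subtype.val
      (hsign r ⟨x, hxS⟩ (Subtype.ext ((hsH _).trans hx)))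

/-- An automorphism that fixes `H` fixes the sign of its grading. -/
lemma map_sign_eq {H H₀ : g} (hH : IsHyperbolic H) (hH₀ : H₀ ∈ derivedSeries ℂ g 1)
    (hs : ∀ (r : ℝ) (x : g), ⁅H, x⁆ = (r : ℂ) • x → ⁅H₀, x⁆ = (Real.sign r : ℂ) • x)
    (τ : g ≃ₗ⁅ℂ⁆ g) (hτ : ∀ x, τ (τ x) = x) (hτH : τ H = H) : τ H₀ = H₀ := by
  have hτS : (derivedSeries ℂ g 1).toSubmodule ≤
      (derivedSeries ℂ g 1).toSubmodule.comap (τ : g →ₗ[ℂ] g) :=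
    derived_le_of_lie_mem fun x y => by
      change τ ⁅x, y⁆ ∈ derivedSeries ℂ g 1
      rw [LieEquiv.map_lie]
      exact lie_mem_derived _ _
  have hker : LinearMap.ker (ad ℂ g (τ H₀ - H₀)) = ⊤ := by
    refine hH.induction fun r x hx => ?_
    have h1 : ⁅H, τ x⁆ = (r : ℂ) • τ x := by
      have := congrArg τ hx
      rwa [LieEquiv.map_lie, hτH, map_smul] at this
    have h2 := congrArg τ (hs r _ h1)
    rw [LieEquiv.map_lie, hτ, map_smul, hτ] at h2
    rw [LinearMap.mem_ker, ad_apply, sub_lie, h2, hs r x hx, sub_self]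
  refine sub_eq_zero.1 (center_inf_derived (mem_center_iff'.2 fun y => ?_)
    ((derivedSeries ℂ g 1).sub_mem (hτS hH₀) hH₀))
  have : ⁅τ H₀ - H₀, y⁆ = 0 := LinearMap.mem_ker.1 (hker ▸ Submodule.mem_top : y ∈ _)
  rw [← lie_skew, this, neg_zero]

end DerivedCartan

section Bound

open LieAlgebra LieModule

variable {g : Type u} [LieRing g] [LieAlgebra ℂ g] [Module.Finite ℂ g] [HasCentralRadical ℂ g]

/-- If `χ` is sufficiently negative, a vector of positive depth in the module induced from `χ` is
not killed by `n⁺`. -/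
theorem exists_bound_isVeryNegative {H : g} (hH : IsHyperbolic H) (j : LieSubalgebra ℂ g)
    [j.IsCartanSubalgebra] (hj : j ≤ levi H) (H₀ : derivedSeries ℂ g 1) (hH₀ : H₀ ∈ derivedCartan j)
    (hs : ∀ (r : ℝ) (x : g), ⁅H, x⁆ = (r : ℂ) • x → ⁅(H₀ : g), x⁆ = (Real.sign r : ℂ) • x) :
    ∃ C : ℝ, ∀ χ : LieCharacter ℂ (parabolic H), IsVeryNegative (parabolic H) (nPlus H) j χ C →
      ∀ k, k ≠ 0 → ∀ v ∈ words (gr (H₀ : g) (-1)) (Submodule.span ℂ {generator (parabolic H) χ}) k,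
        (∀ x ∈ gr (H₀ : g) 1, ⁅x, v⁆ = 0) → v = 0 := by
  have hJ := derivedCartan_isCartan j
  have hgr : IsShortGrading (H₀ : g) := isShortGrading_of_sign hH hs
  have hgrS : IsShortGrading H₀ := fun x => Subtype.ext (hgr (x : g))
  have hmem : ∀ (k : ℤ) (x : derivedSeries ℂ g 1), x ∈ gr H₀ k ↔ (x : g) ∈ gr (H₀ : g) k :=
    fun k x => by
      rw [mem_gr, mem_gr, Subtype.ext_iff]
      rfl
  have h0 : gr (H₀ : g) 0 ≤ (parabolic H).toSubmodule :=
    (gr_zero_le_levi hH hs).trans levi_le_parabolic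
  have h1 : gr (H₀ : g) 1 ≤ (parabolic H).toSubmodule :=
    (gr_one_le_nPlus hH hs).trans nPlus_le_parabolic
  have hjp : j ≤ parabolic H := hj.trans levi_le_parabolic
  obtain ⟨C, hC⟩ := exists_bound_singular.{u, u} hH₀ hgrS
  refine ⟨C, fun χ hχ k hk v hv hv1 => ?_⟩
  set m₀ := generator (parabolic H) χ
  let lam : Module.Dual ℂ (derivedCartan j) :=
    { toFun := fun h => χ ⟨((h : derivedSeries ℂ g 1) : g), hjp h.2⟩
      map_add' := fun h h' =>
        map_add χ (⟨((h : derivedSeries ℂ g 1) : g), hjp h.2⟩ : parabolic H)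
          (⟨((h' : derivedSeries ℂ g 1) : g), hjp h'.2⟩ : parabolic H)
      map_smul' := fun c h =>
        map_smul χ c (⟨((h : derivedSeries ℂ g 1) : g), hjp h.2⟩ : parabolic H) }
  refine hC (Induced (parabolic H) (OneDim χ)) m₀ lam ?_ ?_ ?_ ?_ ?_ k hk v ?_ ?_
  · exact fun h => lie_generator (parabolic H) χ ⟨_, hjp h.2⟩
  · exact fun x hx => ⟨_, lie_generator (parabolic H) χ ⟨x, h0 ((hmem 0 x).1 hx)⟩⟩
  · exact fun x hx => lie_span_generator_of_gr_one h0 h1 ((hmem 1 x).1 hx) _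
      (Submodule.mem_span_singleton_self _)
  · intro T hT hst
    refine eq_top_of_generator_mem (parabolic H) χ hT fun x m hm => ?_
    obtain ⟨z, hz, s, rfl⟩ := exists_center_add_derived x
    have hzp : z ∈ parabolic H := h0 (by
      rw [mem_gr, mem_center_iff'.1 hz]
      simp)
    -- the center acts by scalars
    have hzm : LinearMap.eqLocus (toEnd ℂ g (Induced (parabolic H) (OneDim χ)) z)
        (χ ⟨z, hzp⟩ • LinearMap.id) = ⊤ := by
      refine eq_top_of_generator_mem (parabolic H) χ (lie_generator (parabolic H) χ ⟨z, hzp⟩)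
        fun x m hm => ?_
      change ⁅z, m⁆ = χ ⟨z, hzp⟩ • m at hm
      change ⁅z, ⁅x, m⁆⁆ = χ ⟨z, hzp⟩ • ⁅x, m⁆
      rw [leibniz_lie, ← lie_skew z, mem_center_iff'.1 hz, neg_zero, zero_lie, zero_add, hm,
        lie_smul]
    have hzm' : ⁅z, m⁆ = χ ⟨z, hzp⟩ • m :=
      LinearMap.mem_eqLocus.1 (hzm ▸ Submodule.mem_top : m ∈ LinearMap.eqLocus _ _)
    rw [add_lie, hzm']
    exact T.add_mem (T.smul_mem _ hm) (hst s m hm)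
  · intro γ hγ
    let t := (IsKilling.cartanEquivDual (derivedCartan j)).symm γ.toLinear
    let tg : g := ((t : derivedSeries ℂ g 1) : g)
    let α : Module.Dual ℂ j := (killingForm ℂ g tg) ∘ₗ j.toSubmodule.subtype
    have hα : α ∈ weights (nPlus H) j := by
      obtain ⟨x, hx, hx0⟩ := γ.exists_ne_zero
      have hx1 : x ∈ gr H₀ 1 := by
        have h := IsKilling.lie_eq_smul_of_mem_rootSpace hx ⟨H₀, hH₀⟩
        rw [hγ] at h
        have h' : ⁅H₀, x⁆ = (1 : ℂ) • x := h
        rw [mem_gr, h']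
        simp
      refine ⟨x, gr_one_le_nPlus hH hs ((hmem 1 x).1 hx1), fun h => hx0 (Subtype.ext h),
        fun h => ?_⟩
      obtain ⟨z, hz, s, hzs⟩ := exists_center_add_derived (h : g)
      have hsJ : s ∈ derivedCartan j := by
        have := j.sub_mem h.2 (center_le_cartan j hz)
        rw [hzs, add_sub_cancel_left] at this
        exact this
      have h2 : ⁅(s : g), (x : g)⁆ = γ ⟨s, hsJ⟩ • (x : g) :=
        congrArg Subtype.val (IsKilling.lie_eq_smul_of_mem_rootSpace hx ⟨s, hsJ⟩)
      have h3 : α h = γ ⟨s, hsJ⟩ := by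
        change killingForm ℂ g tg (h : g) = _
        rw [hzs, map_add, killingForm_symm, killingForm_of_mem_center hz, zero_add]
        have h4 := killingForm_cartanEquivDual_symm γ.toLinear (⟨s, hsJ⟩ : derivedCartan j)
        rw [killingForm_derived] at h4
        exact h4
      rw [h3, hzs, add_lie, ← lie_skew, mem_center_iff'.1 hz, neg_zero, zero_add, h2]
    exact hχ α hα ⟨tg, hjp t.2⟩ ⟨t.2, (t : derivedSeries ℂ g 1).2, fun h => rfl⟩
  · have hle : ∀ k, words (gr (H₀ : g) (-1)) (Submodule.span ℂ {m₀}) k ≤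
        words (gr H₀ (-1)) (Submodule.span ℂ {m₀}) k := by
      intro k
      induction k with
      | zero => exact le_rfl
      | succ k ih =>
        refine words_succ_le.2 fun y hy m hm => ?_
        have hyS : y ∈ derivedSeries ℂ g 1 := by
          have : y = -⁅(H₀ : g), y⁆ := by
            rw [mem_gr.1 hy]
            simp
          rw [this]
          exact (derivedSeries ℂ g 1).neg_mem (lie_mem_derived _ _)
        exact lie_mem_words (y := (⟨y, hyS⟩ : derivedSeries ℂ g 1)) ((hmem (-1) _).2 hy) (ih hm)
    exact hle k hv
  · exact fun x hx => hv1 x ((hmem 1 x).1 hx)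

/-- The multiplicities in the module induced from a sufficiently negative character are at most `1`,
and `1` is attained. -/
theorem exists_isLUB_multiplicities (g' : LieSubalgebra ℂ g) (hg' : IsSymmetricPair g') {H : g}
    (hHg' : H ∈ g') (hH : IsHyperbolic H) (hab : IsLieAbelian (nPlus H)) (j : LieSubalgebra ℂ g)
    [j.IsCartanSubalgebra] (hj : j ≤ levi H) :
    ∃ C : ℝ, ∀ χ : LieCharacter ℂ (parabolic H),
      IsVeryNegative (parabolic H) (nPlus H) j χ C →
        IsLUB (multiplicities.{u, w} g' (parabolic H) χ) 1 := by
  obtain ⟨τ, hτ, hτg'⟩ := hg'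
  obtain ⟨H₀, hH₀, hs⟩ := exists_sign_grading_reductive hH hab j hj
  obtain ⟨C, hC⟩ := exists_bound_isVeryNegative hH j hj H₀ hH₀ hs
  have hgr : IsShortGrading (H₀ : g) := isShortGrading_of_sign hH hs
  have h0 : gr (H₀ : g) 0 ≤ (parabolic H).toSubmodule :=
    (gr_zero_le_levi hH hs).trans levi_le_parabolic
  have h1 : gr (H₀ : g) 1 ≤ (parabolic H).toSubmodule :=
    (gr_one_le_nPlus hH hs).trans nPlus_le_parabolic
  have hH₀g' : (H₀ : g) ∈ g' :=
    (hτg' _).2 (map_sign_eq hH H₀.2 hs τ hτ ((hτg' H).1 hHg'))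
  refine ⟨C, fun χ hχ => IsGreatest.isLUB ?_⟩
  have hle : ∀ (F' : Type w) [AddCommGroup F'] [Module ℂ F']
      [LieRingModule (inter g' (parabolic H)) F'] [LieModule ℂ (inter g' (parabolic H)) F'],
      Module.Finite ℂ F' → LieModule.IsIrreducible ℂ (inter g' (parabolic H)) F' →
        Module.rank ℂ (VermaHom g' (parabolic H) F' (OneDim χ)) ≤ 1 := fun F' _ _ _ _ _ _ =>
    rank_vermaHom_le_one g' (parabolic H) χ hgr H₀.2 hH₀g' τ hτ hτg' h0 h1 (hC χ hχ) F'
  constructor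
  · obtain ⟨F', i₁, i₂, i₃, i₄, hfin, hirr, hr⟩ := exists_one_le_rank.{u, w} g' (parabolic H) χ
      (unit_oneDim_ne_zero hgr (parabolic H) h0 h1 (parabolic_le_gr hs) χ)
    exact ⟨F', i₁, i₂, i₃, i₄, hfin, hirr, le_antisymm hr (hle F' hfin hirr)⟩
  · rintro _ ⟨F', i₁, i₂, i₃, i₄, hfin, hirr, rfl⟩
    exact hle F' hfin hirr

end Bound

end GenVerma

end

theorem proposition6p11 {g : Type u} [LieRing g] [LieAlgebra ℂ g] [Module.Finite ℂ g]
    [LieAlgebra.HasCentralRadical ℂ g]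
    (g' : LieSubalgebra ℂ g) [LieAlgebra.HasCentralRadical ℂ g']
    (p : LieSubalgebra ℂ g) (hp : GenVerma.IsCompatible g' p) :
    (∀ (F : Type v) [AddCommGroup F] [Module ℂ F] [LieRingModule p F] [LieModule ℂ p F]
        (F' : Type w) [AddCommGroup F'] [Module ℂ F']
        [LieRingModule (GenVerma.inter g' p) F'] [LieModule ℂ (GenVerma.inter g' p) F'],
        Module.Finite ℂ F → Module.Finite ℂ F' →
          Module.Finite ℂ (GenVerma.VermaHom g' p F' F)) ∧
    (GenVerma.IsSymmetricPair g' →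
      ∀ H ∈ g', GenVerma.IsHyperbolic H → p = GenVerma.parabolic H →
        IsLieAbelian (GenVerma.nPlus H) →
        ∀ j : LieSubalgebra ℂ g, j.IsCartanSubalgebra → j ≤ GenVerma.levi H →
          ∃ C : ℝ, ∀ χ : LieAlgebra.LieCharacter ℂ p,
            GenVerma.IsVeryNegative p (GenVerma.nPlus H) j χ C →
              IsLUB (GenVerma.multiplicities.{u, w} g' p χ) 1) := by
  constructor
  · intro F _ _ _ _ F' _ _ _ _ _ _
    exact GenVerma.vermaHom_finite g g' p hp F F'
  · rintro hg' H hHg' hH rfl hab j hj hjl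
    exact GenVerma.exists_isLUB_multiplicities g' hg' hHg' hH hab j hjl
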